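/- Setting. There are $n\ge 3$ bidders with click outcomes $o\in\{0,1\}^n$ drawn from a distribution $\lambda$ that is invariant under permutations of the bidders; $\lambda_k$ is the probability that exactly $k$ outcomes equal $1$. Assume that the $\lambda_k$ are rational, and that $\lambda_0>0$. A calibrated signaling $\pi$ assigns to each $o$ a probability distribution $\pi(\cdot\mid o)$ on $[0,1]^n$ such that, for $o\sim\lambda$ and $x\sim\pi(\cdot\mid o)$, $\mathbb E[o_i\mid x_i]=x_i$ almost surely for every bidder $i$. Bidder $i$ bids $x_i$ in a second-price auction with uniform tie-breaking; $\mathrm{secmax}(x)$ is the second-highest bid (with multiplicity), $\mathrm{Rev}(\pi)=\mathbb E[\mathrm{secmax}(x)]$, and $\omega_i(x)$ is the probability that $i$ wins. A calibrated signaling is (ex-ante) IR if $\mathbb E[\omega_i(x)(o_i-\mathrm{secmax}(x))]\ge 0$ for all $i$; $\mathrm{OPT}_{\mathrm{IR}}$ is the supremum of $\mathrm{Rev}$ over IR calibrated signalings, and $W=\sum_{k=1}^n\lambda_k$. Let $(a_k,b_k)_{2\le k\le n}$ be any solution of: $b_n>0$; $a_k,b_k\ge 0$ and $a_k+b_k=\frac{k-2}{k}$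 for all $k$; $\sum_{k\ge2}\lambda_k k a_k=\max\Big(\frac{\lambda_1\sum_{k\ge 2}(k-2)\lambda_k+2\lambda_1\lambda_0(1-\sqrt2)}{\lambda_1+\sqrt2\lambda_0},0\Big)$; $\sum_{k\ge2}\lambda_k k a_k+\sum_{k\ge2}\lambda_k k b_k=\sum_{k\ge2}(k-2)\lambda_k$. Put $$t_1^\star=\frac{\lambda_1+\sum_{k\ge2}\lambda_k k a_k}{2\lambda_1+\sum_{k\ge2}\lambda_k k a_k},\qquad t_0^\star=\frac{\sum_{k\ge2}\lambda_k k b_k}{2\lambda_0+\sum_{k\ge2}\lambda_k k b_k}.$$ Theorem. There is an algorithm which, for every such $n,\lambda$ and every real $\varepsilon$ with $0<\varepsilon\le\min\big(\sqrt{\lambda_1},\,4\lambda_n/\lambda_1\big)$, given $n$, $\lambda_0,\dots,\lambda_n$ and the accuracy parameter $\lceil 1/\varepsilon\rceil$, runs in time polynomial in $n$, $\sum_{k=0}^n c_k$ and $1/\varepsilon$, where $c_k$ is the bit complexity of $\lambda_k$, and outputs a succinct description of an IR calibrated signaling $\pi_{\mathrm{IR}}$. The description lists, for each $k\in\{0,\dots,n\}$,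 the finitely many bid profiles and probabilities for an outcome profile with $k$ ones, up to a random relabeling of the bidders. The linear system above is solvable, and for every solution of it: (1) If $t_0^\star\le\lambda_1(1-t_1^\star)/\lambda_0$, then $\mathrm{Rev}(\pi_{\mathrm{IR}})\ge \mathrm{OPT}_{\mathrm{IR}}-\varepsilon$. (2) If $t_0^\star>\lambda_1(1-t_1^\star)/\lambda_0$, then for all sufficiently small $\varepsilon$ the output is exactly optimal and extracts the full surplus: $\mathrm{Rev}(\pi_{\mathrm{IR}})=\mathrm{OPT}_{\mathrm{IR}}=W$. More precisely, there are $(c'_k)_{2\le k\le n}$ with $0\le c'_k\le b_k$, $c'_n<b_n$ and $\frac{\sum_{k\ge2}\lambda_k k c'_k}{2\lambda_0+\sum_{k\ge2}\lambda_k k c'_k}=\frac{\lambda_1}{\lambda_0}(1-t_1^\star)$, and for any such $(c'_k)$ it is enough that $\varepsilon\le\frac{2n\lambda_n}{\lambda_1}(b_n-c'_n)$. -/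

import Mathlib

open MeasureTheory

namespace CalibSignal

noncomputable section

/-! ### Outcome profiles, priors, signalings -/

/-- Click outcome profiles of `n` bidders. -/
abbrev Outcome (n : ℕ) : Type := Fin n → Bool

/-- The `ℓ₁`-norm of an outcome profile: the number of bidders with outcome one. -/
def ones {n : ℕ} (o : Outcome n) : ℕ := (Finset.univ.filter fun i => o i = true).card

/-- The click outcome of bidder `i` as a real number. -/
def click {n : ℕ} (o : Outcome n) (i : Fin n) : ℝ := if o i = true then 1 else 0

/-- A probability distribution on outcome profiles which is invariant under permuting bidders. -/
structure IsSymmetricPrior {n : ℕ} (lam : Outcome n → ℝ) : Prop where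
  nonneg : ∀ o, 0 ≤ lam o
  sum_eq_one : ∑ o, lam o = 1
  symm : ∀ (s : Equiv.Perm (Fin n)) (o : Outcome n), lam (fun i => o (s i)) = lam o

/-- `λ_k`: the total probability of the outcome profiles with exactly `k` ones. -/
def levelProb {n : ℕ} (lam : Outcome n → ℝ) (k : ℕ) : ℝ :=
  ∑ o ∈ Finset.univ.filter (fun o : Outcome n => ones o = k), lam o

/-- The maximum welfare `∑_{k = 1}^n λ_k`. -/
def welfare {n : ℕ} (lam : Outcome n → ℝ) : ℝ := ∑ k ∈ Finset.Icc 1 n, levelProb lam k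

/-- A candidate signaling: a measure on profiles of real signals for every outcome profile. -/
abbrev Signaling (n : ℕ) : Type := Outcome n → Measure (Fin n → ℝ)

/-- Conditionally on each outcome profile, the signal profile has a probability law on the cube. -/
def IsSignaling {n : ℕ} (p : Signaling n) : Prop :=
  ∀ o, IsProbabilityMeasure (p o) ∧ ∀ᵐ x ∂(p o), ∀ i, x i ∈ Set.Icc (0 : ℝ) 1

/-- The joint law of the outcome profile and the signal profile. -/
def jointLaw {n : ℕ} (lam : Outcome n → ℝ) (p : Signaling n) :
    Measure (Outcome n × (Fin n → ℝ)) :=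
  ∑ o, ENNReal.ofReal (lam o) • (p o).map (fun x => (o, x))

/-- Calibration: `E[o_i | x_i] = x_i` for every bidder `i`. -/
def IsCalibrated {n : ℕ} (lam : Outcome n → ℝ) (p : Signaling n) : Prop :=
  ∀ i : Fin n,
    (jointLaw lam p)[fun w => click w.1 i |
        MeasurableSpace.comap (fun w : Outcome n × (Fin n → ℝ) => w.2 i) inferInstance]
      =ᵐ[jointLaw lam p] fun w => w.2 i

/-! ### The second-price auction -/

/-- The second-highest entry of a vector, counted with multiplicity: the largest `min (x i) (x j)`
over pairs of different indices. -/
def secmax {n : ℕ} (x : Fin n → ℝ) : ℝ :=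
  ⨆ p : {p : Fin n × Fin n // p.1 ≠ p.2}, min (x p.1.1) (x p.1.2)

/-- The bidders who submit the highest bid. -/
def topBidders {n : ℕ} (x : Fin n → ℝ) : Finset (Fin n) :=
  Finset.univ.filter fun i => ∀ j, x j ≤ x i

/-- The winning probability of bidder `i` under uniform tie-breaking. -/
def winProb {n : ℕ} (x : Fin n → ℝ) (i : Fin n) : ℝ :=
  if i ∈ topBidders x then 1 / ((topBidders x).card : ℝ) else 0

/-- The expected second-highest bid, when every bidder bids the received signal. -/
def revenue {n : ℕ} (lam : Outcome n → ℝ) (p : Signaling n) : ℝ :=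
  ∫ w, secmax w.2 ∂(jointLaw lam p)

/-- The ex-ante expected utility of bidder `i`: value of the realized outcome minus price. -/
def utility {n : ℕ} (lam : Outcome n → ℝ) (p : Signaling n) (i : Fin n) : ℝ :=
  ∫ w, winProb w.2 i * (click w.1 i - secmax w.2) ∂(jointLaw lam p)

/-- The calibrated signalings which are ex-ante individually rational for every bidder. -/
def calibratedIR {n : ℕ} (lam : Outcome n → ℝ) : Set (Signaling n) :=
  {p | IsSignaling p ∧ IsCalibrated lam p ∧ ∀ i, 0 ≤ utility lam p i}

/-! ### The minimum second-highest bids -/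

/-- The linear system for `(a_k, b_k)_{2 ≤ k ≤ n}`, where `L k` stands for `λ_k`. -/
structure LinSys (n : ℕ) (L a b : ℕ → ℝ) : Prop where
  pos : 0 < b n
  nonneg_a : ∀ k ∈ Finset.Icc 2 n, 0 ≤ a k
  nonneg_b : ∀ k ∈ Finset.Icc 2 n, 0 ≤ b k
  split : ∀ k ∈ Finset.Icc 2 n, a k + b k = ((k : ℝ) - 2) / k
  sum_a : ∑ k ∈ Finset.Icc 2 n, L k * (k * a k) =
    max ((L 1 * ∑ k ∈ Finset.Icc 2 n, ((k : ℝ) - 2) * L k + 2 * L 1 * L 0 * (1 - Real.sqrt 2)) /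
      (L 1 + Real.sqrt 2 * L 0)) 0
  sum_ab : ∑ k ∈ Finset.Icc 2 n, L k * (k * a k) + ∑ k ∈ Finset.Icc 2 n, L k * (k * b k) =
    ∑ k ∈ Finset.Icc 2 n, ((k : ℝ) - 2) * L k

/-- The minimum second-highest bid `t*_1`. -/
def tOne (n : ℕ) (L a : ℕ → ℝ) : ℝ :=
  (L 1 + ∑ k ∈ Finset.Icc 2 n, L k * (k * a k)) /
    (2 * L 1 + ∑ k ∈ Finset.Icc 2 n, L k * (k * a k))

/-- The minimum second-highest bid `t*_0`. -/
def tZero (n : ℕ) (L b : ℕ → ℝ) : ℝ :=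
  (∑ k ∈ Finset.Icc 2 n, L k * (k * b k)) /
    (2 * L 0 + ∑ k ∈ Finset.Icc 2 n, L k * (k * b k))

/-- Weights `c_k ≤ b_k`, with `c_n < b_n`, which lower `t*_0` to `λ_1 (1 - t*_1) / λ_0`. -/
structure IsReduction (n : ℕ) (L a b c : ℕ → ℝ) : Prop where
  nonneg : ∀ k ∈ Finset.Icc 2 n, 0 ≤ c k
  le : ∀ k ∈ Finset.Icc 2 n, c k ≤ b k
  lt : c n < b n
  eq : tZero n L c = L 1 / L 0 * (1 - tOne n L a)

/-! ### Succinct descriptions of signalings -/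

/-- A fraction of natural numbers, not necessarily in lowest terms. -/
abbrev Frac : Type := ℕ × ℕ+

def Frac.val (r : Frac) : ℝ := (r.1 : ℝ) / ((r.2 : ℕ) : ℝ)

/-- A bid profile together with its probability. -/
structure Atom (n : ℕ) where
  weight : Frac
  bids : Fin n → Frac

/-- A succinct description of a signaling: for every `k ≤ n` a finitely supported law of bid
profiles, for the outcome profile whose first `k` bidders have outcome one. -/
abbrev Desc (n : ℕ) : Type := ℕ → List (Atom n)

/-- The relabelings of the bidders that move exactly those with outcome one to the first places. -/
def alignments {n : ℕ} (o : Outcome n) : Finset (Equiv.Perm (Fin n)) :=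
  Finset.univ.filter fun s => ∀ i, o i = true ↔ (s i : ℕ) < ones o

/-- The described signaling: given `o`, draw an atom from the list for `ones o` and a uniformly
random relabeling from `alignments o`, and send bidder `i` the bid at place `s i`. -/
def Desc.signaling {n : ℕ} (D : Desc n) : Signaling n := fun o =>
  ((alignments o).card : ENNReal)⁻¹ • ∑ s ∈ alignments o,
    ((D (ones o)).map fun A =>
      ENNReal.ofReal A.weight.val •
        (Measure.dirac (fun i => (A.bids (s i)).val) : Measure (Fin n → ℝ))).sum

def Frac.encode (r : Frac) : List ℤ := [(r.1 : ℤ), ((r.2 : ℕ) : ℤ)]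

def Atom.encode {n : ℕ} (A : Atom n) : List ℤ :=
  A.weight.encode ++ (List.ofFn A.bids).flatMap Frac.encode

/-- The description written as a sequence of integers: for `k = 0, …, n` the number of atoms,
then the atoms, each as its weight followed by its `n` bids. -/
def Desc.encode {n : ℕ} (D : Desc n) : List ℤ :=
  (List.range (n + 1)).flatMap fun k =>
    ((D k).length : ℤ) :: (D k).flatMap Atom.encode

end

/-! ### Programs and their bit cost

A small imperative language over integers with random-access arrays and an output tape.
Every operation is charged by the bit lengths of its operands (logarithmic-cost RAM), and binary
operations by the product of the bit lengths, which covers schoolbook multiplication. -/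

/-- The bit length of an integer. -/
def bitLen (z : ℤ) : ℕ := Nat.size z.natAbs

inductive BinOp where
  | plus | minus | times | quot | less

def BinOp.eval : BinOp → ℤ → ℤ → ℤ
  | .plus, x, y => x + y
  | .minus, x, y => x - y
  | .times, x, y => x * y
  | .quot, x, y => x / y
  | .less, x, y => if x < y then 1 else 0

/-- Integer expressions; `load a e` reads array `a` at index `e`. -/
inductive Expr where
  | const (z : ℤ)
  | load (a : ℕ) (e : Expr)
  | bin (f : BinOp) (e₁ e₂ : Expr)

abbrev Mem : Type := ℕ → ℤ → ℤ

def Expr.eval (m : Mem) : Expr → ℤ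
  | .const z => z
  | .load a e => m a (e.eval m)
  | .bin f e₁ e₂ => f.eval (e₁.eval m) (e₂.eval m)

/-- The bit cost of evaluating an expression. -/
def Expr.cost (m : Mem) : Expr → ℕ
  | .const z => 1 + bitLen z
  | .load a e => e.cost m + 1 + bitLen (e.eval m) + bitLen (m a (e.eval m))
  | .bin _ e₁ e₂ =>
      e₁.cost m + e₂.cost m + (1 + bitLen (e₁.eval m)) * (1 + bitLen (e₂.eval m))

/-- Programs; `store a i e` writes `e` to array `a` at index `i`, and `emit e` appends `e` to the
output tape. Tests succeed on nonzero values. -/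
inductive Prog where
  | skip
  | store (a : ℕ) (i e : Expr)
  | emit (e : Expr)
  | seq (s₁ s₂ : Prog)
  | cond (e : Expr) (s₁ s₂ : Prog)
  | loop (e : Expr) (s : Prog)

/-- The memory together with the output tape. -/
structure State where
  mem : Mem
  out : List ℤ

def Mem.write (m : Mem) (a : ℕ) (i z : ℤ) : Mem :=
  fun b j => if b = a ∧ j = i then z else m b j

/-- `Runs s σ t τ`: started in state `σ`, the program `s` halts in state `τ` at bit cost `t`. -/
inductive Runs : Prog → State → ℕ → State → Prop where
  | skip (σ : State) : Runs .skip σ 1 σ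
  | store (σ : State) (a : ℕ) (i e : Expr) :
      Runs (.store a i e) σ
        (i.cost σ.mem + e.cost σ.mem + 1 + bitLen (i.eval σ.mem) + bitLen (e.eval σ.mem))
        ⟨σ.mem.write a (i.eval σ.mem) (e.eval σ.mem), σ.out⟩
  | emit (σ : State) (e : Expr) :
      Runs (.emit e) σ (e.cost σ.mem + 1 + bitLen (e.eval σ.mem))
        ⟨σ.mem, σ.out ++ [e.eval σ.mem]⟩
  | seq {s₁ s₂ : Prog} {σ τ υ : State} {t u : ℕ} :
      Runs s₁ σ t τ → Runs s₂ τ u υ → Runs (.seq s₁ s₂) σ (t + u) υ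
  | cond_true {e : Expr} {s₁ s₂ : Prog} {σ τ : State} {t : ℕ} :
      e.eval σ.mem ≠ 0 → Runs s₁ σ t τ →
      Runs (.cond e s₁ s₂) σ (e.cost σ.mem + 1 + bitLen (e.eval σ.mem) + t) τ
  | cond_false {e : Expr} {s₁ s₂ : Prog} {σ τ : State} {t : ℕ} :
      e.eval σ.mem = 0 → Runs s₂ σ t τ →
      Runs (.cond e s₁ s₂) σ (e.cost σ.mem + 1 + t) τ
  | loop_done {e : Expr} {s : Prog} {σ : State} :
      e.eval σ.mem = 0 → Runs (.loop e s) σ (e.cost σ.mem + 1) σ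
  | loop_step {e : Expr} {s : Prog} {σ τ υ : State} {t u : ℕ} :
      e.eval σ.mem ≠ 0 → Runs s σ t τ → Runs (.loop e s) τ u υ →
      Runs (.loop e s) σ (e.cost σ.mem + 1 + bitLen (e.eval σ.mem) + t + u) υ

/-- The bit complexity of a rational number. -/
def bitComplexity (r : ℚ) : ℕ := max (Nat.size r.num.natAbs) (Nat.size r.den)

/-- The input: array `0` holds `n` and the accuracy parameter `M`, arrays `1` and `2` hold the
numerators and the denominators of `λ_0, …, λ_n`; the output tape is empty. -/
def inputState (n M : ℕ) (q : ℕ → ℚ) : State where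
  mem := fun a i =>
    match a with
    | 0 => if i = 0 then (n : ℤ) else if i = 1 then (M : ℤ) else 0
    | 1 => if 0 ≤ i ∧ i ≤ n then (q i.toNat).num else 0
    | 2 => if 0 ≤ i ∧ i ≤ n then ((q i.toNat).den : ℤ) else 0
    | _ => 0
  out := []

end CalibSignal

open CalibSignal

namespace CalibSignal

/-! Write `S` for the expected number of clicks beyond the second, so `S = ∑ (k-2) λ_k`. With two or
more clicks, let two clickers bid one; the price is one, and the remaining clicks, of mass `S`, are
free to calibrate bids made by bidders without a click. Spend `A` of them on outcomes with a single
click and `B = S - A` on outcomes with none. Two non-clickers at the zero outcome can then bid `B /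
(2λ_0 + B)`, and at a single click the clicker and one rival can bid about `(λ_1 + A) / (2λ_1 + A)`.
`splitValue` adds up these two contributions, and `IsOptSplit` says that the marginal values of `A`
and `B` agree, or that `A = 0`.

If clicker and rival bid the same, ties give the item to the wrong bidder. Hence a chain: the
clicker bids `t (j+1)` and the rival `t j`, for uniform `j`, with `t` strictly increasing from 0 to
1. A clicker on one link is calibrated against a rival on the next, topped up by surplus clicks, and
the clicker always wins. Only single-click outcomes leave utility and only zero outcomes lose it. So
the zero outcome sends its positive bids just with the largest probability that IR permits. The
revenue at outcomes with at most one click is thus the minimum of `λ_1` and the chain's value, which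
is `splitValue` up to a loss of order one over the number of links (`value_ge`).

Two upper bounds match this. IR alone gives revenue at most the welfare (`revenue_le_welfare`).
Calibration alone gives `splitValue` plus `∑_{k≥2} λ_k` by weak duality (`revenue_le_dual`): the
price function `dualPrice` is `μ / (1 - y)` capped at one half, and `exists_dual` picks the
multipliers by complementary slackness. In the first case `splitValue ≤ λ_1`, so the loss is all
that is given up. In the second, `splitValue` exceeds `λ_1` by a definite gap (`LinSys.gap`) that
absorbs the loss, and the output is exactly optimal.

The optimal `A` involves `√2`. The program finds only its cell in a grid, by comparing squares of
integers after clearing denominators, and prints every number as a fraction of polynomials in the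
data. Cost bounds come from one quantity `β` that dominates all bit lengths and loop counts. -/

/-! ### Integration against the joint law and finite mixtures. -/

theorem integral_jointLaw {n : ℕ} {lam : Outcome n → ℝ} (hlam : ∀ o, 0 ≤ lam o)
    (p : Signaling n) (G : Outcome n × (Fin n → ℝ) → ℝ)
    (hG : ∀ o, Integrable (fun x => G (o, x)) (p o)) :
    Integrable G (jointLaw lam p) ∧
      ∫ w, G w ∂(jointLaw lam p) = ∑ o, lam o * ∫ x, G (o, x) ∂(p o) := by
  have h1 : ∀ o ∈ Finset.univ,
      Integrable G (ENNReal.ofReal (lam o) • (p o).map (fun x => (o, x))) := by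
    intro o _
    refine Integrable.smul_measure ?_ ENNReal.ofReal_ne_top
    exact ((measurableEmbedding_prodMk_left o).integrable_map_iff).2 (hG o)
  refine ⟨integrable_finsetSum_measure.2 h1, ?_⟩
  rw [jointLaw, integral_finsetSum_measure h1]
  refine Finset.sum_congr rfl fun o _ => ?_
  rw [integral_smul_measure, (measurableEmbedding_prodMk_left o).integral_map,
    ENNReal.toReal_ofReal (hlam o), smul_eq_mul]

theorem isProbabilityMeasure_jointLaw {n : ℕ} {lam : Outcome n → ℝ} (hlam : IsSymmetricPrior lam)
    {p : Signaling n} (hp : ∀ o, IsProbabilityMeasure (p o)) :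
    IsProbabilityMeasure (jointLaw lam p) := by
  constructor
  have : ∀ o, (p o).map (fun x => (o, x)) Set.univ = 1 := fun o => by
    rw [Measure.map_apply measurable_prodMk_left MeasurableSet.univ]; simp
  simp only [jointLaw, Measure.coe_finsetSum, Finset.sum_apply, Measure.smul_apply, this,
    smul_eq_mul, mul_one]
  rw [← ENNReal.ofReal_sum_of_nonneg fun o _ => hlam.nonneg o, hlam.sum_eq_one, ENNReal.ofReal_one]

/-- A finite mixture of point masses. -/
noncomputable def mixture {α : Type*} [MeasurableSpace α] (l : List (ℝ × α)) : Measure α :=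
  (l.map fun A => ENNReal.ofReal A.1 • (Measure.dirac A.2 : Measure α)).sum

/-- Finitely many atoms on measurable singletons make every function integrable, so later test
functions need no measurability. -/
theorem integral_mixture {α : Type*} [MeasurableSpace α] [MeasurableSingletonClass α]
    (l : List (ℝ × α)) (hl : ∀ A ∈ l, 0 ≤ A.1) (g : α → ℝ) :
    Integrable g (mixture l) ∧ ∫ x, g x ∂(mixture l) = (l.map fun A => A.1 * g A.2).sum := by
  induction l with
  | nil => simp [mixture]
  | cons A l ih =>
    obtain ⟨h1, h2⟩ := ih fun B hB => hl B (List.mem_cons_of_mem _ hB)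
    have h3 : Integrable g (ENNReal.ofReal A.1 • (Measure.dirac A.2 : Measure α)) :=
      (integrable_dirac (by simp)).smul_measure ENNReal.ofReal_ne_top
    have h4 : mixture (A :: l) = ENNReal.ofReal A.1 • (Measure.dirac A.2 : Measure α) + mixture l := by
      simp [mixture]
    rw [h4]
    refine ⟨h3.add_measure h1, ?_⟩
    rw [integral_add_measure h3 h1, h2, integral_smul_measure, integral_dirac,
      ENNReal.toReal_ofReal (hl A (by simp))]
    simp

theorem mixture_univ {α : Type*} [MeasurableSpace α] (l : List (ℝ × α)) (hl : ∀ A ∈ l, 0 ≤ A.1) :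
    mixture l Set.univ = ENNReal.ofReal (l.map Prod.fst).sum := by
  induction l with
  | nil => simp [mixture]
  | cons A l ih =>
    have h4 : mixture (A :: l) = ENNReal.ofReal A.1 • (Measure.dirac A.2 : Measure α) + mixture l := by
      simp [mixture]
    have h5 : ∀ B ∈ l, 0 ≤ B.1 := fun B hB => hl B (List.mem_cons_of_mem _ hB)
    rw [h4, List.map_cons, List.sum_cons, ENNReal.ofReal_add (hl A (by simp))
      (List.sum_nonneg (by simpa using fun a b h => h5 _ h)), ← ih h5]
    simp

theorem ae_mixture {α : Type*} [MeasurableSpace α] [MeasurableSingletonClass α] (l : List (ℝ × α))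
    (P : α → Prop) (hl : ∀ A ∈ l, P A.2) : ∀ᵐ x ∂(mixture l), P x := by
  induction l with
  | nil => simp [mixture]
  | cons A l ih =>
    have h4 : mixture (A :: l) = ENNReal.ofReal A.1 • (Measure.dirac A.2 : Measure α) + mixture l := by
      simp [mixture]
    rw [h4, ae_add_measure_iff]
    refine ⟨?_, ih fun B hB => hl B (List.mem_cons_of_mem _ hB)⟩
    refine Measure.ae_smul_measure ?_ _
    rw [ae_dirac_eq]
    exact hl A (by simp)

/-- The law of the unpermuted bid profiles of a description, as weighted real vectors. -/
noncomputable def Desc.real {n : ℕ} (D : Desc n) (k : ℕ) : List (ℝ × (Fin n → ℝ)) :=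
  (D k).map fun A => (A.weight.val, fun i => (A.bids i).val)

/-- The list of weighted vectors after relabeling the bidders. -/
def relabel {n : ℕ} (s : Equiv.Perm (Fin n)) (l : List (ℝ × (Fin n → ℝ))) :
    List (ℝ × (Fin n → ℝ)) := l.map fun A => (A.1, fun i => A.2 (s i))

theorem Desc.signaling_eq {n : ℕ} (D : Desc n) (o : Outcome n) :
    D.signaling o = ((alignments o).card : ENNReal)⁻¹ •
      ∑ s ∈ alignments o, mixture (relabel s (D.real (ones o))) := by
  simp [Desc.signaling, mixture, relabel, Desc.real, Function.comp_def]

/-! ### Alignments -/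

/-- The outcome profile that gets aligned by `s` and has `k` ones. -/
def stdOutcome {n : ℕ} (k : ℕ) (s : Equiv.Perm (Fin n)) : Outcome n :=
  fun i => decide ((s i : ℕ) < k)

theorem ones_comp {n : ℕ} (o : Outcome n) (s : Equiv.Perm (Fin n)) :
    ones (fun i => o (s i)) = ones o := by
  unfold ones
  refine Finset.card_bij (fun i _ => s i) (by simp) (by simp) fun j hj => ⟨s.symm j, ?_⟩
  simpa using hj

theorem ones_stdOutcome {n k : ℕ} (hk : k ≤ n) (s : Equiv.Perm (Fin n)) :
    ones (stdOutcome k s) = k := by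
  have h2 : ones (fun i : Fin n => decide ((i : ℕ) < k)) = k := by
    simp [ones, Fin.card_filter_val_lt, hk]
  conv_rhs => rw [← h2, ← ones_comp _ s]
  rfl

theorem ones_le {n : ℕ} (o : Outcome n) : ones o ≤ n := by
  have := Finset.card_filter_le (Finset.univ : Finset (Fin n)) (fun i => o i = true)
  rwa [Finset.card_univ, Fintype.card_fin] at this

theorem mem_alignments_iff {n : ℕ} {o : Outcome n} {s : Equiv.Perm (Fin n)} :
    s ∈ alignments o ↔ stdOutcome (ones o) s = o := by
  simp only [alignments, Finset.mem_filter, Finset.mem_univ, true_and, stdOutcome, funext_iff]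
  refine forall_congr' fun i => ?_
  cases o i <;> simp

theorem alignments_nonempty {n : ℕ} (o : Outcome n) : (alignments o).Nonempty := by
  have h : Fintype.card {i : Fin n // o i = true} =
      Fintype.card {i : Fin n // (i : ℕ) < ones o} := by
    rw [Fintype.card_subtype, Fintype.card_subtype, Fin.card_filter_val_lt,
      min_eq_right (ones_le o)]; rfl
  let e := Fintype.equivOfCardEq h
  refine ⟨e.extendSubtype, ?_⟩
  simp only [alignments, Finset.mem_filter, Finset.mem_univ, true_and]
  intro i
  by_cases hi : o i = true
  · simpa [hi] using e.extendSubtype_mem i hi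
  · simpa [hi] using e.extendSubtype_not_mem i hi

theorem alignments_card_comp {n : ℕ} (o : Outcome n) (s : Equiv.Perm (Fin n)) :
    (alignments (fun i => o (s i))).card = (alignments o).card := by
  refine Finset.card_bij (fun t _ => s⁻¹.trans t) ?_ ?_ ?_
  · intro t ht
    simp only [alignments, Finset.mem_filter, Finset.mem_univ, true_and, ones_comp] at ht ⊢
    intro i
    simpa using ht (s⁻¹ i)
  · intro t _ u _ h
    ext i
    have := congrArg (fun e : Equiv.Perm (Fin n) => e (s i)) h
    simpa using congrArg Fin.val this
  · intro t ht
    refine ⟨s.trans t, ?_, ?_⟩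
    · simp only [alignments, Finset.mem_filter, Finset.mem_univ, true_and, ones_comp] at ht ⊢
      intro i
      simpa using ht (s i)
    · ext i; simp

/-- Outcome profiles with the same number of ones are relabelings of each other. -/
theorem exists_comp_eq {n : ℕ} {o o' : Outcome n} (h : ones o = ones o') :
    ∃ s : Equiv.Perm (Fin n), o' = fun i => o (s i) := by
  obtain ⟨s, hs⟩ := alignments_nonempty o
  obtain ⟨t, ht⟩ := alignments_nonempty o'
  rw [mem_alignments_iff] at hs ht
  refine ⟨t.trans s.symm, ?_⟩
  funext i
  rw [← ht]
  conv_rhs => rw [← hs]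
  simp [stdOutcome, h]

/-- A permutation determines the outcome with `k` ones that it aligns. Pairs of such an outcome and
one of its alignments are therefore just permutations. -/
theorem sum_alignments {n : ℕ} {β : Type*} [AddCommMonoid β] {k : ℕ} (hk : k ≤ n)
    (F : Outcome n → Equiv.Perm (Fin n) → β) :
    ∑ o ∈ Finset.univ.filter (fun o : Outcome n => ones o = k), ∑ s ∈ alignments o, F o s =
      ∑ s, F (stdOutcome k s) s := by
  rw [Finset.sum_sigma']
  refine Finset.sum_bij' (fun x _ => x.2) (fun s _ => ⟨stdOutcome k s, s⟩) ?_ ?_ ?_ ?_ ?_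
  · simp
  · intro s _
    simp [mem_alignments_iff, ones_stdOutcome hk]
  · rintro ⟨o, s⟩ h
    simp only [Finset.mem_sigma, Finset.mem_filter, Finset.mem_univ, true_and,
      mem_alignments_iff] at h
    obtain ⟨rfl, h⟩ := h
    simp [h]
  · simp
  · rintro ⟨o, s⟩ h
    simp only [Finset.mem_sigma, Finset.mem_filter, Finset.mem_univ, true_and,
      mem_alignments_iff] at h
    obtain ⟨rfl, h⟩ := h
    simp [h]

/-- Double counting: the prior and the number of alignments are constant on a level, and the level
has `n!` aligned pairs in total. -/
theorem lam_mul_inv_card {n : ℕ} {lam : Outcome n → ℝ} (hlam : IsSymmetricPrior lam)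
    (o : Outcome n) :
    lam o * ((alignments o).card : ℝ)⁻¹ = levelProb lam (ones o) / (Nat.factorial n : ℝ) := by
  have hc : ∀ o' ∈ Finset.univ.filter (fun o' : Outcome n => ones o' = ones o),
      lam o' = lam o ∧ (alignments o').card = (alignments o).card := by
    intro o' ho'
    obtain ⟨s, rfl⟩ := exists_comp_eq ((Finset.mem_filter.1 ho').2).symm
    exact ⟨hlam.symm s o, alignments_card_comp o s⟩
  have h1 := sum_alignments (ones_le o) (fun (_ : Outcome n) (_ : Equiv.Perm (Fin n)) => (1 : ℝ))
  simp only [Finset.sum_const, nsmul_eq_mul, mul_one, Finset.card_univ, Fintype.card_perm,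
    Fintype.card_fin] at h1
  rw [Finset.sum_congr rfl fun o' ho' => by rw [(hc o' ho').2], Finset.sum_const] at h1
  have h2 : levelProb lam (ones o) =
      (Finset.univ.filter (fun o' : Outcome n => ones o' = ones o)).card • lam o := by
    unfold levelProb
    rw [Finset.sum_congr rfl fun o' ho' => (hc o' ho').1, Finset.sum_const]
  have h3 : ((alignments o).card : ℝ) ≠ 0 := by
    exact_mod_cast (alignments_nonempty o).card_pos.ne'
  have h4 : (Nat.factorial n : ℝ) ≠ 0 := by positivity
  rw [h2, eq_div_iff h4, ← h1]
  simp only [nsmul_eq_mul]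
  field_simp

theorem sum_by_level {n : ℕ} {β : Type*} [AddCommMonoid β] (F : Outcome n → β) :
    ∑ o, F o = ∑ k ∈ Finset.range (n + 1),
      ∑ o ∈ Finset.univ.filter (fun o : Outcome n => ones o = k), F o := by
  rw [Finset.sum_fiberwise_of_maps_to]
  intro o _
  simpa [Nat.lt_succ_iff] using ones_le o

theorem sum_levelProb {n : ℕ} {lam : Outcome n → ℝ} (hlam : IsSymmetricPrior lam) :
    ∑ k ∈ Finset.range (n + 1), levelProb lam k = 1 := by
  rw [← hlam.sum_eq_one, sum_by_level]; rfl

theorem levelProb_nonneg {n : ℕ} {lam : Outcome n → ℝ} (hlam : IsSymmetricPrior lam) (k : ℕ) :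
    0 ≤ levelProb lam k := Finset.sum_nonneg fun o _ => hlam.nonneg o

/-! ### Expectations under a described signaling -/

theorem relabel_nonneg {n : ℕ} {l : List (ℝ × (Fin n → ℝ))} (hl : ∀ A ∈ l, 0 ≤ A.1)
    (s : Equiv.Perm (Fin n)) : ∀ A ∈ relabel s l, 0 ≤ A.1 := by
  intro A hA
  obtain ⟨B, hB, rfl⟩ := List.mem_map.1 hA
  exact hl B hB

theorem Desc.real_nonneg {n : ℕ} (D : Desc n) (k : ℕ) : ∀ A ∈ D.real k, 0 ≤ A.1 := by
  intro A hA
  obtain ⟨B, _, rfl⟩ := List.mem_map.1 hA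
  simp only [Frac.val]
  positivity

theorem Desc.integral_signaling {n : ℕ} (D : Desc n) (o : Outcome n) (g : (Fin n → ℝ) → ℝ) :
    Integrable g (D.signaling o) ∧ ∫ x, g x ∂(D.signaling o) =
      ((alignments o).card : ℝ)⁻¹ * ∑ s ∈ alignments o,
        ((D.real (ones o)).map fun A => A.1 * g (fun i => A.2 (s i))).sum := by
  have h := fun s => integral_mixture _ (relabel_nonneg (D.real_nonneg (ones o)) s) g
  have h3 : ((alignments o).card : ENNReal)⁻¹ ≠ ⊤ :=
    ENNReal.inv_ne_top.2 (by exact_mod_cast (alignments_nonempty o).card_pos.ne')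
  rw [D.signaling_eq]
  refine ⟨(integrable_finsetSum_measure.2 fun s _ => (h s).1).smul_measure h3, ?_⟩
  rw [integral_smul_measure, integral_finsetSum_measure fun s _ => (h s).1]
  simp only [(h _).2, smul_eq_mul, ENNReal.toReal_inv, ENNReal.toReal_natCast]
  simp [relabel, Function.comp_def]

/-- The joint law amounts to three draws: the level `k` by `λ_k`, an atom of its list, and a uniform
permutation of all the bidders, which fixes the outcome. -/
theorem Desc.integral_jointLaw {n : ℕ} {lam : Outcome n → ℝ} (hlam : IsSymmetricPrior lam)
    (D : Desc n) (G : Outcome n × (Fin n → ℝ) → ℝ) :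
    ∫ w, G w ∂(jointLaw lam D.signaling) = ∑ k ∈ Finset.range (n + 1), levelProb lam k *
      ((D.real k).map fun A => A.1 * ((Nat.factorial n : ℝ)⁻¹ *
        ∑ s : Equiv.Perm (Fin n), G (stdOutcome k s, fun i => A.2 (s i)))).sum := by
  rw [(CalibSignal.integral_jointLaw hlam.nonneg _ G
    fun o => (D.integral_signaling o _).1).2, sum_by_level]
  refine Finset.sum_congr rfl fun k hk => ?_
  have hk : k ≤ n := by simpa [Nat.lt_succ_iff] using hk
  have h1 : ∀ o ∈ Finset.univ.filter (fun o : Outcome n => ones o = k),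
      lam o * ∫ x, G (o, x) ∂(D.signaling o) = ∑ s ∈ alignments o,
        levelProb lam k / (Nat.factorial n : ℝ) *
          ((D.real k).map fun A => A.1 * G (o, fun i => A.2 (s i))).sum := by
    intro o ho
    have ho := (Finset.mem_filter.1 ho).2
    rw [(D.integral_signaling o _).2, ← mul_assoc, lam_mul_inv_card hlam, ho, Finset.mul_sum]
  rw [Finset.sum_congr rfl h1, sum_alignments hk, ← Finset.mul_sum, div_mul_eq_mul_div,
    mul_div_assoc]
  congr 1
  induction D.real k with
  | nil => simp
  | cons A l ih =>
    simp only [List.map_cons, List.sum_cons, Finset.sum_add_distrib, add_div, ih,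
      ← Finset.mul_sum]
    ring

/-- A uniform permutation sends a fixed bidder to a uniform place. -/
theorem sum_perm_apply {n : ℕ} (g : Fin n → ℝ) (i : Fin n) :
    (Nat.factorial n : ℝ)⁻¹ * ∑ s : Equiv.Perm (Fin n), g (s i) = (n : ℝ)⁻¹ * ∑ j, g j := by
  have hn : 0 < n := i.pos
  have h1 : ∀ i' : Fin n, ∑ s : Equiv.Perm (Fin n), g (s i') = ∑ s : Equiv.Perm (Fin n), g (s i) := by
    intro i'
    refine Fintype.sum_equiv (Equiv.mulRight (Equiv.swap i i')) _ _ fun s => ?_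
    simp
  have h2 : ∑ i' : Fin n, ∑ s : Equiv.Perm (Fin n), g (s i') = (Nat.factorial n) * ∑ j, g j := by
    rw [Finset.sum_comm]
    rw [Finset.sum_congr rfl fun s _ => Equiv.sum_comp s g]
    simp [Fintype.card_perm]
  rw [Finset.sum_congr rfl fun i' _ => h1 i'] at h2
  simp only [Finset.sum_const, Finset.card_univ, Fintype.card_fin, nsmul_eq_mul] at h2
  have : (Nat.factorial n : ℝ) ≠ 0 := by positivity
  have : (n : ℝ) ≠ 0 := by positivity
  field_simp
  linarith

/-- The expectation of a function of a bidder's own place, click and the bid profile. -/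
theorem Desc.integral_bidder {n : ℕ} {lam : Outcome n → ℝ} (hlam : IsSymmetricPrior lam)
    (D : Desc n) (i : Fin n) (G : Outcome n × (Fin n → ℝ) → ℝ)
    (g : ℕ → (Fin n → ℝ) → Fin n → ℝ)
    (hg : ∀ k s b, G (stdOutcome k s, fun j => b (s j)) = g k b (s i)) :
    ∫ w, G w ∂(jointLaw lam D.signaling) = (n : ℝ)⁻¹ * ∑ k ∈ Finset.range (n + 1),
      levelProb lam k * ((D.real k).map fun A => A.1 * ∑ j, g k A.2 j).sum := by
  rw [D.integral_jointLaw hlam, Finset.mul_sum]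
  refine Finset.sum_congr rfl fun k _ => ?_
  simp only [hg, sum_perm_apply]
  rw [mul_left_comm]
  congr 1
  rw [← List.sum_map_mul_left]
  congr 2
  funext A
  ring

theorem secmax_comp {n : ℕ} (x : Fin n → ℝ) (s : Equiv.Perm (Fin n)) :
    secmax (fun i => x (s i)) = secmax x := by
  unfold secmax
  refine Equiv.iSup_congr (Equiv.subtypeEquiv (Equiv.prodCongr s s) ?_) ?_
  · simp
  · simp

theorem mem_topBidders_comp {n : ℕ} (x : Fin n → ℝ) (s : Equiv.Perm (Fin n)) (i : Fin n) :
    i ∈ topBidders (fun i => x (s i)) ↔ s i ∈ topBidders x := by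
  simp only [topBidders, Finset.mem_filter, Finset.mem_univ, true_and]
  exact s.forall_congr_left.trans (by simp)

theorem winProb_comp {n : ℕ} (x : Fin n → ℝ) (s : Equiv.Perm (Fin n)) (i : Fin n) :
    winProb (fun i => x (s i)) i = winProb x (s i) := by
  have h : (topBidders (fun i => x (s i))).card = (topBidders x).card :=
    Finset.card_bij (fun j _ => s j) (fun j hj => (mem_topBidders_comp x s j).1 hj) (by simp)
      fun j hj => ⟨s.symm j, (mem_topBidders_comp x s _).2 (by simpa using hj), by simp⟩
  simp only [winProb, mem_topBidders_comp, h]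

/-- The click of the bidder at place `j` when `k` bidders click. -/
noncomputable def placeClick {n : ℕ} (k : ℕ) (j : Fin n) : ℝ := if (j : ℕ) < k then 1 else 0

theorem click_stdOutcome {n : ℕ} (k : ℕ) (s : Equiv.Perm (Fin n)) (i : Fin n) :
    click (stdOutcome k s) i = placeClick k (s i) := by
  simp [click, stdOutcome, placeClick]

theorem Desc.utility_eq {n : ℕ} {lam : Outcome n → ℝ} (hlam : IsSymmetricPrior lam)
    (D : Desc n) (i : Fin n) :
    utility lam D.signaling i = (n : ℝ)⁻¹ * ∑ k ∈ Finset.range (n + 1), levelProb lam k *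
      ((D.real k).map fun A =>
        A.1 * ∑ j, winProb A.2 j * (placeClick k j - secmax A.2)).sum := by
  refine D.integral_bidder hlam i _ (fun k b j => winProb b j * (placeClick k j - secmax b)) ?_
  intro k s b
  simp only [winProb_comp, click_stdOutcome, secmax_comp]

theorem Desc.revenue_eq {n : ℕ} {lam : Outcome n → ℝ} (hlam : IsSymmetricPrior lam)
    (D : Desc n) :
    revenue lam D.signaling = ∑ k ∈ Finset.range (n + 1), levelProb lam k *
      ((D.real k).map fun A => A.1 * secmax A.2).sum := by
  unfold revenue
  rw [D.integral_jointLaw hlam]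
  have : (Nat.factorial n : ℝ) ≠ 0 := by positivity
  simp only [secmax_comp, Finset.sum_const, Finset.card_univ, Fintype.card_perm, Fintype.card_fin,
    nsmul_eq_mul]
  simp [this]

theorem Desc.isSignaling {n : ℕ} (D : Desc n)
    (h1 : ∀ k ≤ n, ((D.real k).map Prod.fst).sum = 1)
    (h2 : ∀ k ≤ n, ∀ A ∈ D.real k, ∀ i, A.2 i ∈ Set.Icc (0 : ℝ) 1) : IsSignaling D.signaling := by
  intro o
  have hc : ((alignments o).card : ENNReal) ≠ 0 := by
    exact_mod_cast (alignments_nonempty o).card_pos.ne'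
  rw [D.signaling_eq]
  constructor
  · constructor
    have : ∀ s, mixture (relabel s (D.real (ones o))) Set.univ = 1 := fun s => by
      rw [mixture_univ _ (relabel_nonneg (D.real_nonneg _) s)]
      have : (relabel s (D.real (ones o))).map Prod.fst = (D.real (ones o)).map Prod.fst := by
        simp [relabel]
      rw [this, h1 _ (ones_le o), ENNReal.ofReal_one]
    simp only [Measure.smul_apply, Measure.coe_finsetSum, Finset.sum_apply, this,
      Finset.sum_const, nsmul_eq_mul, mul_one, smul_eq_mul]
    exact ENNReal.inv_mul_cancel hc (by simp)
  · refine Measure.ae_smul_measure ?_ _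
    rw [ae_finsetSum_measure_iff]
    intro s _
    refine ae_mixture _ _ fun A hA => ?_
    obtain ⟨B, hB, rfl⟩ := List.mem_map.1 hA
    exact fun i => h2 _ (ones_le o) B hB (s i)

theorem abs_click_le {n : ℕ} (o : Outcome n) (i : Fin n) : |click o i| ≤ 1 := by
  unfold click; split_ifs <;> simp

theorem measurable_click {n : ℕ} (i : Fin n) :
    Measurable (fun w : Outcome n × (Fin n → ℝ) => click w.1 i) :=
  (measurable_of_finite (fun o : Outcome n => click o i)).comp measurable_fst

theorem comap_signal_le {n : ℕ} (i : Fin n) :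
    MeasurableSpace.comap (fun w : Outcome n × (Fin n → ℝ) => w.2 i) inferInstance ≤
      (inferInstance : MeasurableSpace (Outcome n × (Fin n → ℝ))) :=
  Measurable.comap_le (by fun_prop)

theorem integrable_click {n : ℕ} (μ : Measure (Outcome n × (Fin n → ℝ))) [IsFiniteMeasure μ]
    (i : Fin n) : Integrable (fun w => click w.1 i) μ :=
  Integrable.of_bound (measurable_click i).aestronglyMeasurable 1
    (Filter.Eventually.of_forall fun w => abs_click_le w.1 i)

/-- Conditional expectation is tested on the events that the signal lies in a set, that is, with `φ`
an indicator. By symmetry the test becomes a sum over places, so one identity serves all bidders. -/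
theorem Desc.isCalibrated {n : ℕ} {lam : Outcome n → ℝ} (hlam : IsSymmetricPrior lam)
    (D : Desc n) (hD : IsSignaling D.signaling)
    (h : ∀ φ : ℝ → ℝ, ∑ k ∈ Finset.range (n + 1), levelProb lam k *
      ((D.real k).map fun A => A.1 * ∑ j, φ (A.2 j) * (placeClick k j - A.2 j)).sum = 0) :
    IsCalibrated lam D.signaling := by
  intro i
  have hp := isProbabilityMeasure_jointLaw hlam fun o => (hD o).1
  have hint : ∀ G, Integrable G (jointLaw lam D.signaling) := fun G =>
    (CalibSignal.integral_jointLaw hlam.nonneg _ G fun o => (D.integral_signaling o _).1).1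
  symm
  refine ae_eq_condExp_of_forall_setIntegral_eq (comap_signal_le i) (hint _)
    (fun s _ _ => (hint _).integrableOn) ?_ ?_
  · rintro s ⟨T, hT, rfl⟩ -
    have hs : MeasurableSet ((fun w : Outcome n × (Fin n → ℝ) => w.2 i) ⁻¹' T) :=
      (by fun_prop : Measurable fun w : Outcome n × (Fin n → ℝ) => w.2 i) hT
    rw [← integral_indicator hs, ← integral_indicator hs, eq_comm, ← sub_eq_zero,
      ← integral_sub (hint _) (hint _)]
    classical
    rw [D.integral_bidder hlam i _ (fun k b j => T.indicator 1 (b j) * (placeClick k j - b j)),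
      h, mul_zero]
    intro k s b
    by_cases hb : b (s i) ∈ T <;> simp [Set.indicator, hb, click_stdOutcome]
  · refine StronglyMeasurable.aestronglyMeasurable (Measurable.stronglyMeasurable ?_)
    exact comap_measurable _

/-- Calibration tested against a bounded function of the signal. -/
theorem IsCalibrated.integral_eq {n : ℕ} {lam : Outcome n → ℝ} {p : Signaling n}
    (hcal : IsCalibrated lam p) [IsProbabilityMeasure (jointLaw lam p)]
    (i : Fin n) (f : ℝ → ℝ) (hf : Measurable f) (c : ℝ) (hc : ∀ x, |f x| ≤ c) :
    ∫ w, f (w.2 i) * click w.1 i ∂(jointLaw lam p) = ∫ w, f (w.2 i) * w.2 i ∂(jointLaw lam p) := by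
  have hm := comap_signal_le (n := n) i
  rw [← integral_condExp hm]
  refine integral_congr_ae ?_
  have h1 : StronglyMeasurable[MeasurableSpace.comap
      (fun w : Outcome n × (Fin n → ℝ) => w.2 i) inferInstance]
      (fun w : Outcome n × (Fin n → ℝ) => f (w.2 i)) :=
    (hf.comp (comap_measurable _)).stronglyMeasurable
  have h2 := condExp_stronglyMeasurable_mul_of_bound hm h1
    (integrable_click (jointLaw lam p) i) c (Filter.Eventually.of_forall fun w => hc _)
  filter_upwards [h2, hcal i] with w hw hw'
  have : (fun w : Outcome n × (Fin n → ℝ) => f (w.2 i) * click w.1 i) =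
    (fun w => f (w.2 i)) * fun w => click w.1 i := rfl
  rw [this, hw, Pi.mul_apply, hw']

/-! ### The second-highest bid -/

theorem min_le_secmax {n : ℕ} (x : Fin n → ℝ) {i j : Fin n} (h : i ≠ j) :
    min (x i) (x j) ≤ secmax x :=
  le_ciSup (f := fun p : {p : Fin n × Fin n // p.1 ≠ p.2} => min (x p.1.1) (x p.1.2))
    (Set.finite_range _).bddAbove ⟨(i, j), h⟩

theorem exists_secmax_eq {n : ℕ} (hn : 2 ≤ n) (x : Fin n → ℝ) :
    ∃ i j : Fin n, i ≠ j ∧ secmax x = min (x i) (x j) := by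
  have : Nonempty {p : Fin n × Fin n // p.1 ≠ p.2} :=
    ⟨⟨(⟨0, by omega⟩, ⟨1, by omega⟩), by simp⟩⟩
  obtain ⟨p, hp⟩ := exists_eq_ciSup_of_finite
    (f := fun p : {p : Fin n × Fin n // p.1 ≠ p.2} => min (x p.1.1) (x p.1.2))
  exact ⟨p.1.1, p.1.2, p.2, hp.symm⟩

theorem secmax_eq {n : ℕ} (x : Fin n → ℝ) (v : ℝ) {i j : Fin n} (hij : i ≠ j)
    (h : min (x i) (x j) = v) (hle : ∀ a b, a ≠ b → min (x a) (x b) ≤ v) : secmax x = v := by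
  refine le_antisymm ?_ (h ▸ min_le_secmax x hij)
  have : Nonempty {p : Fin n × Fin n // p.1 ≠ p.2} := ⟨⟨(i, j), hij⟩⟩
  exact ciSup_le fun p => hle _ _ p.2

theorem secmax_mem_Icc {n : ℕ} (hn : 2 ≤ n) (x : Fin n → ℝ) (hx : ∀ i, x i ∈ Set.Icc (0 : ℝ) 1) :
    secmax x ∈ Set.Icc (0 : ℝ) 1 := by
  obtain ⟨i, j, _, h⟩ := exists_secmax_eq hn x
  rw [h]
  exact ⟨le_min (hx i).1 (hx j).1, (min_le_left _ _).trans (hx i).2⟩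

theorem measurable_secmax {n : ℕ} : Measurable (secmax : (Fin n → ℝ) → ℝ) := by
  unfold secmax
  refine Measurable.iSup fun p => ?_
  fun_prop

theorem measurable_winProb {n : ℕ} (i : Fin n) :
    Measurable (fun x : Fin n → ℝ => winProb x i) := by
  have hs : ∀ l, MeasurableSet {x : Fin n → ℝ | ∀ j, x j ≤ x l} := fun l => by
    simp only [Set.ofPred_forall]
    exact MeasurableSet.iInter fun j => measurableSet_le (by fun_prop) (by fun_prop)
  -- Writing the number of top bidders as a sum of indicators makes it visibly measurable.
  have h : (fun x : Fin n → ℝ => winProb x i) = fun x =>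
      Set.indicator {x : Fin n → ℝ | ∀ j, x j ≤ x i} (fun x => 1 / ∑ l,
        Set.indicator {x : Fin n → ℝ | ∀ j, x j ≤ x l} (fun _ => (1 : ℝ)) x) x := by
    funext x
    simp only [winProb, topBidders, Finset.mem_filter, Finset.mem_univ, true_and,
      Set.indicator_apply, Set.mem_ofPred_eq, Finset.card_filter]
    push_cast
    rfl
  rw [h]
  refine Measurable.indicator ?_ (hs i)
  refine measurable_const.div (Finset.measurable_sum _ fun l _ => measurable_const.indicator (hs l))

theorem topBidders_nonempty {n : ℕ} (hn : 0 < n) (x : Fin n → ℝ) : (topBidders x).Nonempty := by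
  have : Nonempty (Fin n) := ⟨⟨0, hn⟩⟩
  obtain ⟨i, hi⟩ := Finite.exists_max x
  exact ⟨i, by simpa [topBidders] using hi⟩

theorem sum_winProb {n : ℕ} (hn : 0 < n) (x : Fin n → ℝ) : ∑ i, winProb x i = 1 := by
  have : ((topBidders x).card : ℝ) ≠ 0 := by
    exact_mod_cast (topBidders_nonempty hn x).card_pos.ne'
  simp [winProb, this]

theorem winProb_nonneg {n : ℕ} (x : Fin n → ℝ) (i : Fin n) : 0 ≤ winProb x i := by
  unfold winProb; split_ifs <;> positivity

theorem winProb_le_one {n : ℕ} (x : Fin n → ℝ) (i : Fin n) : winProb x i ≤ 1 :=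
  (Finset.single_le_sum (f := winProb x) (fun j _ => winProb_nonneg x j) (Finset.mem_univ i)).trans
    (sum_winProb i.pos x).le

/-! ### Revenue is at most the welfare -/

theorem ae_jointLaw_mem_Icc {n : ℕ} {lam : Outcome n → ℝ} {p : Signaling n} (hp : IsSignaling p) :
    ∀ᵐ w ∂(jointLaw lam p), ∀ i, w.2 i ∈ Set.Icc (0 : ℝ) 1 := by
  rw [jointLaw, ae_finsetSum_measure_iff]
  intro o _
  refine Measure.ae_smul_measure ?_ _
  rw [(measurableEmbedding_prodMk_left o).ae_map_iff]
  exact (hp o).2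

theorem integrable_of_abs_le {n : ℕ} {lam : Outcome n → ℝ} {p : Signaling n}
    [IsFiniteMeasure (jointLaw lam p)] (hp : IsSignaling p)
    {G : Outcome n × (Fin n → ℝ) → ℝ} (hG : Measurable G) (c : ℝ)
    (hc : ∀ w, (∀ i, w.2 i ∈ Set.Icc (0 : ℝ) 1) → |G w| ≤ c) : Integrable G (jointLaw lam p) :=
  Integrable.of_bound hG.aestronglyMeasurable c
    ((ae_jointLaw_mem_Icc hp).mono fun w hw => hc w hw)

theorem integral_jointLaw_le {n : ℕ} {lam : Outcome n → ℝ} (hlam : IsSymmetricPrior lam)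
    {p : Signaling n} (hp : IsSignaling p) {G : Outcome n × (Fin n → ℝ) → ℝ} (hG : Measurable G)
    (c : ℝ) (hc : ∀ w, (∀ i, w.2 i ∈ Set.Icc (0 : ℝ) 1) → |G w| ≤ c) (g : ℕ → ℝ)
    (hg : ∀ o x, (∀ i, x i ∈ Set.Icc (0 : ℝ) 1) → G (o, x) ≤ g (ones o)) :
    ∫ w, G w ∂(jointLaw lam p) ≤ ∑ k ∈ Finset.range (n + 1), levelProb lam k * g k := by
  have hint : ∀ o, Integrable (fun x => G (o, x)) (p o) := fun o => by
    have := (hp o).1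
    exact Integrable.of_bound (hG.comp measurable_prodMk_left).aestronglyMeasurable c
      ((hp o).2.mono fun x hx => hc (o, x) hx)
  rw [(integral_jointLaw hlam.nonneg p G hint).2, sum_by_level]
  refine Finset.sum_le_sum fun k _ => ?_
  unfold levelProb
  rw [Finset.sum_mul]
  refine Finset.sum_le_sum fun o ho => mul_le_mul_of_nonneg_left ?_ (hlam.nonneg o)
  have := (hp o).1
  calc ∫ x, G (o, x) ∂(p o) ≤ ∫ _, g k ∂(p o) := by
        refine integral_mono_ae (hint o) (integrable_const _) ((hp o).2.mono fun x hx => ?_)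
        rw [← (Finset.mem_filter.1 ho).2]
        exact hg o x hx
    _ = g k := by simp

theorem click_mem {n : ℕ} (o : Outcome n) (i : Fin n) : 0 ≤ click o i ∧ click o i ≤ 1 := by
  unfold click; split_ifs <;> norm_num

theorem sum_range_eq_welfare {n : ℕ} (lam : Outcome n → ℝ) :
    ∑ k ∈ Finset.range (n + 1), levelProb lam k * (if k = 0 then 0 else 1) = welfare lam := by
  have h : Finset.Icc 1 n = (Finset.range (n + 1)).erase 0 := by
    ext k; simp [Nat.one_le_iff_ne_zero]
  rw [welfare, h, ← Finset.sum_erase (a := 0) _ (by simp)]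
  refine Finset.sum_congr rfl fun k hk => ?_
  rw [if_neg (Finset.ne_of_mem_erase hk), mul_one]

/-- Winning probabilities add up to one, so the utilities add up to the expected click of the winner
minus the revenue. That click is zero if nobody clicks and at most one otherwise. -/
theorem revenue_le_welfare {n : ℕ} (hn : 2 ≤ n) {lam : Outcome n → ℝ} (hlam : IsSymmetricPrior lam)
    {p : Signaling n} (hp : p ∈ calibratedIR lam) : revenue lam p ≤ welfare lam := by
  obtain ⟨hs, -, hu⟩ := hp
  have hprob := isProbabilityMeasure_jointLaw hlam fun o => (hs o).1
  have hmc : ∀ i, Measurable fun w : Outcome n × (Fin n → ℝ) => winProb w.2 i * click w.1 i :=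
    fun i => ((measurable_winProb i).comp measurable_snd).mul (measurable_click i)
  have hms : Measurable fun w : Outcome n × (Fin n → ℝ) => secmax w.2 :=
    measurable_secmax.comp measurable_snd
  have hmu : ∀ i, Measurable fun w : Outcome n × (Fin n → ℝ) =>
      winProb w.2 i * (click w.1 i - secmax w.2) := fun i =>
    ((measurable_winProb i).comp measurable_snd).mul ((measurable_click i).sub hms)
  have hiu : ∀ i, Integrable (fun w : Outcome n × (Fin n → ℝ) =>
      winProb w.2 i * (click w.1 i - secmax w.2)) (jointLaw lam p) := fun i => by
    refine integrable_of_abs_le hs (hmu i) 1 fun w hw => ?_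
    have h1 := secmax_mem_Icc hn w.2 hw
    have h2 := click_mem w.1 i
    rw [abs_mul]
    refine mul_le_one₀ ?_ (abs_nonneg _) (abs_le.2 ⟨by linarith [h1.2], by linarith [h1.1]⟩)
    rw [abs_of_nonneg (winProb_nonneg _ _)]
    exact winProb_le_one _ _
  have hsum : ∀ w : Outcome n × (Fin n → ℝ), (∀ i, w.2 i ∈ Set.Icc (0 : ℝ) 1) →
      0 ≤ ∑ i, winProb w.2 i * click w.1 i ∧ ∑ i, winProb w.2 i * click w.1 i ≤ 1 := fun w _ => by
    refine ⟨Finset.sum_nonneg fun i _ => mul_nonneg (winProb_nonneg _ _) (click_mem _ _).1, ?_⟩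
    rw [← sum_winProb (by omega : 0 < n) w.2]
    exact Finset.sum_le_sum fun i _ =>
      mul_le_of_le_one_right (winProb_nonneg _ _) (click_mem _ _).2
  have h0 : 0 ≤ ∫ w, ∑ i, winProb w.2 i * (click w.1 i - secmax w.2) ∂(jointLaw lam p) := by
    rw [integral_finsetSum _ fun i _ => hiu i]
    exact Finset.sum_nonneg fun i _ => hu i
  have h1 : ∀ w : Outcome n × (Fin n → ℝ), ∑ i, winProb w.2 i * (click w.1 i - secmax w.2) =
      ∑ i, winProb w.2 i * click w.1 i - secmax w.2 := fun w => by
    simp only [mul_sub, Finset.sum_sub_distrib, ← Finset.sum_mul, sum_winProb (by omega : 0 < n),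
      one_mul]
  simp only [h1] at h0
  rw [integral_sub (integrable_of_abs_le hs (Finset.measurable_sum _ fun i _ => hmc i) 1
      fun w hw => abs_le.2 ⟨by linarith [(hsum w hw).1], (hsum w hw).2⟩)
    (integrable_of_abs_le hs hms 1 fun w hw => by
      have := secmax_mem_Icc hn w.2 hw
      exact abs_le.2 ⟨by linarith [this.1], this.2⟩)] at h0
  rw [← sum_range_eq_welfare]
  refine (sub_nonneg.1 h0).trans (integral_jointLaw_le hlam hs
    (Finset.measurable_sum _ fun i _ => hmc i) 1
    (fun w hw => abs_le.2 ⟨by linarith [(hsum w hw).1], (hsum w hw).2⟩) _ ?_)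
  intro o x hx
  dsimp only
  split_ifs with h
  · have : ∀ i, click o i = 0 := fun i => by
      simp only [ones, Finset.card_eq_zero, Finset.filter_eq_empty_iff] at h
      simp [click, h (Finset.mem_univ i)]
    simp [this]
  · exact (hsum (o, x) hx).2

/-! ### The dual bound -/

/-- The dual price function for the calibration constraints. -/
noncomputable def dualPrice (μ y : ℝ) : ℝ := if y < 1 - 2 * μ then μ / (1 - y) else 1 / 2

theorem measurable_dualPrice (μ : ℝ) : Measurable (dualPrice μ) := by
  unfold dualPrice
  exact Measurable.ite measurableSet_Iio (by fun_prop) measurable_const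

section
variable {μ y : ℝ}

theorem dualPrice_nonneg (hμ : 0 ≤ μ) : 0 ≤ dualPrice μ y := by
  unfold dualPrice
  split_ifs with h
  · exact div_nonneg hμ (by linarith)
  · norm_num

theorem dualPrice_le (hμ : 0 ≤ μ) : dualPrice μ y ≤ 1 / 2 := by
  unfold dualPrice
  split_ifs with h
  · rw [div_le_iff₀ (by linarith)]; linarith
  · exact le_rfl

theorem dualPrice_mul_of_lt (hμ : 0 ≤ μ) (h : y < 1 - 2 * μ) : dualPrice μ y * (1 - y) = μ := by
  rw [dualPrice, if_pos h, div_mul_cancel₀]; linarith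

theorem dualPrice_of_ge (h : 1 - 2 * μ ≤ y) : dualPrice μ y = 1 / 2 := by
  rw [dualPrice, if_neg (not_lt.2 h)]

theorem dualPrice_mul_le (hμ : 0 ≤ μ) : dualPrice μ y * (1 - y) ≤ μ := by
  rcases lt_or_ge y (1 - 2 * μ) with h | h
  · exact (dualPrice_mul_of_lt hμ h).le
  · rw [dualPrice_of_ge h]; linarith

theorem dualPrice_mono (hμ : 0 ≤ μ) {x : ℝ} (h : y ≤ x) : dualPrice μ y ≤ dualPrice μ x := by
  rcases lt_or_ge x (1 - 2 * μ) with hx | hx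
  · rw [dualPrice, dualPrice, if_pos hx, if_pos (h.trans_lt hx)]
    exact div_le_div_of_nonneg_left hμ (by linarith) (by linarith)
  · rw [dualPrice_of_ge hx]; exact dualPrice_le hμ

theorem dualPrice_mul_anti (hμ : 0 ≤ μ) {x : ℝ} (h : y ≤ x) :
    dualPrice μ x * (1 - x) ≤ dualPrice μ y * (1 - y) := by
  rcases lt_or_ge y (1 - 2 * μ) with hy | hy
  · rw [dualPrice_mul_of_lt hμ hy]; exact dualPrice_mul_le hμ
  · rw [dualPrice_of_ge hy, dualPrice_of_ge (hy.trans h)]; linarith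

/-- Below the cap the gap is `(1 - y - s)^2 / (1 - y)`, which vanishes at the bid `y = 1 - s` of the
zero outcome. At the cap the left side is zero. -/
theorem sub_two_mul_dualPrice_le {s : ℝ} (hsμ : s ^ 2 = 2 * μ) :
    y - 2 * (y * dualPrice μ y) ≤ (1 - s) ^ 2 := by
  have hμ : 0 ≤ μ := by nlinarith
  rcases lt_or_ge y (1 - 2 * μ) with hy | hy
  · have h1 := dualPrice_mul_of_lt hμ hy
    have h2 : 0 < 1 - y := by linarith
    have h3 : dualPrice μ y = μ / (1 - y) := by field_simp; linarith
    rw [h3]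
    have h4 : (1 - s) ^ 2 - (y - 2 * (y * (μ / (1 - y)))) = (1 - y - s) ^ 2 / (1 - y) := by
      field_simp
      have : μ = s ^ 2 / 2 := by linarith
      rw [this]; ring
    have h5 : 0 ≤ (1 - y - s) ^ 2 / (1 - y) := by positivity
    linarith
  · rw [dualPrice_of_ge hy]
    nlinarith [sq_nonneg (1 - s)]

end

theorem sum_click {n : ℕ} (o : Outcome n) : ∑ i, click o i = ones o := by
  simp [click, ones]

/-- The pointwise bound behind weak duality. -/
theorem secmax_add_dual_le {n : ℕ} (hn : 2 ≤ n) {μ s γ : ℝ} (hsμ : s ^ 2 = 2 * μ) (hγ : ∀ y ∈ Set.Icc (0 : ℝ) 1, y + dualPrice μ y * (1 - 2 * y) ≤ γ)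
    (hγ1 : (1 - s) ^ 2 + μ ≤ γ) (hγ2 : γ + μ ≤ 1) (o : Outcome n) (x : Fin n → ℝ)
    (hx : ∀ i, x i ∈ Set.Icc (0 : ℝ) 1) :
    secmax x + ∑ i, dualPrice μ (x i) * (click o i - x i) ≤
      if ones o = 0 then (1 - s) ^ 2 else if ones o = 1 then γ else 1 + ((ones o : ℝ) - 2) * μ := by
  have hμ : 0 ≤ μ := by nlinarith
  obtain ⟨i, j, hij, hsec⟩ := exists_secmax_eq hn x
  have hy := secmax_mem_Icc hn x hx
  set y := secmax x with hydef
  have hi : y ≤ x i := hsec ▸ min_le_left _ _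
  have hj : y ≤ x j := hsec ▸ min_le_right _ _
  -- Charging `μ` for each click makes every summand nonpositive (`hall`). For a bid of at least
  -- `y`, monotonicity allows replacing the bid by `y`.
  have htop : ∀ l, y ≤ x l → dualPrice μ (x l) * (click o l - x l) - μ * click o l ≤
      if o l = true then dualPrice μ y * (1 - y) - μ else - (y * dualPrice μ y) := by
    intro l hl
    unfold click
    split_ifs with h
    · have := dualPrice_mul_anti hμ hl
      linarith
    · have h1 := dualPrice_mono hμ hl
      have h2 := dualPrice_nonneg (y := y) hμ
      nlinarith [hy.1]
  have hall : ∀ l, dualPrice μ (x l) * (click o l - x l) - μ * click o l ≤ 0 := by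
    intro l
    unfold click
    split_ifs with h
    · have := dualPrice_mul_le (y := x l) hμ
      linarith
    · nlinarith [dualPrice_nonneg (y := x l) hμ, (hx l).1]
  -- Only the two bidders who determine the second-highest bid are kept.
  have hsum : ∑ l, dualPrice μ (x l) * (click o l - x l) ≤ μ * ones o +
      (dualPrice μ (x i) * (click o i - x i) - μ * click o i) +
      (dualPrice μ (x j) * (click o j - x j) - μ * click o j) := by
    have h1 : ∑ l, (dualPrice μ (x l) * (click o l - x l) - μ * click o l) ≤
        ∑ l ∈ {i, j}, (dualPrice μ (x l) * (click o l - x l) - μ * click o l) := by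
      rw [← Finset.sum_sdiff (Finset.subset_univ {i, j})]
      have := Finset.sum_nonpos fun l (_ : l ∈ Finset.univ \ {i, j}) => hall l
      linarith
    rw [Finset.sum_pair hij, Finset.sum_sub_distrib, ← Finset.mul_sum, sum_click] at h1
    linarith
  have hti := htop i hi
  have htj := htop j hj
  -- `b0`, `b1` and `b2` bound the price plus the terms of `i` and `j` when none, one or both of
  -- them clicked. Clicks elsewhere cost `μ` each and are absorbed by `hγ1`, `hγ2` and `b3`.
  have b0 := sub_two_mul_dualPrice_le (y := y) hsμ
  have b1 := hγ y hy
  have b2 : dualPrice μ y * (1 - y) ≤ (1 - y) / 2 := by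
    have := dualPrice_le (y := y) hμ
    nlinarith [hy.2]
  have b3 : (1 - s) ^ 2 + 2 * μ ≤ 1 := by nlinarith
  have hcount : click o i + click o j ≤ ones o := by
    rw [← sum_click o, ← Finset.sum_pair (f := click o) hij]
    exact Finset.sum_le_sum_of_subset_of_nonneg (Finset.subset_univ _)
      fun l _ _ => (click_mem o l).1
  have hk : ones o = 0 ∨ ones o = 1 ∨ 2 ≤ ones o := by omega
  generalize ∑ i, dualPrice μ (x i) * (click o i - x i) = T at hsum ⊢
  by_cases oi : o i = true <;> by_cases oj : o j = true <;>
    simp only [click, oi, oj, if_true, if_false, Bool.false_eq_true] at hti htj hsum hcount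
  all_goals
    rcases hk with hk | hk | hk
    · simp only [hk, if_true] at hsum hcount ⊢
      push_cast at hsum hcount
      linarith
    · simp only [hk, if_true, one_ne_zero, if_false] at hsum hcount ⊢
      push_cast at hsum hcount
      linarith
    · rw [if_neg (by omega), if_neg (by omega)]
      linarith

/-- Weak duality: calibration makes each priced term vanish in expectation, so adding them leaves
the revenue unchanged, and the pointwise bound integrates level by level. -/
theorem revenue_le_dual {n : ℕ} (hn : 2 ≤ n) {lam : Outcome n → ℝ} (hlam : IsSymmetricPrior lam)
    {p : Signaling n} (hs : IsSignaling p) (hcal : IsCalibrated lam p)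
    {μ s γ : ℝ} (hsμ : s ^ 2 = 2 * μ) (hγ : ∀ y ∈ Set.Icc (0 : ℝ) 1, y + dualPrice μ y * (1 - 2 * y) ≤ γ)
    (hγ1 : (1 - s) ^ 2 + μ ≤ γ) (hγ2 : γ + μ ≤ 1) :
    revenue lam p ≤ ∑ k ∈ Finset.range (n + 1), levelProb lam k *
      (if k = 0 then (1 - s) ^ 2 else if k = 1 then γ else 1 + ((k : ℝ) - 2) * μ) := by
  have hμ : 0 ≤ μ := by nlinarith
  have hprob := isProbabilityMeasure_jointLaw hlam fun o => (hs o).1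
  have hms : Measurable fun w : Outcome n × (Fin n → ℝ) => secmax w.2 :=
    measurable_secmax.comp measurable_snd
  have hmf : ∀ i, Measurable fun w : Outcome n × (Fin n → ℝ) => dualPrice μ (w.2 i) := fun i =>
    (measurable_dualPrice μ).comp (by fun_prop)
  have hmx : ∀ i, Measurable fun w : Outcome n × (Fin n → ℝ) => w.2 i := fun i => by fun_prop
  have hfabs : ∀ x, |dualPrice μ x| ≤ 1 := fun x =>
    abs_le.2 ⟨by linarith [dualPrice_nonneg (y := x) hμ], by linarith [dualPrice_le (y := x) hμ]⟩
  have hi1 : ∀ i, Integrable (fun w : Outcome n × (Fin n → ℝ) =>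
      dualPrice μ (w.2 i) * click w.1 i) (jointLaw lam p) := fun i =>
    integrable_of_abs_le hs ((hmf i).mul (measurable_click i)) 1 fun w _ => by
      rw [abs_mul]; exact mul_le_one₀ (hfabs _) (abs_nonneg _) (abs_click_le _ _)
  have hi2 : ∀ i, Integrable (fun w : Outcome n × (Fin n → ℝ) =>
      dualPrice μ (w.2 i) * w.2 i) (jointLaw lam p) := fun i =>
    integrable_of_abs_le hs ((hmf i).mul (hmx i)) 1 fun w hw => by
      rw [abs_mul]
      exact mul_le_one₀ (hfabs _) (abs_nonneg _) (abs_le.2 ⟨by linarith [(hw i).1], (hw i).2⟩)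
  have hi3 : ∀ i, Integrable (fun w : Outcome n × (Fin n → ℝ) =>
      dualPrice μ (w.2 i) * (click w.1 i - w.2 i)) (jointLaw lam p) := fun i => by
    simp only [mul_sub]
    exact (hi1 i).sub (hi2 i)
  have hz : ∀ i, ∫ w, dualPrice μ (w.2 i) * (click w.1 i - w.2 i) ∂(jointLaw lam p) = 0 := by
    intro i
    simp only [mul_sub]
    rw [integral_sub (hi1 i) (hi2 i),
      hcal.integral_eq i (dualPrice μ) (measurable_dualPrice μ) 1 hfabs, sub_self]
  have hsecint : Integrable (fun w : Outcome n × (Fin n → ℝ) => secmax w.2) (jointLaw lam p) :=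
    integrable_of_abs_le hs hms 1 fun w hw => by
      have := secmax_mem_Icc hn w.2 hw
      exact abs_le.2 ⟨by linarith [this.1], this.2⟩
  have hrev : revenue lam p = ∫ w, (secmax w.2 +
      ∑ i, dualPrice μ (w.2 i) * (click w.1 i - w.2 i)) ∂(jointLaw lam p) := by
    rw [integral_add hsecint (integrable_finsetSum _ fun i _ => hi3 i),
      integral_finsetSum _ fun i _ => hi3 i, Finset.sum_congr rfl fun i _ => hz i]
    simp [revenue]
  rw [hrev]
  refine integral_jointLaw_le hlam hs (hms.add (Finset.measurable_sum _ fun i _ =>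
    (hmf i).mul ((measurable_click i).sub (hmx i)))) (1 + n) ?_ _ ?_
  · intro w hw
    have h1 := secmax_mem_Icc hn w.2 hw
    refine (abs_add_le _ _).trans (add_le_add (abs_le.2 ⟨by linarith [h1.1], h1.2⟩) ?_)
    refine (Finset.abs_sum_le_sum_abs _ _).trans ?_
    refine (Finset.sum_le_sum (g := fun _ => (1 : ℝ)) fun i _ => ?_).trans (by simp)
    have h2 := click_mem w.1 i
    have h3 := hw i
    change |dualPrice μ (w.2 i) * (click w.1 i - w.2 i)| ≤ 1
    rw [abs_mul]
    exact mul_le_one₀ (hfabs _) (abs_nonneg _)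
      (abs_le.2 ⟨by linarith [h3.2], by linarith [h3.1]⟩)
  · exact fun o x hx => secmax_add_dual_le hn hsμ hγ hγ1 hγ2 o x hx

/-! ### A signaling built from a chain of bids -/

theorem sum_range_eq_zero_one_Icc {n : ℕ} (hn : 2 ≤ n) (f : ℕ → ℝ) :
    ∑ k ∈ Finset.range (n + 1), f k = f 0 + f 1 + ∑ k ∈ Finset.Icc 2 n, f k := by
  have h : Finset.range (n + 1) = insert 0 (insert 1 (Finset.Icc 2 n)) := by
    ext k; simp only [Finset.mem_range, Finset.mem_insert, Finset.mem_Icc]; omega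
  rw [h, Finset.sum_insert (by simp), Finset.sum_insert (by simp), add_assoc]

theorem sum_fin_ite_lt {n p : ℕ} (hp : p ≤ n) (a : ℝ) :
    ∑ i : Fin n, (if (i : ℕ) < p then a else 0) = p * a := by
  rw [← Finset.sum_filter, Finset.sum_const, Fin.card_filter_val_lt, min_eq_right hp, nsmul_eq_mul]

/-- The first two bidders bid `x`, the others bid zero. -/
noncomputable def pairBids (n : ℕ) (x : ℝ) : Fin n → ℝ := fun i => if (i : ℕ) < 2 then x else 0

/-- The first bidder bids `x`, the second one `y`, the others bid zero. -/
noncomputable def chainBids (n : ℕ) (x y : ℝ) : Fin n → ℝ := fun i =>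
  if (i : ℕ) < 1 then x else if (i : ℕ) < 2 then y else 0

/-- The first two bidders bid one, the next `k - 2` bid `x`, the others bid zero. -/
noncomputable def surplusBids (n k : ℕ) (x : ℝ) : Fin n → ℝ := fun i =>
  if (i : ℕ) < 2 then 1 else if (i : ℕ) < k then x else 0

theorem secmax_pairBids {n : ℕ} (hn : 2 ≤ n) {x : ℝ} (hx : 0 ≤ x) : secmax (pairBids n x) = x := by
  refine secmax_eq _ x (i := ⟨0, by omega⟩) (j := ⟨1, by omega⟩) (by simp) (by simp [pairBids])
    fun a b _ => (min_le_left _ _).trans ?_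
  unfold pairBids; split_ifs <;> simp [hx]

theorem secmax_chainBids {n : ℕ} (hn : 2 ≤ n) {x y : ℝ} (hy : 0 ≤ y) (hxy : y ≤ x) :
    secmax (chainBids n x y) = y := by
  refine secmax_eq _ y (i := ⟨0, by omega⟩) (j := ⟨1, by omega⟩) (by simp)
    (by simp [chainBids, hxy]) fun a b hab => ?_
  have h : ∀ c : Fin n, (c : ℕ) ≠ 0 → chainBids n x y c ≤ y := by
    intro c hc
    rw [chainBids, if_neg (by omega)]
    split_ifs <;> simp [hy]
  by_cases ha : (a : ℕ) = 0
  · have hb : (b : ℕ) ≠ 0 := fun hb => hab (Fin.ext (ha.trans hb.symm))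
    exact (min_le_right _ _).trans (h b hb)
  · exact (min_le_left _ _).trans (h a ha)

theorem surplusBids_le_one {n k : ℕ} {x : ℝ} (hx1 : x ≤ 1) (i : Fin n) :
    surplusBids n k x i ≤ 1 := by
  unfold surplusBids; split_ifs <;> linarith

theorem secmax_surplusBids {n : ℕ} (hn : 2 ≤ n) (k : ℕ) {x : ℝ} (hx1 : x ≤ 1) :
    secmax (surplusBids n k x) = 1 :=
  secmax_eq _ 1 (i := ⟨0, by omega⟩) (j := ⟨1, by omega⟩) (by simp) (by simp [surplusBids])
    fun a _ _ => (min_le_left _ _).trans (surplusBids_le_one hx1 a)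

theorem winProb_eq_zero {n : ℕ} {x : Fin n → ℝ} {i j : Fin n} (h : x i < x j) :
    winProb x i = 0 := by
  rw [winProb, if_neg]
  simp only [topBidders, Finset.mem_filter, Finset.mem_univ, true_and, not_forall, not_le]
  exact ⟨j, h⟩

theorem sum_winProb_zero {n : ℕ} (hn : 0 < n) (b : Fin n → ℝ) :
    ∑ j, winProb b j * (placeClick 0 j - secmax b) = - secmax b := by
  simp only [placeClick, not_lt_zero, if_false, zero_sub]
  rw [← Finset.sum_mul, sum_winProb hn, one_mul]

/-- The strict inequality makes the clicker the only winner, at price `y`. -/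
theorem sum_winProb_chainBids {n : ℕ} (hn : 2 ≤ n) {x y : ℝ} (hy : 0 ≤ y) (hxy : y < x) :
    ∑ j, winProb (chainBids n x y) j * (placeClick 1 j - secmax (chainBids n x y)) = 1 - y := by
  rw [secmax_chainBids hn hy hxy.le]
  have h : ∀ j, winProb (chainBids n x y) j * (placeClick 1 j - y) =
      winProb (chainBids n x y) j * (1 - y) := by
    intro j
    by_cases hj : (j : ℕ) < 1
    · simp [placeClick, hj]
    · rw [winProb_eq_zero (j := ⟨0, by omega⟩)]
      · simp
      · simp only [chainBids, hj, if_false, zero_lt_one, if_true]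
        split_ifs <;> linarith
  rw [Finset.sum_congr rfl fun j _ => h j, ← Finset.sum_mul, sum_winProb (by omega), one_mul]

/-- Everyone who bids one has clicked, even when `x = 1`, so the winner gets value one at price one.
-/
theorem sum_winProb_surplusBids {n k : ℕ} (hk : 2 ≤ k) (hn : 2 ≤ n) {x : ℝ} (hx1 : x ≤ 1) :
    ∑ j, winProb (surplusBids n k x) j * (placeClick k j - secmax (surplusBids n k x)) = 0 := by
  rw [secmax_surplusBids hn k hx1]
  refine Finset.sum_eq_zero fun j _ => ?_
  by_cases hj : (j : ℕ) < k
  · simp [placeClick, hj]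
  · rw [winProb_eq_zero (j := ⟨0, by omega⟩), zero_mul]
    simp [surplusBids, hj, show ¬ (j : ℕ) < 2 by omega]

theorem sum_test_pairBids {n : ℕ} (hn : 2 ≤ n) (φ : ℝ → ℝ) (x : ℝ) :
    ∑ j, φ (pairBids n x j) * (placeClick 0 j - pairBids n x j) = - (2 * (φ x * x)) := by
  have h := sum_fin_ite_lt hn (-(φ x * x))
  rw [Nat.cast_ofNat, mul_neg] at h
  rw [← h]
  refine Finset.sum_congr rfl fun i _ => ?_
  unfold pairBids placeClick
  split_ifs <;> first | omega | simp

theorem sum_test_chainBids {n : ℕ} (hn : 2 ≤ n) (φ : ℝ → ℝ) (x y : ℝ) :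
    ∑ j, φ (chainBids n x y j) * (placeClick 1 j - chainBids n x y j) =
      φ x * (1 - x) - φ y * y := by
  have h : ∀ j : Fin n, φ (chainBids n x y j) * (placeClick 1 j - chainBids n x y j) =
      (if (j : ℕ) < 1 then φ x * (1 - x) + φ y * y else 0) +
        (if (j : ℕ) < 2 then - (φ y * y) else 0) := by
    intro i
    unfold chainBids placeClick
    split_ifs <;> first | omega | simp
  rw [Finset.sum_congr rfl fun j _ => h j, Finset.sum_add_distrib, sum_fin_ite_lt (by omega),
    sum_fin_ite_lt hn]
  push_cast
  ring

theorem sum_test_surplusBids {n k : ℕ} (hk : 2 ≤ k) (hkn : k ≤ n) (φ : ℝ → ℝ) (x : ℝ) :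
    ∑ j, φ (surplusBids n k x j) * (placeClick k j - surplusBids n k x j) =
      ((k : ℝ) - 2) * (φ x * (1 - x)) := by
  have h : ∀ j : Fin n, φ (surplusBids n k x j) * (placeClick k j - surplusBids n k x j) =
      (if (j : ℕ) < k then φ x * (1 - x) else 0) +
        (if (j : ℕ) < 2 then - (φ x * (1 - x)) else 0) := by
    intro i
    unfold surplusBids placeClick
    split_ifs <;> first | omega | simp
  rw [Finset.sum_congr rfl fun j _ => h j, Finset.sum_add_distrib, sum_fin_ite_lt hkn,
    sum_fin_ite_lt (hk.trans hkn)]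
  push_cast
  ring

/-- A description that sends chained bids when one bidder clicks, and uses the surplus clicks of
the other outcomes to calibrate the bids of bidders without a click. -/
structure IsChain {n : ℕ} (lam : Outcome n → ℝ) (D : Desc n) (m : ℕ) (t w w' : ℕ → ℝ)
    (θ s ws wf : ℝ) : Prop where
  pos : 0 < m
  real_zero : D.real 0 = [(θ, pairBids n s), (1 - θ, pairBids n 0)]
  real_one : D.real 1 = (List.range m).map fun j => (1 / (m : ℝ), chainBids n (t (j + 1)) (t j))
  real_of_two_le : ∀ k, 2 ≤ k → k ≤ n → D.real k =
    (List.range (m - 1)).flatMap (fun j =>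
      [(w (j + 1), surplusBids n k (t (j + 1))), (w' (j + 1), surplusBids n k 1)]) ++
    [(ws, surplusBids n k s), (wf, surplusBids n k 1)]
  t_zero : t 0 = 0
  t_last : t m = 1
  t_lt : ∀ j < m, t j < t (j + 1)
  s_mem : s ∈ Set.Icc (0 : ℝ) 1
  balance : ∀ j, 1 ≤ j → j < m →
    (levelProb lam 1 / m + (∑ k ∈ Finset.Icc 2 n, ((k : ℝ) - 2) * levelProb lam k) * w j) *
      (1 - t j) = levelProb lam 1 / m * t j
  balance_zero : (∑ k ∈ Finset.Icc 2 n, ((k : ℝ) - 2) * levelProb lam k) * ws * (1 - s) =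
    2 * levelProb lam 0 * θ * s
  total : ∑ j ∈ Finset.range (m - 1), (w (j + 1) + w' (j + 1)) + ws + wf = 1

theorem list_sum_range (f : ℕ → ℝ) (m : ℕ) :
    ((List.range m).map f).sum = ∑ j ∈ Finset.range m, f j := by
  induction m with
  | zero => simp
  | succ m ih => rw [List.range_succ, Finset.sum_range_succ]; simp [ih]

theorem list_sum_flatMap (f g : ℕ → ℝ) (m : ℕ) :
    (((List.range m).flatMap fun j => [f j, g j])).sum = ∑ j ∈ Finset.range m, (f j + g j) := by
  induction m with
  | zero => simp
  | succ m ih =>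
    rw [List.range_succ, Finset.sum_range_succ]; simp [ih]

namespace IsChain

variable {n : ℕ} {lam : Outcome n → ℝ} {D : Desc n} {m : ℕ} {t w w' : ℕ → ℝ} {θ s ws wf : ℝ}

theorem mono (h : IsChain lam D m t w w' θ s ws wf) {i j : ℕ} (hij : i ≤ j) (hj : j ≤ m) :
    t i ≤ t j := by
  induction j, hij using Nat.le_induction with
  | base => exact le_rfl
  | succ j hij ih => exact (ih (by omega)).trans (h.t_lt j (by omega)).le

theorem t_mem (h : IsChain lam D m t w w' θ s ws wf) {j : ℕ} (hj : j ≤ m) :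
    t j ∈ Set.Icc (0 : ℝ) 1 :=
  ⟨h.t_zero ▸ h.mono (Nat.zero_le j) hj, h.t_last ▸ h.mono hj le_rfl⟩

theorem sum_zero (h : IsChain lam D m t w w' θ s ws wf) (g : (Fin n → ℝ) → ℝ) :
    ((D.real 0).map fun A => A.1 * g A.2).sum =
      θ * g (pairBids n s) + (1 - θ) * g (pairBids n 0) := by
  simp [h.real_zero]

theorem sum_one (h : IsChain lam D m t w w' θ s ws wf) (g : (Fin n → ℝ) → ℝ) :
    ((D.real 1).map fun A => A.1 * g A.2).sum =
      1 / (m : ℝ) * ∑ j ∈ Finset.range m, g (chainBids n (t (j + 1)) (t j)) := by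
  rw [h.real_one, List.map_map, Function.comp_def, list_sum_range, Finset.mul_sum]

theorem sum_of_two_le (h : IsChain lam D m t w w' θ s ws wf) {k : ℕ} (hk : 2 ≤ k) (hkn : k ≤ n)
    (g : (Fin n → ℝ) → ℝ) :
    ((D.real k).map fun A => A.1 * g A.2).sum =
      ∑ j ∈ Finset.range (m - 1), (w (j + 1) * g (surplusBids n k (t (j + 1))) +
        w' (j + 1) * g (surplusBids n k 1)) +
      ws * g (surplusBids n k s) + wf * g (surplusBids n k 1) := by
  rw [h.real_of_two_le k hk hkn, List.map_append, List.sum_append, List.map_flatMap]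
  simp only [List.map_cons, List.map_nil, list_sum_flatMap]
  simp [add_assoc]

theorem isSignaling (h : IsChain lam D m t w w' θ s ws wf) : IsSignaling D.signaling := by
  have hm : (m : ℝ) ≠ 0 := by exact_mod_cast h.pos.ne'
  have hk : ∀ k, k = 0 ∨ k = 1 ∨ 2 ≤ k := by omega
  refine D.isSignaling (fun k hkn => ?_) fun k hkn => ?_
  · have e : (D.real k).map Prod.fst = (D.real k).map fun A => A.1 * (1 : ℝ) := by
      simp
    rw [e]
    rcases hk k with rfl | rfl | hk
    · rw [h.sum_zero (fun _ => 1)]; ring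
    · rw [h.sum_one (fun _ => 1)]; simp [hm]
    · rw [h.sum_of_two_le hk hkn (fun _ => 1)]; simpa using h.total
  · have hpair : ∀ x ∈ Set.Icc (0 : ℝ) 1, ∀ i, pairBids n x i ∈ Set.Icc (0 : ℝ) 1 := by
      intro x hx i; unfold pairBids; split_ifs <;> simp_all
    have hsur : ∀ x ∈ Set.Icc (0 : ℝ) 1, ∀ i, surplusBids n k x i ∈ Set.Icc (0 : ℝ) 1 := by
      intro x hx i; unfold surplusBids; split_ifs <;> simp_all
    intro A hA
    rcases hk k with rfl | rfl | hk
    · rw [h.real_zero] at hA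
      simp only [List.mem_cons, List.not_mem_nil, or_false] at hA
      rcases hA with rfl | rfl
      · exact hpair s h.s_mem
      · exact hpair 0 (by simp)
    · rw [h.real_one] at hA
      obtain ⟨j, hj, rfl⟩ := List.mem_map.1 hA
      have hj : j < m := List.mem_range.1 hj
      have h1 := h.t_mem hj.le
      have h2 := h.t_mem (Nat.succ_le_of_lt hj)
      intro i
      dsimp only [chainBids]
      split_ifs <;> simp_all
    · rw [h.real_of_two_le k hk hkn] at hA
      simp only [List.mem_append, List.mem_flatMap, List.mem_range, List.mem_cons,
        List.not_mem_nil, or_false] at hA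
      rcases hA with ⟨j, hj, rfl | rfl⟩ | rfl | rfl
      · exact hsur _ (h.t_mem (by omega))
      · exact hsur _ (by simp)
      · exact hsur _ h.s_mem
      · exact hsur _ (by simp)

theorem isCalibrated (hn : 2 ≤ n) (hlam : IsSymmetricPrior lam)
    (h : IsChain lam D m t w w' θ s ws wf) : IsCalibrated lam D.signaling := by
  refine D.isCalibrated hlam h.isSignaling fun φ => ?_
  set S := ∑ k ∈ Finset.Icc 2 n, ((k : ℝ) - 2) * levelProb lam k with hS
  have h2 : ∑ k ∈ Finset.Icc 2 n, levelProb lam k *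
      ((D.real k).map fun A => A.1 * ∑ j, φ (A.2 j) * (placeClick k j - A.2 j)).sum =
      S * (∑ j ∈ Finset.range (m - 1), w (j + 1) * (φ (t (j + 1)) * (1 - t (j + 1))) +
        ws * (φ s * (1 - s))) := by
    rw [hS, Finset.sum_mul]
    refine Finset.sum_congr rfl fun k hk => ?_
    obtain ⟨hk2, hkn⟩ := Finset.mem_Icc.1 hk
    rw [h.sum_of_two_le hk2 hkn (fun b => ∑ j, φ (b j) * (placeClick k j - b j))]
    simp only [sum_test_surplusBids hk2 hkn, sub_self, mul_zero, add_zero]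
    rw [mul_add, mul_add, Finset.mul_sum, Finset.mul_sum]
    congr 1
    · exact Finset.sum_congr rfl fun j _ => by ring
    · ring
  rw [sum_range_eq_zero_one_Icc hn, h2,
    h.sum_zero (fun b => ∑ j, φ (b j) * (placeClick 0 j - b j)),
    h.sum_one (fun b => ∑ j, φ (b j) * (placeClick 1 j - b j))]
  simp only [sum_test_pairBids hn, sum_test_chainBids hn]
  obtain ⟨p, rfl⟩ : ∃ p, m = p + 1 := ⟨m - 1, by have := h.pos; omega⟩
  -- Shifting the index puts the clicker of each link next to the rival of the following one. The
  -- loose ends contribute nothing: a clicker who bids one and a rival who bids zero.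
  rw [Finset.sum_sub_distrib, Finset.sum_range_succ, h.t_last, Finset.sum_range_succ', h.t_zero,
    Nat.add_sub_cancel]
  have h3 : ∀ j ∈ Finset.range p, S * (w (j + 1) * (φ (t (j + 1)) * (1 - t (j + 1)))) =
      levelProb lam 1 / ((p + 1 : ℕ) : ℝ) * (φ (t (j + 1)) * t (j + 1)) -
      levelProb lam 1 / ((p + 1 : ℕ) : ℝ) * (φ (t (j + 1)) * (1 - t (j + 1))) := by
    intro j hj
    have := h.balance (j + 1) (by omega) (by have := Finset.mem_range.1 hj; omega)
    linear_combination φ (t (j + 1)) * this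
  rw [mul_add S, Finset.mul_sum (a := S), Finset.sum_congr rfl h3, Finset.sum_sub_distrib, ← Finset.mul_sum,
    ← Finset.mul_sum]
  have h4 := h.balance_zero
  rw [← hS] at h4
  linear_combination φ s * h4

theorem revenue_eq (hn : 2 ≤ n) (hlam : IsSymmetricPrior lam)
    (h : IsChain lam D m t w w' θ s ws wf) :
    revenue lam D.signaling = levelProb lam 0 * (θ * s) +
      levelProb lam 1 * (1 / (m : ℝ) * ∑ j ∈ Finset.range m, t j) +
      ∑ k ∈ Finset.Icc 2 n, levelProb lam k := by
  rw [D.revenue_eq hlam, sum_range_eq_zero_one_Icc hn, h.sum_zero, h.sum_one,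
    secmax_pairBids hn h.s_mem.1, secmax_pairBids hn le_rfl, mul_zero, add_zero]
  congr 1
  · congr 3
    refine Finset.sum_congr rfl fun j hj => ?_
    have hj := Finset.mem_range.1 hj
    exact secmax_chainBids hn (h.t_mem hj.le).1 (h.t_lt j hj).le
  · refine Finset.sum_congr rfl fun k hk => ?_
    obtain ⟨hk2, hkn⟩ := Finset.mem_Icc.1 hk
    rw [h.sum_of_two_le hk2 hkn, secmax_surplusBids hn k h.s_mem.2, secmax_surplusBids hn k le_rfl,
      Finset.sum_congr rfl fun j hj => by
        rw [secmax_surplusBids hn k (h.t_mem (j := j + 1)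
          (by have := Finset.mem_range.1 hj; omega)).2]]
    simp only [mul_one, h.total]

/-- A single click yields its value minus the rival's bid, an outcome without clicks loses its
price, and the other outcomes break even. -/
theorem utility_eq (hn : 2 ≤ n) (hlam : IsSymmetricPrior lam)
    (h : IsChain lam D m t w w' θ s ws wf) (i : Fin n) :
    utility lam D.signaling i = (n : ℝ)⁻¹ * (levelProb lam 1 *
      (1 - 1 / (m : ℝ) * ∑ j ∈ Finset.range m, t j) - levelProb lam 0 * (θ * s)) := by
  have hm : (m : ℝ) ≠ 0 := by exact_mod_cast h.pos.ne'
  rw [D.utility_eq hlam, sum_range_eq_zero_one_Icc hn,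
    h.sum_zero (fun b => ∑ j, winProb b j * (placeClick 0 j - secmax b)),
    h.sum_one (fun b => ∑ j, winProb b j * (placeClick 1 j - secmax b))]
  simp only [sum_winProb_zero (by omega : 0 < n)]
  rw [secmax_pairBids hn h.s_mem.1, secmax_pairBids hn le_rfl, neg_zero, mul_zero, add_zero,
    Finset.sum_congr rfl fun j hj => by
      have hj := Finset.mem_range.1 hj
      exact sum_winProb_chainBids hn (h.t_mem hj.le).1 (h.t_lt j hj),
    Finset.sum_eq_zero (s := Finset.Icc 2 n)]
  · rw [Finset.sum_sub_distrib]
    simp only [Finset.sum_const, Finset.card_range, nsmul_eq_mul, mul_one]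
    congr 1
    field_simp
    ring
  · intro k hk
    obtain ⟨hk2, hkn⟩ := Finset.mem_Icc.1 hk
    rw [h.sum_of_two_le hk2 hkn (fun b => ∑ j, winProb b j * (placeClick k j - secmax b)),
      sum_winProb_surplusBids hk2 hn h.s_mem.2, sum_winProb_surplusBids hk2 hn le_rfl,
      Finset.sum_congr rfl fun j hj => by
        rw [sum_winProb_surplusBids hk2 hn (h.t_mem (j := j + 1)
          (by have := Finset.mem_range.1 hj; omega)).2]]
    simp

theorem mem_calibratedIR (hn : 2 ≤ n) (hlam : IsSymmetricPrior lam)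
    (h : IsChain lam D m t w w' θ s ws wf)
    (hIR : levelProb lam 0 * (θ * s) ≤
      levelProb lam 1 * (1 - 1 / (m : ℝ) * ∑ j ∈ Finset.range m, t j)) :
    D.signaling ∈ calibratedIR lam := by
  refine ⟨h.isSignaling, h.isCalibrated hn hlam, fun i => ?_⟩
  rw [h.utility_eq hn hlam]
  exact mul_nonneg (by positivity) (sub_nonneg.2 hIR)

end IsChain

/-! ### The optimal minimum second-highest bids -/

/-- First-order optimality of the split of the surplus clicks into `A` and `B`. -/
structure IsOptSplit (l0 l1 A B : ℝ) : Prop where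
  nonneg : 0 ≤ A
  pos : 0 < B
  le : l1 * (2 * l0 + B) ≤ √2 * l0 * (2 * l1 + A)
  eq : 0 < A → l1 * (2 * l0 + B) = √2 * l0 * (2 * l1 + A)

/-- The marginal value of `A` is `(l1 / (2 l1 + A))^2`, that of `B` is `2 (l0 / (2 l0 + B))^2`. With
`B = S - A` their equality is linear in `A` after taking roots, with solution `X`. A negative `X` is
replaced by the boundary point 0, and `X < S` because `√2 > 1`. -/
theorem IsOptSplit.of_max {l0 l1 S : ℝ} (h0 : 0 < l0) (h1 : 0 < l1) (hS : 0 < S) :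
    IsOptSplit l0 l1 (max ((l1 * S + 2 * l1 * l0 * (1 - √2)) / (l1 + √2 * l0)) 0)
      (S - max ((l1 * S + 2 * l1 * l0 * (1 - √2)) / (l1 + √2 * l0)) 0) := by
  have h2 : (0 : ℝ) < √2 := by positivity
  have h2' : (1 : ℝ) < √2 := by rw [Real.lt_sqrt] <;> norm_num
  have hd : 0 < l1 + √2 * l0 := by positivity
  set X := (l1 * S + 2 * l1 * l0 * (1 - √2)) / (l1 + √2 * l0) with hX
  have hXd : X * (l1 + √2 * l0) = l1 * S + 2 * l1 * l0 * (1 - √2) := div_mul_cancel₀ _ hd.ne'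
  have hXS : X < S := by
    have : X * (l1 + √2 * l0) < S * (l1 + √2 * l0) := by
      rw [hXd]
      have e1 : 0 < l1 * l0 * (√2 - 1) := by
        have : 0 < √2 - 1 := by linarith
        positivity
      have e2 : 0 < S * (√2 * l0) := by positivity
      nlinarith
    exact lt_of_mul_lt_mul_right this hd.le
  refine ⟨le_max_right _ _, sub_pos.2 (max_lt hXS hS), ?_, fun h => ?_⟩
  · rcases le_total X 0 with h | h
    · rw [max_eq_right h]
      have : X * (l1 + √2 * l0) ≤ 0 := mul_nonpos_of_nonpos_of_nonneg h hd.le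
      linarith
    · rw [max_eq_left h]; linarith
  · have h3 : max X 0 = X := by
      rcases le_total X 0 with h' | h'
      · rw [max_eq_right h'] at h; exact absurd h (lt_irrefl _)
      · exact max_eq_left h'
    rw [h3]; linarith

/-- Dual multipliers that certify the optimal value. -/
theorem IsOptSplit.exists_dual {l0 l1 A B : ℝ} (h : IsOptSplit l0 l1 A B) (h0 : 0 < l0)
    (h1 : 0 < l1) :
    ∃ μ s γ : ℝ, s ^ 2 = 2 * μ ∧
      (∀ y ∈ Set.Icc (0 : ℝ) 1, y + dualPrice μ y * (1 - 2 * y) ≤ γ) ∧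
      (1 - s) ^ 2 + μ ≤ γ ∧ γ + μ ≤ 1 ∧
      l0 * (1 - s) ^ 2 + l1 * γ + (A + B) * μ =
        l0 * (B / (2 * l0 + B)) + l1 * ((l1 + A) / (2 * l1 + A)) := by
  obtain ⟨hA, hB, hle, heq⟩ := h
  have hq : √2 ^ 2 = (2 : ℝ) := Real.sq_sqrt (by norm_num)
  have h2 : (0 : ℝ) < √2 := by positivity
  have hdB : 0 < 2 * l0 + B := by positivity
  have hdA : 0 < 2 * l1 + A := by positivity
  -- One minus the bid at the zero outcome, where the bound on pairs of non-clickers has to be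
  -- tight.
  set s := 2 * l0 / (2 * l0 + B) with hs
  have hsd : s * (2 * l0 + B) = 2 * l0 := div_mul_cancel₀ _ hdB.ne'
  have hs0 : 0 < s := by positivity
  have hs1 : s ≤ 1 := by rw [hs, div_le_one hdB]; linarith
  have ht0 : B / (2 * l0 + B) = 1 - s := by rw [hs]; field_simp; ring
  have hBs : l0 * (1 - s) * s = B * (s ^ 2 / 2) := by nlinarith
  rcases hA.eq_or_lt with rfl | hA
  -- Boundary case `A = 0`: the single-click bid is 1/2, so `γ = 1/2`. Here `hle` gives `s^2 ≥ 1/2`,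
  -- which makes 1/2 maximal.
  · have hs2 : 1 ≤ √2 * s := by
      rw [hs, mul_div_assoc', le_div_iff₀ hdB]
      have : l1 * (2 * l0 + B) ≤ l1 * (√2 * (2 * l0)) := by linarith
      linarith [le_of_mul_le_mul_left this h1]
    have hμ : 1 / 2 ≤ s ^ 2 := by nlinarith
    refine ⟨s ^ 2 / 2, s, 1 / 2, by ring, ?_, ?_, ?_, ?_⟩
    · intro y hy
      rcases lt_or_ge y (1 - 2 * (s ^ 2 / 2)) with hy' | hy'
      · have h3 := dualPrice_mul_of_lt (by positivity : 0 ≤ s ^ 2 / 2) hy'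
        have h4 : 0 < 1 - y := by nlinarith
        refine le_of_mul_le_mul_right ?_ h4
        have h5 : 0 ≤ (1 - 2 * y) * (1 - y - s ^ 2) := mul_nonneg (by linarith) (by linarith)
        linear_combination (1 - 2 * y) * h3 + h5 / 2
      · rw [dualPrice_of_ge hy']; linarith
    · nlinarith
    · nlinarith
    · have : (l1 + 0) / (2 * l1 + 0) = 1 / 2 := by field_simp; ring
      rw [this, ht0]
      linear_combination -hBs
  · have heq := heq hA
    -- One minus the single-click bid. Equal marginals give `s = √2 * r`, so the one multiplier `μ =
    -- r^2` is tight at both bids; for a single click the gap is `(1 - y - r)^2` after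
    -- multiplication by `1 - y`.
    set r := l1 / (2 * l1 + A) with hr
    have hrd : r * (2 * l1 + A) = l1 := div_mul_cancel₀ _ hdA.ne'
    have hr0 : 0 < r := by positivity
    have hr1 : r ≤ 1 / 2 := by rw [hr, div_le_div_iff₀ hdA (by norm_num)]; linarith
    have ht1 : (l1 + A) / (2 * l1 + A) = 1 - r := by rw [hr]; field_simp; ring
    have hsr : s = √2 * r := by
      rw [hs, hr, mul_div_assoc', div_eq_div_iff hdB.ne' hdA.ne']
      linear_combination (√2) * (-heq) + (-(l0 * (2 * l1 + A))) * hq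
    have hs2 : s ^ 2 = 2 * r ^ 2 := by rw [hsr, mul_pow, hq]
    -- Since `r ≤ 1/2`, this rational bound for `√2` suffices for `r^2 + 2 r ≤ 2 s`, which is what
    -- `(1 - s)^2 + μ ≤ γ` says.
    have hsr2 : 1.4 * r ≤ s := by nlinarith
    refine ⟨r ^ 2, s, 1 - 2 * r + 2 * r ^ 2, hs2, ?_, ?_, ?_, ?_⟩
    · intro y hy
      rcases lt_or_ge y (1 - 2 * r ^ 2) with hy' | hy'
      · have h3 := dualPrice_mul_of_lt (by positivity : 0 ≤ r ^ 2) hy'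
        have h4 : 0 < 1 - y := by nlinarith
        refine le_of_mul_le_mul_right ?_ h4
        linear_combination (1 - 2 * y) * h3 + sq_nonneg (1 - y - r)
      · rw [dualPrice_of_ge hy']; nlinarith [sq_nonneg (r - 1 / 2)]
    · nlinarith
    · nlinarith
    · rw [ht0, ht1]
      linear_combination (-(1 : ℝ)) * hBs + r * hrd - B / 2 * hs2

/-- Lowering the surplus `B` lowers the bid by a controlled amount. -/
theorem tZero_sub {l0 B C : ℝ} (h0 : 0 < l0) (hB : 0 ≤ B) (hC : 0 ≤ C) :
    l0 * (B / (2 * l0 + B)) - l0 * (C / (2 * l0 + C)) =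
      2 * l0 ^ 2 * (B - C) / ((2 * l0 + B) * (2 * l0 + C)) := by
  have h1 : 0 < 2 * l0 + B := by positivity
  have h2 : 0 < 2 * l0 + C := by positivity
  field_simp
  ring

theorem tOne_sub {l1 A A' : ℝ} (h1 : 0 < l1) (hA : 0 ≤ A) (hA' : 0 ≤ A') :
    l1 * ((l1 + A) / (2 * l1 + A)) - l1 * ((l1 + A') / (2 * l1 + A')) =
      l1 ^ 2 * (A - A') / ((2 * l1 + A) * (2 * l1 + A')) := by
  have h3 : 0 < 2 * l1 + A := by positivity
  have h2 : 0 < 2 * l1 + A' := by positivity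
  field_simp
  ring

/-- The contribution of `B` is concave with slope 1/2 at zero; that of `A`, treated next, has slope
1/4 there. -/
theorem tZero_sub_le {l0 B C : ℝ} (h0 : 0 < l0) (hC : 0 ≤ C) (hCB : 0 ≤ B) {δ : ℝ} (hδ : 0 ≤ δ)
    (h : B - C ≤ δ) : l0 * (B / (2 * l0 + B)) - l0 * (C / (2 * l0 + C)) ≤ δ / 2 := by
  have h1 : 0 < 2 * l0 + B := by positivity
  have h2 : 0 < 2 * l0 + C := by positivity
  rw [tZero_sub h0 hCB hC, div_le_iff₀ (by positivity)]
  have e1 : 2 * l0 ^ 2 * (B - C) ≤ 2 * l0 ^ 2 * δ := by gcongr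
  have e2 : (2 * l0) * (2 * l0) ≤ (2 * l0 + B) * (2 * l0 + C) := by
    apply mul_le_mul <;> linarith
  nlinarith [mul_le_mul_of_nonneg_left e2 hδ]

theorem tOne_sub_le {l1 A A' : ℝ} (h1 : 0 < l1) (hA : 0 ≤ A) (hA' : 0 ≤ A') {δ : ℝ} (hδ : 0 ≤ δ)
    (h : A - A' ≤ δ) :
    l1 * ((l1 + A) / (2 * l1 + A)) - l1 * ((l1 + A') / (2 * l1 + A')) ≤ δ / 4 := by
  have h3 : 0 < 2 * l1 + A := by positivity
  have h2 : 0 < 2 * l1 + A' := by positivity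
  rw [tOne_sub h1 hA hA', div_le_iff₀ (by positivity)]
  have e1 : l1 ^ 2 * (A - A') ≤ l1 ^ 2 * δ := by gcongr
  have e2 : (2 * l1) * (2 * l1) ≤ (2 * l1 + A) * (2 * l1 + A') := by
    apply mul_le_mul <;> linarith
  nlinarith [mul_le_mul_of_nonneg_left e2 hδ]

/-- The slack in the full surplus regime. -/
theorem IsOptSplit.gap {l0 l1 A B C : ℝ} (h : IsOptSplit l0 l1 A B) (h0 : 0 < l0)
    (h1 : 0 < l1) (hC : 0 ≤ C) (hCB : C ≤ B) :
    (l1 / (2 * l1 + A)) ^ 2 * (B - C) ≤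
      l0 * (B / (2 * l0 + B)) - l0 * (C / (2 * l0 + C)) := by
  obtain ⟨hA, hB, hle, -⟩ := h
  have hq : √2 ^ 2 = (2 : ℝ) := Real.sq_sqrt (by norm_num)
  have hdB : 0 < 2 * l0 + B := by positivity
  have hdC : 0 < 2 * l0 + C := by positivity
  have hdA : 0 < 2 * l1 + A := by positivity
  rw [tZero_sub h0 hB.le hC, mul_div_right_comm]
  refine mul_le_mul_of_nonneg_right ?_ (sub_nonneg.2 hCB)
  -- The secant slope from `C` to `B` of a concave function is at least its slope at `B`, which is
  -- at least the marginal value of `A`.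
  calc (l1 / (2 * l1 + A)) ^ 2 ≤ (√2 * l0 / (2 * l0 + B)) ^ 2 := by
        refine pow_le_pow_left₀ (by positivity) ?_ 2
        rw [div_le_div_iff₀ hdA hdB]; exact hle
    _ = 2 * l0 ^ 2 / ((2 * l0 + B) * (2 * l0 + B)) := by rw [div_pow, mul_pow, hq]; ring
    _ ≤ 2 * l0 ^ 2 / ((2 * l0 + B) * (2 * l0 + C)) := by gcongr

/-- The test that locates the optimal split without square roots. -/
theorem IsOptSplit.le_of_test {l0 l1 A S : ℝ} (h : IsOptSplit l0 l1 A (S - A)) (h0 : 0 < l0)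
    (h1 : 0 < l1) {x : ℝ} (hx : 0 ≤ x)
    (ht : l1 ^ 2 * (2 * l0 + (S - x)) ^ 2 ≤ 2 * l0 ^ 2 * (2 * l1 + x) ^ 2) : A ≤ x := by
  have hq : √2 ^ 2 = (2 : ℝ) := Real.sq_sqrt (by norm_num)
  have h2 : (0 : ℝ) < √2 := by positivity
  by_contra! hlt
  have heq := h.eq (hx.trans_lt hlt)
  -- The left side decreases in `x`, the right side increases, and they meet at an interior optimum.
  -- Squaring turns the comparison into a rational test.
  have h3 : l1 * (2 * l0 + (S - x)) ≤ √2 * l0 * (2 * l1 + x) := by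
    refine le_of_sq_le_sq ?_ (by positivity)
    calc (l1 * (2 * l0 + (S - x))) ^ 2 = l1 ^ 2 * (2 * l0 + (S - x)) ^ 2 := by ring
      _ ≤ _ := ht
      _ = (√2 * l0 * (2 * l1 + x)) ^ 2 := by rw [mul_pow, mul_pow, hq]
  have h4 : l1 * (2 * l0 + (S - A)) < l1 * (2 * l0 + (S - x)) := by gcongr
  have h5 : √2 * l0 * (2 * l1 + x) < √2 * l0 * (2 * l1 + A) := by gcongr
  linarith

/-- The converse direction; `x ≤ S` keeps the squared quantity nonnegative, so that squaring
preserves the order. -/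
theorem IsOptSplit.lt_of_not_test {l0 l1 A S : ℝ} (h : IsOptSplit l0 l1 A (S - A)) (h0 : 0 < l0)
    (h1 : 0 < l1) {x : ℝ} (hxS : x ≤ S)
    (ht : 2 * l0 ^ 2 * (2 * l1 + x) ^ 2 < l1 ^ 2 * (2 * l0 + (S - x)) ^ 2) : x < A := by
  have hq : √2 ^ 2 = (2 : ℝ) := Real.sq_sqrt (by norm_num)
  by_contra! hlt
  have h4 : l1 * (2 * l0 + (S - x)) ≤ l1 * (2 * l0 + (S - A)) := by gcongr
  have h5 : √2 * l0 * (2 * l1 + A) ≤ √2 * l0 * (2 * l1 + x) := by gcongr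
  have h6 : l1 * (2 * l0 + (S - x)) ≤ √2 * l0 * (2 * l1 + x) := h4.trans (h.le.trans h5)
  have h7 : 0 ≤ l1 * (2 * l0 + (S - x)) := by
    have : 0 ≤ S - x := by linarith
    positivity
  have := pow_le_pow_left₀ h7 h6 2
  rw [mul_pow, mul_pow, mul_pow, hq] at this
  linarith

/-! ### The numbers of the chain -/

section chain

variable (l0 l1 S : ℝ) (m h : ℕ)

/-- The common denominator of the chained bids. -/
noncomputable def chainDen : ℝ := (m : ℝ) ^ 3 * (2 * m * l1 + h * S)

/-- Strictly between the ends the bids form an arithmetic progression with a tiny step. They sit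
just above the bid that belongs to `A = h * S / m`, and their sum is explicit. -/
noncomputable def chainBid (j : ℕ) : ℝ :=
  if j = 0 then 0 else if j < m then 1 - m * l1 * ((m : ℝ) ^ 3 - j) / chainDen l1 S m h else 1

/-- Solves the calibration equation for the prescribed bid. It is `h / m^2` at `j = 0` and rises
slowly along the chain. -/
noncomputable def chainWeight (j : ℕ) : ℝ :=
  (h * S * (m : ℝ) ^ 3 + 2 * m * l1 * j) / ((m : ℝ) ^ 2 * S * ((m : ℝ) ^ 3 - j))

/-- Each link is allotted `h / m^2` and half a unit `1 / (2 m^2)` of room for the rising weights.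
The unused part is sent as bids of one. -/
noncomputable def restWeight (j : ℕ) : ℝ :=
  (2 * h + 1) / (2 * (m : ℝ) ^ 2) - chainWeight l1 S m h j

/-- The part of the surplus, in units of `S / (2 m)`, which is reserved for the zero outcome. -/
noncomputable def freeUnits : ℝ := 2 * m - 2 * h - 1

/-- The bid `B / (2 l0 + B)` for `B = S * freeUnits / (2 m)`. -/
noncomputable def zeroBid : ℝ := S * freeUnits m h / (4 * m * l0 + S * freeUnits m h)

/-- `2 m` times `chainDen` times the utility which is left at the outcomes with a single one. -/
noncomputable def slackNum : ℝ :=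
  l1 * (2 * chainDen l1 S m h + m * l1 * (m - 1) * (2 * (m : ℝ) ^ 3 - m))

noncomputable def mixNum : ℝ := slackNum l1 S m h * (4 * m * l0 + S * freeUnits m h)

noncomputable def mixDen : ℝ := l0 * S * freeUnits m h * (2 * m * chainDen l1 S m h)

/-- The quotient of `mixNum` by `mixDen` is the utility left by single clicks over the payment at
the zero outcome, here truncated at one. -/
noncomputable def mixProb : ℝ := min (mixNum l0 l1 S m h) (mixDen l0 l1 S m h) / mixDen l0 l1 S m h

variable {l0 l1 S m h}

structure ChainParams (l0 l1 S : ℝ) (m h : ℕ) : Prop where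
  l0_pos : 0 < l0
  l1_pos : 0 < l1
  S_pos : 0 < S
  lt : h < m
  -- Ensures that half a unit is room enough for the rising weights (`rest_nonneg`), and that the
  -- chain has at least two links.
  large : 4 * l1 + 2 * S ≤ m * S

namespace ChainParams

theorem m_ge (P : ChainParams l0 l1 S m h) : (2 : ℝ) ≤ m := by
  have h1 := P.large
  have h2 := P.l1_pos
  have h3 := P.S_pos
  by_contra! h4
  nlinarith

theorem m_pos (P : ChainParams l0 l1 S m h) : (0 : ℝ) < m := by linarith [P.m_ge]

theorem m_lt_cube (P : ChainParams l0 l1 S m h) : (m : ℝ) < (m : ℝ) ^ 3 := by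
  have := P.m_ge; nlinarith [mul_pos P.m_pos P.m_pos]

theorem den_pos (P : ChainParams l0 l1 S m h) : 0 < chainDen l1 S m h := by
  have h2 := P.l1_pos
  have h3 := P.S_pos
  have h4 := P.m_pos
  unfold chainDen; positivity

theorem sub_pos (P : ChainParams l0 l1 S m h) {j : ℕ} (hj : j < m) : 0 < (m : ℝ) ^ 3 - j := by
  have : (j : ℝ) < m := by exact_mod_cast hj
  linarith [P.m_lt_cube]

theorem free_pos (P : ChainParams l0 l1 S m h) : 0 < freeUnits m h := by
  have : (h : ℝ) + 1 ≤ m := by exact_mod_cast P.lt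
  unfold freeUnits; linarith

theorem bid_mid (_ : ChainParams l0 l1 S m h) {j : ℕ} (hj : 1 ≤ j) (hjm : j < m) :
    chainBid l1 S m h j = 1 - m * l1 * ((m : ℝ) ^ 3 - j) / chainDen l1 S m h := by
  rw [chainBid, if_neg (by omega), if_pos hjm]

theorem bid_last (P : ChainParams l0 l1 S m h) : chainBid l1 S m h m = 1 := by
  have := P.lt
  rw [chainBid, if_neg (by omega), if_neg (lt_irrefl _)]

theorem bid_zero : chainBid l1 S m h 0 = 0 := by rw [chainBid, if_pos rfl]

theorem bid_pos (P : ChainParams l0 l1 S m h) {j : ℕ} (hj : 1 ≤ j) (hjm : j < m) :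
    0 < chainBid l1 S m h j := by
  have h2 := P.l1_pos
  have h3 := P.S_pos
  have h4 := P.m_pos
  rw [P.bid_mid hj hjm, _root_.sub_pos, div_lt_one P.den_pos]
  unfold chainDen
  have : 0 < (m : ℝ) ^ 3 * (m * l1 + h * S) + m * l1 * j := by positivity
  linarith

theorem bid_lt (P : ChainParams l0 l1 S m h) {j : ℕ} (hj : j < m) :
    chainBid l1 S m h j < chainBid l1 S m h (j + 1) := by
  have h2 := P.l1_pos
  have h4 := P.m_pos
  rcases Nat.eq_zero_or_pos j with rfl | hj0
  · rw [bid_zero]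
    rcases (Nat.succ_le_of_lt hj).eq_or_lt with h1 | h1
    · have := P.m_ge
      rw [← h1] at this; norm_num at this
    · exact P.bid_pos le_rfl h1
  · rw [P.bid_mid hj0 hj]
    rcases (Nat.succ_le_of_lt hj).eq_or_lt with h1 | h1
    · rw [show j + 1 = m from h1, P.bid_last]
      have := div_pos (mul_pos (mul_pos h4 h2) (P.sub_pos hj)) P.den_pos
      linarith
    · rw [P.bid_mid (by omega) h1]
      have : m * l1 * ((m : ℝ) ^ 3 - (j + 1 : ℕ)) / chainDen l1 S m h <
          m * l1 * ((m : ℝ) ^ 3 - j) / chainDen l1 S m h := by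
        refine div_lt_div_of_pos_right ?_ P.den_pos
        refine mul_lt_mul_of_pos_left ?_ (mul_pos h4 h2)
        push_cast; linarith
      linarith

theorem weight_nonneg (P : ChainParams l0 l1 S m h) {j : ℕ} (hj : j < m) :
    0 ≤ chainWeight l1 S m h j := by
  have h2 := P.l1_pos
  have h3 := P.S_pos
  have h4 := P.m_pos
  have h5 := P.sub_pos hj
  unfold chainWeight; positivity

theorem rest_nonneg (P : ChainParams l0 l1 S m h) {j : ℕ} (hj : j < m) :
    0 ≤ restWeight l1 S m h j := by
  have h2 := P.l1_pos
  have h3 := P.S_pos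
  have h4 := P.m_pos
  have h5 := P.sub_pos hj
  have hjm : (j : ℝ) ≤ m := by exact_mod_cast hj.le
  have hhm : (h : ℝ) + 1 ≤ m := by exact_mod_cast P.lt
  unfold restWeight chainWeight
  rw [sub_nonneg, div_le_div_iff₀ (by positivity) (by positivity)]
  have e1 : m * (4 * l1 + 2 * S) * j ≤ S * (m : ℝ) ^ 3 := by
    calc m * (4 * l1 + 2 * S) * j ≤ m * (m * S) * m := by
          have := P.large
          gcongr
      _ = _ := by ring
  have e2 : (2 * h + 1) * S * j ≤ 2 * m * S * j := by gcongr; linarith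
  have e3 : 2 * (h * S * (m : ℝ) ^ 3 + 2 * m * l1 * j) ≤
    (2 * h + 1) * S * ((m : ℝ) ^ 3 - j) := by nlinarith
  nlinarith [mul_le_mul_of_nonneg_left e3 (by positivity : 0 ≤ (m : ℝ) ^ 2)]

theorem balance (P : ChainParams l0 l1 S m h) {j : ℕ} (hj : 1 ≤ j) (hjm : j < m) :
    (l1 / m + S * chainWeight l1 S m h j) * (1 - chainBid l1 S m h j) =
      l1 / m * chainBid l1 S m h j := by
  have h2 := P.l1_pos
  have h3 := P.S_pos
  have h4 := P.m_pos
  have h5 := P.sub_pos hjm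
  have h6 : 0 < 2 * m * l1 + h * S := by positivity
  rw [P.bid_mid hj hjm]
  unfold chainWeight chainDen
  field_simp
  ring

theorem zeroBid_mem (P : ChainParams l0 l1 S m h) : 0 < zeroBid l0 S m h ∧ zeroBid l0 S m h < 1 := by
  have h2 := P.l0_pos
  have h3 := P.S_pos
  have h4 := P.m_pos
  have h5 := P.free_pos
  unfold zeroBid
  refine ⟨by positivity, ?_⟩
  rw [div_lt_one (by positivity)]
  have : 0 < 4 * m * l0 := by positivity
  linarith

theorem balance_zero (P : ChainParams l0 l1 S m h) (θ : ℝ) :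
    S * (θ * freeUnits m h / (2 * m)) * (1 - zeroBid l0 S m h) = 2 * l0 * θ * zeroBid l0 S m h := by
  have h2 := P.l0_pos
  have h3 := P.S_pos
  have h4 := P.m_pos
  have h5 := P.free_pos
  have h6 : 0 < 4 * m * l0 + S * freeUnits m h := by positivity
  unfold zeroBid
  field_simp
  ring

theorem total (P : ChainParams l0 l1 S m h) (θ : ℝ) :
    ∑ j ∈ Finset.range (m - 1), (chainWeight l1 S m h (j + 1) + restWeight l1 S m h (j + 1)) +
      θ * freeUnits m h / (2 * m) +
      ((1 - θ) * freeUnits m h / (2 * m) + (2 * h + 1) / (2 * (m : ℝ) ^ 2)) = 1 := by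
  have h4 := P.m_pos
  have : ((m - 1 : ℕ) : ℝ) = m - 1 := by
    have := P.lt
    rw [Nat.cast_sub (by omega)]; simp
  simp only [restWeight, add_sub_cancel, Finset.sum_const, Finset.card_range, nsmul_eq_mul, this,
    freeUnits]
  field_simp
  ring

theorem sum_bid (P : ChainParams l0 l1 S m h) :
    l1 * (1 - 1 / (m : ℝ) * ∑ j ∈ Finset.range m, chainBid l1 S m h j) =
      slackNum l1 S m h / (2 * m * chainDen l1 S m h) := by
  have h4 := P.m_pos
  have h5 := P.den_pos
  obtain ⟨p, rfl⟩ : ∃ p, m = p + 1 := ⟨m - 1, by have := P.lt; omega⟩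
  have e1 : ∑ j ∈ Finset.range (p + 1), chainBid l1 S (p + 1) h j = ∑ j ∈ Finset.range p,
      (1 - ((p + 1 : ℕ) : ℝ) * l1 * (((p + 1 : ℕ) : ℝ) ^ 3 - (j + 1 : ℕ)) /
        chainDen l1 S (p + 1) h) := by
    rw [Finset.sum_range_succ', bid_zero, add_zero]
    exact Finset.sum_congr rfl fun j hj => P.bid_mid (by omega)
      (by have := Finset.mem_range.1 hj; omega)
  have e2 : ∑ j ∈ Finset.range p, ((j + 1 : ℕ) : ℝ) = p * (p + 1) / 2 := by
    clear * -
    induction p with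
    | zero => simp
    | succ p ih => rw [Finset.sum_range_succ, ih]; push_cast; ring
  rw [e1, Finset.sum_sub_distrib, ← Finset.sum_div, ← Finset.mul_sum, Finset.sum_sub_distrib, e2,
    slackNum]
  simp only [Finset.sum_const, Finset.card_range, nsmul_eq_mul, mul_one]
  generalize chainDen l1 S (p + 1) h = Y at h5
  push_cast at h4 ⊢
  field_simp
  ring

theorem mixDen_pos (P : ChainParams l0 l1 S m h) : 0 < mixDen l0 l1 S m h := by
  have h2 := P.l0_pos
  have h3 := P.S_pos
  have h4 := P.m_pos
  have h5 := P.free_pos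
  have h6 := P.den_pos
  unfold mixDen; positivity

theorem slackNum_pos (P : ChainParams l0 l1 S m h) : 0 < slackNum l1 S m h := by
  have h2 := P.l1_pos
  have h4 := P.m_pos
  have h5 := P.m_ge
  have h6 := P.den_pos
  have h7 := P.m_lt_cube
  have h8 : 0 < (m : ℝ) - 1 := by linarith
  have h9 : 0 < 2 * (m : ℝ) ^ 3 - m := by linarith
  unfold slackNum; positivity

theorem mixNum_pos (P : ChainParams l0 l1 S m h) : 0 < mixNum l0 l1 S m h := by
  have h2 := P.l0_pos
  have h3 := P.S_pos
  have h4 := P.m_pos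
  have h5 := P.free_pos
  have h6 := P.slackNum_pos
  unfold mixNum; positivity

theorem mixProb_mem (P : ChainParams l0 l1 S m h) :
    0 ≤ mixProb l0 l1 S m h ∧ mixProb l0 l1 S m h ≤ 1 := by
  have h1 := P.mixDen_pos
  have h2 := P.mixNum_pos
  unfold mixProb
  exact ⟨by positivity, (div_le_one h1).2 (min_le_right _ _)⟩

/-- The payment at the zero outcome is the full one, or exactly the utility available when that is
smaller. -/
theorem mixProb_mul (P : ChainParams l0 l1 S m h) :
    l0 * (mixProb l0 l1 S m h * zeroBid l0 S m h) =
      min (l1 * (1 - 1 / (m : ℝ) * ∑ j ∈ Finset.range m, chainBid l1 S m h j))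
        (l0 * zeroBid l0 S m h) := by
  have h2 := P.l0_pos
  have h3 := P.S_pos
  have h4 := P.m_pos
  have h5 := P.free_pos
  have h6 := P.den_pos
  have h7 := P.mixDen_pos
  have h8 : 0 < 4 * m * l0 + S * freeUnits m h := by positivity
  rw [P.sum_bid, mixProb, ← min_div_div_right h7.le, div_self h7.ne', mul_left_comm,
    min_mul_of_nonneg _ _ (mul_nonneg h2.le P.zeroBid_mem.1.le), one_mul]
  congr 1
  unfold mixNum mixDen zeroBid
  field_simp

/-- The average chained bid is nearly the bid for the lower end of the chain. -/
theorem le_sum_bid (P : ChainParams l0 l1 S m h) :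
    l1 * ((l1 + h * S / m) / (2 * l1 + h * S / m)) - l1 / m ≤
      l1 * (1 / (m : ℝ) * ∑ j ∈ Finset.range m, chainBid l1 S m h j) := by
  have h1 := P.l1_pos
  have h3 := P.S_pos
  have h4 := P.m_pos
  set q := (l1 + h * S / m) / (2 * l1 + h * S / m) with hq
  have hd : 0 < 2 * l1 + h * S / m := by positivity
  have hq1 : q ≤ 1 := by rw [hq, div_le_one hd]; linarith
  -- Every bid beats the target `q` except `t 0 = 0`, which costs at most one link of probability `1
  -- / m`.
  have hb : ∀ j ∈ Finset.range m, q - (if j = 0 then 1 else 0) ≤ chainBid l1 S m h j := by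
    intro j hj
    have hj := Finset.mem_range.1 hj
    split_ifs with hj0
    · rw [hj0, bid_zero]; linarith
    · have h6 : 0 < 2 * m * l1 + h * S := by positivity
      rw [P.bid_mid (by omega) hj, sub_zero]
      have e : 1 - m * l1 * ((m : ℝ) ^ 3 - j) / chainDen l1 S m h - q =
          m * l1 * j / chainDen l1 S m h := by
        rw [hq]; unfold chainDen; field_simp; ring
      have : 0 ≤ m * l1 * j / chainDen l1 S m h := div_nonneg (by positivity) P.den_pos.le
      linarith
  have hs := Finset.sum_le_sum hb
  rw [Finset.sum_sub_distrib, Finset.sum_ite_eq' (Finset.range m) 0 fun _ => (1 : ℝ),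
    if_pos (Finset.mem_range.2 (by have := P.lt; omega)), Finset.sum_const, Finset.card_range,
    nsmul_eq_mul] at hs
  have : l1 * q - l1 / m = l1 * (1 / m * (m * q - 1)) := by field_simp
  rw [this]
  gcongr

/-- The chain loses little against the optimal split. -/
theorem value_ge (P : ChainParams l0 l1 S m h) {A : ℝ} (hA : IsOptSplit l0 l1 A (S - A))
    (hlow : h * S / m ≤ A) (hup : A ≤ (h + 1) * S / m) :
    l0 * ((S - A) / (2 * l0 + (S - A))) + l1 * ((l1 + A) / (2 * l1 + A)) - (l1 + S / 2) / m ≤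
      l1 * (1 / (m : ℝ) * ∑ j ∈ Finset.range m, chainBid l1 S m h j) + l0 * zeroBid l0 S m h := by
  have h0 := P.l0_pos
  have h1 := P.l1_pos
  have h3 := P.S_pos
  have h4 := P.m_pos
  have h5 := P.free_pos
  -- `A` exceeds `h * S / m` by at most a unit `S / m`, and the amount reserved for the zero outcome
  -- falls short of `S - A` by at most half a unit. The slopes 1/4 and 1/2 make both losses `S / (4
  -- m)`.
  have e1 := tOne_sub_le h1 hA.nonneg (by positivity : 0 ≤ h * S / m)
    (by positivity : 0 ≤ S / m) (by rw [add_mul, one_mul, add_div] at hup; linarith)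
  have e2 : zeroBid l0 S m h =
      (S * freeUnits m h / (2 * m)) / (2 * l0 + S * freeUnits m h / (2 * m)) := by
    have h8 : 0 < 4 * m * l0 + S * freeUnits m h := by positivity
    have h9 : 0 < 2 * l0 * (2 * m) + S * freeUnits m h := by positivity
    unfold zeroBid
    field_simp
    ring
  have e3 := tZero_sub_le h0 (by positivity : 0 ≤ S * freeUnits m h / (2 * m)) hA.pos.le
    (by positivity : 0 ≤ S / (2 * m)) (by
      have : S * freeUnits m h / (2 * m) = S - h * S / m - S / (2 * m) := by
        unfold freeUnits; field_simp
      rw [this]; linarith)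
  rw [← e2] at e3
  have e4 := P.le_sum_bid
  have e5 : (l1 + S / 2) / m = l1 / m + S / m / 4 + S / (2 * m) / 2 := by field_simp; ring
  linarith

end ChainParams

end chain

/-! ### Bit lengths and the cost of expressions -/

theorem bitLen_le_iff {z : ℤ} {b : ℕ} : bitLen z ≤ b ↔ z.natAbs < 2 ^ b := Nat.size_le

theorem bitLen_mono {x y : ℤ} (h : x.natAbs ≤ y.natAbs) : bitLen x ≤ bitLen y := Nat.size_le_size h

theorem bitLen_add_le (x y : ℤ) : bitLen (x + y) ≤ bitLen x + bitLen y + 1 := by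
  rw [bitLen_le_iff]
  have h1 : x.natAbs < 2 ^ bitLen x := Nat.lt_size_self _
  have h2 : y.natAbs < 2 ^ bitLen y := Nat.lt_size_self _
  have h3 : 2 ^ bitLen x ≤ 2 ^ (bitLen x + bitLen y) := Nat.pow_le_pow_right (by norm_num) (by omega)
  have h4 : 2 ^ bitLen y ≤ 2 ^ (bitLen x + bitLen y) := Nat.pow_le_pow_right (by norm_num) (by omega)
  have := Int.natAbs_add_le x y
  rw [pow_succ]
  omega

theorem bitLen_neg (x : ℤ) : bitLen (-x) = bitLen x := by simp [bitLen]

theorem bitLen_sub_le (x y : ℤ) : bitLen (x - y) ≤ bitLen x + bitLen y + 1 := by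
  rw [sub_eq_add_neg, ← bitLen_neg y]; exact bitLen_add_le _ _

theorem bitLen_mul_le (x y : ℤ) : bitLen (x * y) ≤ bitLen x + bitLen y := by
  rw [bitLen_le_iff, Int.natAbs_mul, pow_add]
  exact Nat.mul_lt_mul'' (Nat.lt_size_self _) (Nat.lt_size_self _)

theorem bitLen_natCast_le (k : ℕ) : bitLen k ≤ k := by
  rw [bitLen_le_iff]; simpa using Nat.lt_two_pow_self

theorem bitLen_eval_le (f : BinOp) (x y : ℤ) : bitLen (f.eval x y) ≤ bitLen x + bitLen y + 1 := by
  cases f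
  · exact bitLen_add_le x y
  · exact bitLen_sub_le x y
  · exact (bitLen_mul_le x y).trans (Nat.le_succ _)
  · exact (bitLen_mono (Int.natAbs_ediv_le_natAbs x y)).trans (by omega)
  · have : bitLen (if x < y then 1 else 0) ≤ 1 := by split_ifs <;> simp [bitLen]
    exact this.trans (by omega)

/-- All memory cells have bit length less than `β`. -/
def Bdd (β : ℕ) (m : Mem) : Prop := ∀ a i, bitLen (m a i) + 1 ≤ β

theorem Bdd.pos {β : ℕ} {m : Mem} (h : Bdd β m) : 1 ≤ β := (Nat.le_add_left _ _).trans (h 0 0)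

theorem Bdd.write {β : ℕ} {m : Mem} (h : Bdd β m) {a : ℕ} {i z : ℤ} (hz : bitLen z + 1 ≤ β) :
    Bdd β (m.write a i z) := by
  intro b j
  unfold Mem.write
  split_ifs
  · exact hz
  · exact h b j

/-- The expression is fixed while the memory varies. Each operation at most adds the bit lengths of
its operands, up to one, so lengths stay linear in `β` and products of lengths quadratic. -/
theorem Expr.bound (e : Expr) : ∃ w, ∀ β m, Bdd β m →
    bitLen (e.eval m) ≤ w * β ∧ e.cost m ≤ w * β ^ 2 := by
  induction e with
  | const z =>
    refine ⟨1 + bitLen z, fun β m h => ?_⟩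
    have h1 : 1 ≤ β ^ 2 := Nat.one_le_pow _ _ h.pos
    have h2 := h.pos
    simp only [Expr.eval, Expr.cost]
    constructor <;> nlinarith
  | load a e ih =>
    obtain ⟨w, hw⟩ := ih
    refine ⟨2 * w + 1, fun β m h => ?_⟩
    obtain ⟨h1, h2⟩ := hw β m h
    have h3 := h a (e.eval m)
    have h4 := h.pos
    simp only [Expr.eval, Expr.cost]
    constructor
    · nlinarith
    · have h5 : β ≤ β ^ 2 := Nat.le_self_pow two_ne_zero β
      nlinarith
  | bin f e₁ e₂ ih₁ ih₂ =>
    obtain ⟨w₁, hw₁⟩ := ih₁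
    obtain ⟨w₂, hw₂⟩ := ih₂
    refine ⟨w₁ + w₂ + (1 + w₁) * (1 + w₂), fun β m h => ?_⟩
    obtain ⟨h1, h2⟩ := hw₁ β m h
    obtain ⟨h3, h4⟩ := hw₂ β m h
    have h5 := h.pos
    simp only [Expr.eval, Expr.cost]
    constructor
    · refine (bitLen_eval_le f _ _).trans ?_
      nlinarith [Nat.zero_le (w₁ * w₂ * β), Nat.zero_le (w₁ * β), Nat.zero_le (w₂ * β)]
    · have h6 : (1 + bitLen (e₁.eval m)) * (1 + bitLen (e₂.eval m)) ≤
          ((1 + w₁) * β) * ((1 + w₂) * β) := by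
        apply Nat.mul_le_mul <;> nlinarith
      calc _ ≤ w₁ * β ^ 2 + w₂ * β ^ 2 + ((1 + w₁) * β) * ((1 + w₂) * β) := by omega
        _ = _ := by ring

/-! ### Polynomially bounded runs -/

/-- The program runs from one state to the other at cost at most `w * β ^ d`. -/
def Exec (w d β : ℕ) (s : Prog) (σ τ : State) : Prop := ∃ t, Runs s σ t τ ∧ t ≤ w * β ^ d

theorem Exec.mono {w d w' d' β : ℕ} {s : Prog} {σ τ : State} (h : Exec w d β s σ τ) (hβ : 1 ≤ β)
    (hw : w ≤ w') (hd : d ≤ d') : Exec w' d' β s σ τ := by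
  obtain ⟨t, h1, h2⟩ := h
  exact ⟨t, h1, h2.trans (Nat.mul_le_mul hw (Nat.pow_le_pow_right hβ hd))⟩

theorem Exec.seq {w₁ d₁ w₂ d₂ β : ℕ} {s₁ s₂ : Prog} {σ τ υ : State} (h₁ : Exec w₁ d₁ β s₁ σ τ)
    (h₂ : Exec w₂ d₂ β s₂ τ υ) (hβ : 1 ≤ β) :
    Exec (w₁ + w₂) (max d₁ d₂) β (.seq s₁ s₂) σ υ := by
  obtain ⟨t, h1, h2⟩ := h₁.mono hβ le_rfl (le_max_left d₁ d₂)
  obtain ⟨u, h3, h4⟩ := h₂.mono hβ le_rfl (le_max_right d₁ d₂)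
  exact ⟨t + u, .seq h1 h3, by rw [add_mul]; exact add_le_add h2 h4⟩

theorem exec_store (a : ℕ) (i e : Expr) : ∃ w, ∀ β σ, Bdd β σ.mem →
    Exec w 2 β (.store a i e) σ ⟨σ.mem.write a (i.eval σ.mem) (e.eval σ.mem), σ.out⟩ := by
  obtain ⟨w₁, h₁⟩ := i.bound
  obtain ⟨w₂, h₂⟩ := e.bound
  refine ⟨2 * w₁ + 2 * w₂ + 1, fun β σ h => ⟨_, .store σ a i e, ?_⟩⟩
  obtain ⟨h3, h4⟩ := h₁ β _ h
  obtain ⟨h5, h6⟩ := h₂ β _ h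
  have h7 : β ≤ β ^ 2 := Nat.le_self_pow two_ne_zero β
  have h8 := h.pos
  nlinarith

theorem exec_emit (e : Expr) : ∃ w, ∀ β σ, Bdd β σ.mem →
    Exec w 2 β (.emit e) σ ⟨σ.mem, σ.out ++ [e.eval σ.mem]⟩ := by
  obtain ⟨w₂, h₂⟩ := e.bound
  refine ⟨2 * w₂ + 1, fun β σ h => ⟨_, .emit σ e, ?_⟩⟩
  obtain ⟨h5, h6⟩ := h₂ β _ h
  have h7 : β ≤ β ^ 2 := Nat.le_self_pow two_ne_zero β
  have h8 := h.pos
  nlinarith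

/-- Induction on the number of remaining iterations, since `Runs.loop_step` peels off the first one.
The number of iterations is absorbed by one more power of `β`. -/
theorem exec_loop (e : Expr) (s : Prog) (w d : ℕ) : ∃ w' d', ∀ β (σ : ℕ → State) (N : ℕ),
    N + 1 ≤ β → (∀ i ≤ N, Bdd β (σ i).mem) →
    (∀ i < N, e.eval (σ i).mem ≠ 0 ∧ Exec w d β s (σ i) (σ (i + 1))) →
    e.eval (σ N).mem = 0 → Exec w' d' β (.loop e s) (σ 0) (σ N) := by
  obtain ⟨c, hc⟩ := e.bound
  refine ⟨w + (2 * c + 1), max d 2 + 1, fun β σ N hN hb hs he => ?_⟩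
  set q := (w + (2 * c + 1)) * β ^ (max d 2) with hq
  have hβ : 1 ≤ β := by omega
  have hcost : ∀ i ≤ N, e.cost (σ i).mem + 1 + bitLen (e.eval (σ i).mem) ≤
      (2 * c + 1) * β ^ (max d 2) := by
    intro i hi
    obtain ⟨h1, h2⟩ := hc β _ (hb i hi)
    have h3 : β ^ 2 ≤ β ^ (max d 2) := Nat.pow_le_pow_right hβ (le_max_right _ _)
    have h4 : β ≤ β ^ 2 := Nat.le_self_pow two_ne_zero β
    nlinarith
  have key : ∀ j ≤ N, ∃ t, Runs (.loop e s) (σ (N - j)) t (σ N) ∧ t ≤ (j + 1) * q := by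
    intro j
    induction j with
    | zero =>
      intro _
      refine ⟨_, .loop_done he, ?_⟩
      have := hcost N le_rfl
      have hq' : q = w * β ^ (max d 2) + (2 * c + 1) * β ^ (max d 2) := by rw [hq]; ring
      rw [Nat.sub_zero]
      omega
    | succ j ih =>
      intro hj
      obtain ⟨u, hu, hu'⟩ := ih (by omega)
      obtain ⟨h1, t, ht, ht'⟩ := hs (N - (j + 1)) (by omega)
      rw [show N - (j + 1) + 1 = N - j by omega] at ht
      refine ⟨_, .loop_step h1 ht hu, ?_⟩
      have h2 := hcost (N - (j + 1)) (by omega)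
      have h3 : w * β ^ d ≤ w * β ^ (max d 2) :=
        Nat.mul_le_mul le_rfl (Nat.pow_le_pow_right hβ (le_max_left _ _))
      have h4 : (j + 1 + 1) * q = (j + 1) * q + (w * β ^ (max d 2) +
        (2 * c + 1) * β ^ (max d 2)) := by rw [hq]; ring
      omega
  obtain ⟨t, ht, ht'⟩ := key N le_rfl
  rw [Nat.sub_self] at ht
  refine ⟨t, ht, ht'.trans ?_⟩
  calc (N + 1) * q ≤ β * q := Nat.mul_le_mul hN le_rfl
    _ = _ := by rw [hq]; ring

/-! ### Notation for expressions -/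

instance : Add Expr := ⟨.bin .plus⟩
instance : Sub Expr := ⟨.bin .minus⟩
instance : Mul Expr := ⟨.bin .times⟩
instance (k : ℕ) : OfNat Expr k := ⟨.const k⟩

/-- The expression which is one if `x < y`, and zero otherwise. -/
def Expr.lt (x y : Expr) : Expr := .bin .less x y

/-- The integer cell of an array used as a variable. -/
def Expr.var (a : ℕ) : Expr := .load a (.const 0)

theorem Expr.eval_add (m : Mem) (x y : Expr) : (x + y).eval m = x.eval m + y.eval m := rfl
theorem Expr.eval_sub (m : Mem) (x y : Expr) : (x - y).eval m = x.eval m - y.eval m := rfl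
theorem Expr.eval_mul (m : Mem) (x y : Expr) : (x * y).eval m = x.eval m * y.eval m := rfl
theorem Expr.eval_zero (m : Mem) : Expr.eval m 0 = 0 := rfl
theorem Expr.eval_one (m : Mem) : Expr.eval m 1 = 1 := rfl
theorem Expr.eval_two (m : Mem) : Expr.eval m 2 = 2 := rfl
theorem Expr.eval_four (m : Mem) : Expr.eval m 4 = 4 := rfl
theorem Expr.eval_lt (m : Mem) (x y : Expr) :
    (x.lt y).eval m = if x.eval m < y.eval m then 1 else 0 := rfl
theorem Expr.eval_var (m : Mem) (a : ℕ) : (Expr.var a).eval m = m a 0 := rfl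

theorem Mem.write_same (m : Mem) (a : ℕ) (i z : ℤ) : m.write a i z a i = z := by simp [Mem.write]

theorem Mem.write_of_ne (m : Mem) {a b : ℕ} (i j z : ℤ) (h : b ≠ a) : m.write a i z b j = m b j := by
  simp [Mem.write, h]

theorem Mem.write_write (m : Mem) (a : ℕ) (i z z' : ℤ) :
    (m.write a i z).write a i z' = m.write a i z' := by
  funext b j; simp only [Mem.write]; split_ifs <;> rfl

theorem Mem.write_comm (m : Mem) {a b : ℕ} (h : a ≠ b) (i j z z' : ℤ) :
    (m.write a i z).write b j z' = (m.write b j z').write a i z := by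
  funext c l; simp only [Mem.write]; split_ifs <;> simp_all

theorem Mem.write_self (m : Mem) (a : ℕ) (i : ℤ) : m.write a i (m a i) = m := by
  funext c l; simp only [Mem.write]; split_ifs <;> simp_all

/-! ### Counting loops -/

/-- Run `s` with the variable `a` counting from zero up to the value of `e`, then clear `a`. -/
def Prog.for (a : ℕ) (e : Expr) (s : Prog) : Prog :=
  .seq (.store a 0 0)
    (.seq (.loop ((Expr.var a).lt e) (.seq s (.store a 0 (Expr.var a + 1)))) (.store a 0 0))

/-- The counter cell is zero in each `μ i` and is cleared at the end, so a loop whose body preserves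
memory preserves it too and can be nested. -/
theorem exec_for (a : ℕ) (e : Expr) (s : Prog) (w d : ℕ) : ∃ w' d', ∀ β (μ : ℕ → Mem)
    (o : ℕ → List ℤ) (N : ℕ), N + 1 ≤ β → (∀ i ≤ N, Bdd β (μ i)) → (∀ i ≤ N, μ i a 0 = 0) →
    (∀ i ≤ N, e.eval ((μ i).write a 0 i) = N) →
    (∀ i < N, Exec w d β s ⟨(μ i).write a 0 i, o i⟩ ⟨(μ (i + 1)).write a 0 i, o (i + 1)⟩) →
    Exec w' d' β (Prog.for a e s) ⟨μ 0, o 0⟩ ⟨μ N, o N⟩ := by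
  obtain ⟨w₁, h₁⟩ := exec_store a 0 0
  obtain ⟨w₂, h₂⟩ := exec_store a 0 (Expr.var a + 1)
  obtain ⟨w₃, d₃, h₃⟩ := exec_loop ((Expr.var a).lt e) (.seq s (.store a 0 (Expr.var a + 1)))
    (w + w₂) (max d 2)
  refine ⟨w₁ + (w₃ + w₁), max 2 (max d₃ 2), fun β μ o N hN hb hz he hs => ?_⟩
  have hβ : 1 ≤ β := by omega
  have hbw : ∀ i ≤ N, ∀ k ≤ N, Bdd β ((μ i).write a 0 k) := fun i hi k hk =>
    (hb i hi).write (by have := bitLen_natCast_le k; omega)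
  have e1 := h₁ β ⟨μ 0, o 0⟩ (hb 0 (by omega))
  have e3 := h₁ β ⟨(μ N).write a 0 N, o N⟩ (hbw N le_rfl N le_rfl)
  have h4 : (((μ N).write a 0 N).write a (Expr.eval ((μ N).write a 0 N) 0)
      (Expr.eval ((μ N).write a 0 N) 0)) = μ N := by
    simp only [Expr.eval_zero, Mem.write_write]
    conv_rhs => rw [← Mem.write_self (μ N) a 0, hz N le_rfl]
  dsimp only at e1 e3
  rw [h4] at e3
  refine e1.seq ((h₃ β (fun i => ⟨(μ i).write a 0 i, o i⟩) N hN
    (fun i hi => hbw i hi i hi) (fun i hi => ⟨?_, ?_⟩) ?_).seq e3 hβ) hβ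
  · simp only [Expr.eval_lt, Expr.eval_var, Mem.write_same, he i hi.le]
    simp [hi]
  · refine (hs i hi).seq ?_ hβ
    have e2 := h₂ β ⟨(μ (i + 1)).write a 0 i, o (i + 1)⟩ (hbw (i + 1) hi i hi.le)
    simp only [Expr.eval_zero, Expr.eval_one, Expr.eval_add, Expr.eval_var, Mem.write_same,
      Mem.write_write] at e2
    simpa using e2
  · simp only [Expr.eval_lt, Expr.eval_var, Mem.write_same, he N le_rfl]
    simp

/-! ### Programs that only write output -/

/-- Under the precondition `P`, the program appends `f m` to the output, restores the memory `m`,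
and has polynomially bounded cost. -/
def Emits (P : ℕ → Mem → Prop) (s : Prog) (f : Mem → List ℤ) : Prop :=
  ∃ w d, ∀ β m out, P β m → Exec w d β s ⟨m, out⟩ ⟨m, out ++ f m⟩

theorem Emits.emit {P : ℕ → Mem → Prop} (hP : ∀ β m, P β m → Bdd β m) (e : Expr) :
    Emits P (.emit e) fun m => [e.eval m] := by
  obtain ⟨w, h⟩ := exec_emit e
  exact ⟨w, 2, fun β m out hm => h β ⟨m, out⟩ (hP β m hm)⟩

theorem Emits.seq {P : ℕ → Mem → Prop} (hP : ∀ β m, P β m → Bdd β m) {s₁ s₂ : Prog}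
    {f g : Mem → List ℤ} (h₁ : Emits P s₁ f) (h₂ : Emits P s₂ g) :
    Emits P (.seq s₁ s₂) fun m => f m ++ g m := by
  obtain ⟨w₁, d₁, h₁⟩ := h₁
  obtain ⟨w₂, d₂, h₂⟩ := h₂
  refine ⟨w₁ + w₂, max d₁ d₂, fun β m out hm => (h₁ β m out hm).seq ?_ (hP β m hm).pos⟩
  rw [← List.append_assoc]
  exact h₂ β m _ hm

theorem Emits.mono {P Q : ℕ → Mem → Prop} (hPQ : ∀ β m, Q β m → P β m) {s : Prog}
    {f : Mem → List ℤ} (h : Emits P s f) : Emits Q s f := by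
  obtain ⟨w, d, h⟩ := h
  exact ⟨w, d, fun β m out hm => h β m out (hPQ β m hm)⟩

theorem Emits.for {P Q : ℕ → Mem → Prop} {a : ℕ} {e : Expr} {s : Prog} {f : Mem → List ℤ}
    (h : Emits P s f) (hb : ∀ β m, Q β m → Bdd β m) (hz : ∀ β m, Q β m → m a 0 = 0)
    (he : ∀ (m : Mem) (x : ℤ), e.eval (m.write a 0 x) = e.eval m)
    (hN : ∀ β m, Q β m → 0 ≤ e.eval m ∧ e.eval m + 1 ≤ β)
    (hP : ∀ β m, Q β m → ∀ i : ℕ, i + 1 ≤ β → P β (m.write a 0 i)) :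
    Emits Q (Prog.for a e s) fun m =>
      (List.range (e.eval m).toNat).flatMap fun i : ℕ => f (m.write a 0 (i : ℤ)) := by
  obtain ⟨w, d, h⟩ := h
  obtain ⟨w', d', h'⟩ := exec_for a e s w d
  refine ⟨w', d', fun β m out hm => ?_⟩
  obtain ⟨hN0, hN1⟩ := hN β m hm
  have hN' : (e.eval m).toNat + 1 ≤ β := by omega
  have := h' β (fun _ => m)
    (fun k => out ++ (List.range k).flatMap fun i : ℕ => f (m.write a 0 (i : ℤ))) (e.eval m).toNat hN'
    (fun _ _ => hb β m hm) (fun _ _ => hz β m hm)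
    (fun i _ => by rw [he, Int.toNat_of_nonneg hN0]) (fun i hi => ?_)
  · simpa using this
  · have := h β (m.write a 0 i) (out ++ (List.range i).flatMap fun i : ℕ => f (m.write a 0 (i : ℤ)))
      (hP β m hm i (by omega))
    rw [List.range_succ, List.flatMap_append]
    simpa using this

/-! ### Fractions from integers -/

/-- Truncates negative numerators and nonpositive denominators; it is faithful only under the sign
conditions of the next two lemmas. -/
def Frac.ofInt (a b : ℤ) : Frac := (a.toNat, b.toNat.toPNat')

theorem Frac.encode_ofInt {a b : ℤ} (ha : 0 ≤ a) (hb : 0 < b) : (Frac.ofInt a b).encode = [a, b] := by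
  have : 0 < b.toNat := by omega
  simp only [Frac.encode, Frac.ofInt, Nat.toPNat'_coe, this, if_true]
  rw [Int.toNat_of_nonneg ha, Int.toNat_of_nonneg hb.le]

theorem Frac.val_ofInt {a b : ℤ} (ha : 0 ≤ a) (hb : 0 < b) : (Frac.ofInt a b).val = a / b := by
  have : 0 < b.toNat := by omega
  have h1 : ((a.toNat : ℤ) : ℝ) = a := by rw [Int.toNat_of_nonneg ha]
  have h2 : ((b.toNat : ℤ) : ℝ) = b := by rw [Int.toNat_of_nonneg hb.le]
  simp only [Frac.val, Frac.ofInt, Nat.toPNat'_coe, this, if_true]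
  rw [← h1, ← h2, Int.cast_natCast, Int.cast_natCast]

/-! ### The output phase -/

namespace Code

open CalibSignal.Expr

/-- Cells used as variables: 3 the product of denominators, 4 the scaled surplus, 8 the grid level
`h`; 5, 6 and 7 are counters, in the output phase for `k - 2`, the link and the place. -/
def numBidders : Expr := var 0
def accuracy : Expr := load 0 1
/-- The number of links of the chain, `2 n³ M⁷`. -/
def size : Expr :=
  2 * (numBidders * numBidders * numBidders) *
    (accuracy * accuracy * accuracy * accuracy * accuracy * accuracy * accuracy)
/-- The integer `λ_k` times the product of all denominators. -/
def scaled (k : Expr) : Expr := bin .quot (load 1 k * var 3) (load 2 k)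
def l0 : Expr := scaled 0
def l1 : Expr := scaled 1
def surplus : Expr := var 4
def level : Expr := var 8
def place : Expr := var 7
def cube : Expr := size * size * size
def den : Expr := cube * (2 * size * l1 + level * surplus)
-- A numerator over `den`; the case distinctions are products with 0-1 tests.
def bid (j : Expr) : Expr :=
  lt 0 j * (lt j size * (cube * (size * l1 + level * surplus) + size * l1 * j) +
    (1 - lt j size) * den)
def free : Expr := 2 * size - 2 * level - 1
def slack : Expr := l1 * (2 * den + size * l1 * (size - 1) * (2 * cube - size))
def mixN : Expr := slack * (4 * size * l0 + surplus * free)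
def mixD : Expr := l0 * surplus * free * (2 * size * den)
def mix : Expr := lt mixN mixD * mixN + (1 - lt mixN mixD) * mixD
def zeroN : Expr := surplus * free
def zeroD : Expr := 4 * size * l0 + surplus * free
def weightN (j : Expr) : Expr := level * surplus * cube + 2 * size * l1 * j
def weightD (j : Expr) : Expr := size * size * surplus * (cube - j)

/-- Expressions for the weight and the bids of an atom; the bids may depend on `place`. -/
structure AtomCode where
  wn : Expr
  wd : Expr
  bn : Expr
  bd : Expr

def AtomCode.prog (A : AtomCode) : Prog :=
  .seq (.emit A.wn) (.seq (.emit A.wd) (.for 7 numBidders (.seq (.emit A.bn) (.emit A.bd))))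

def AtomCode.out (A : AtomCode) (m : Mem) : List ℤ :=
  [A.wn.eval m] ++ ([A.wd.eval m] ++ (List.range (numBidders.eval m).toNat).flatMap fun i : ℕ =>
    ([A.bn.eval (m.write 7 0 i)] ++ [A.bd.eval (m.write 7 0 i)]))

def AtomCode.atom (A : AtomCode) (n : ℕ) (m : Mem) : Atom n :=
  ⟨Frac.ofInt (A.wn.eval m) (A.wd.eval m),
    fun i => Frac.ofInt (A.bn.eval (m.write 7 0 (i : ℕ))) (A.bd.eval (m.write 7 0 (i : ℕ)))⟩

/-- The atom has the given weight and bids. -/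
structure AtomCode.Spec (A : AtomCode) {n : ℕ} (m : Mem) (w : ℝ) (b : Fin n → ℝ) : Prop where
  wd_pos : 0 < A.wd.eval m
  weight : (A.wn.eval m : ℝ) / A.wd.eval m = w
  weight_nonneg : 0 ≤ w
  bd_pos : ∀ i : Fin n, 0 < A.bd.eval (m.write 7 0 (i : ℕ))
  bid : ∀ i : Fin n,
    (A.bn.eval (m.write 7 0 (i : ℕ)) : ℝ) / A.bd.eval (m.write 7 0 (i : ℕ)) = b i
  bid_nonneg : ∀ i, 0 ≤ b i

theorem num_nonneg {a b : ℤ} {x : ℝ} (hb : 0 < b) (h : (a : ℝ) / b = x) (hx : 0 ≤ x) : 0 ≤ a := by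
  have hb' : (0 : ℝ) < b := by exact_mod_cast hb
  rw [div_eq_iff hb'.ne'] at h
  have : (0 : ℝ) ≤ a := h ▸ mul_nonneg hx hb'.le
  exact_mod_cast this

theorem AtomCode.Spec.real {A : AtomCode} {n : ℕ} {m : Mem} {w : ℝ} {b : Fin n → ℝ}
    (h : A.Spec m w b) :
    ((A.atom n m).weight.val, fun i => ((A.atom n m).bids i).val) = (w, b) := by
  refine Prod.ext ?_ (funext fun i => ?_)
  · exact (Frac.val_ofInt (num_nonneg h.wd_pos h.weight h.weight_nonneg) h.wd_pos).trans h.weight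
  · exact (Frac.val_ofInt (num_nonneg (h.bd_pos i) (h.bid i) (h.bid_nonneg i)) (h.bd_pos i)).trans
      (h.bid i)

theorem AtomCode.Spec.encode {A : AtomCode} {n : ℕ} {m : Mem} {w : ℝ} {b : Fin n → ℝ}
    (h : A.Spec m w b) (hn : numBidders.eval m = n) : (A.atom n m).encode = A.out m := by
  have e : (List.ofFn (A.atom n m).bids).flatMap Frac.encode =
      (List.range n).flatMap fun i : ℕ =>
        ([A.bn.eval (m.write 7 0 i)] ++ [A.bd.eval (m.write 7 0 i)]) := by
    rw [List.flatMap_def, List.flatMap_def]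
    congr 1
    refine List.ext_getElem (by simp) fun i h1 h2 => ?_
    have hi : i < n := by simpa using h1
    simp only [List.getElem_map, List.getElem_ofFn, List.getElem_range, AtomCode.atom]
    exact Frac.encode_ofInt (num_nonneg (h.bd_pos ⟨i, hi⟩) (h.bid ⟨i, hi⟩) (h.bid_nonneg _))
      (h.bd_pos ⟨i, hi⟩)
  rw [AtomCode.out, hn, Int.toNat_natCast, Atom.encode, e, AtomCode.atom,
    Frac.encode_ofInt (num_nonneg h.wd_pos h.weight h.weight_nonneg) h.wd_pos]
  rfl

def pairBid (x : Expr) : Expr := lt place 2 * x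
def chainBid' (x y : Expr) : Expr := lt place 1 * x + (1 - lt place 1) * (lt place 2 * y)
def surplusBid (xn xd : Expr) : Expr :=
  lt place 2 * xd + (1 - lt place 2) * (lt place (var 5 + 2) * xn)

def zeroAtom : AtomCode := ⟨mix, mixD, pairBid zeroN, zeroD⟩
def idleAtom : AtomCode := ⟨mixD - mix, mixD, pairBid 0, 1⟩
def chainAtom : AtomCode := ⟨1, size, chainBid' (bid (var 6 + 1)) (bid (var 6)), den⟩
def linkAtom : AtomCode :=
  ⟨weightN (var 6 + 1), weightD (var 6 + 1), surplusBid (bid (var 6 + 1)) den, den⟩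
def restAtom : AtomCode :=
  ⟨(2 * level + 1) * surplus * (cube - (var 6 + 1)) - 2 * weightN (var 6 + 1),
    2 * weightD (var 6 + 1), surplusBid 1 1, 1⟩
def freeAtom : AtomCode := ⟨mix * free, mixD * (2 * size), surplusBid zeroN zeroD, zeroD⟩
def lastAtom : AtomCode :=
  ⟨(mixD - mix) * free * size + (2 * level + 1) * mixD, 2 * size * size * mixD, surplusBid 1 1, 1⟩

def zeroProg : Prog := .seq (.emit 2) (.seq zeroAtom.prog idleAtom.prog)
def oneProg : Prog := .seq (.emit size) (.for 6 size chainAtom.prog)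
def manyProg : Prog :=
  .seq (.emit (2 * size)) (.seq (.for 6 (size - 1) (.seq linkAtom.prog restAtom.prog))
    (.seq freeAtom.prog lastAtom.prog))
def outputProg : Prog := .seq zeroProg (.seq oneProg (.for 5 (numBidders - 1) manyProg))

def zeroOut (m : Mem) : List ℤ := [Expr.eval m 2] ++ (zeroAtom.out m ++ idleAtom.out m)
def oneOut (m : Mem) : List ℤ :=
  [size.eval m] ++ (List.range (size.eval m).toNat).flatMap fun j : ℕ =>
    chainAtom.out (m.write 6 0 j)
def manyOut (m : Mem) : List ℤ :=
  [Expr.eval m (2 * size)] ++ ((List.range (Expr.eval m (size - 1)).toNat).flatMap (fun j : ℕ =>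
    linkAtom.out (m.write 6 0 j) ++ restAtom.out (m.write 6 0 j)) ++
    (freeAtom.out m ++ lastAtom.out m))
def outputOut (m : Mem) : List ℤ :=
  zeroOut m ++ (oneOut m ++ (List.range (Expr.eval m (numBidders - 1)).toNat).flatMap fun k : ℕ =>
    manyOut (m.write 5 0 k))

/-- The description computed by the output phase. -/
def desc (n : ℕ) (m : Mem) : Desc n
  | 0 => [zeroAtom.atom n m, idleAtom.atom n m]
  | 1 => (List.range (size.eval m).toNat).map fun j : ℕ => chainAtom.atom n (m.write 6 0 j)
  | k + 2 => (List.range (Expr.eval m (size - 1)).toNat).flatMap (fun j : ℕ =>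
      [linkAtom.atom n ((m.write 5 0 k).write 6 0 j),
        restAtom.atom n ((m.write 5 0 k).write 6 0 j)]) ++
      [freeAtom.atom n (m.write 5 0 k), lastAtom.atom n (m.write 5 0 k)]

/-! #### Cost of the output phase -/

theorem numBidders_write {m : Mem} {a : ℕ} (ha : a ≠ 0) (i z : ℤ) :
    numBidders.eval (m.write a i z) = numBidders.eval m :=
  Mem.write_of_ne m i 0 z ha.symm

theorem accuracy_write {m : Mem} {a : ℕ} (ha : a ≠ 0) (i z : ℤ) :
    accuracy.eval (m.write a i z) = accuracy.eval m :=
  Mem.write_of_ne m i 1 z ha.symm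

theorem size_write {m : Mem} {a : ℕ} (ha : a ≠ 0) (i z : ℤ) :
    size.eval (m.write a i z) = size.eval m := by
  simp only [size, eval_mul, numBidders_write ha, accuracy_write ha, eval_two]

/-- The loop bounds are small, and the memory is bounded. -/
structure Ready (β : ℕ) (m : Mem) : Prop where
  bdd : Bdd β m
  one_le : 1 ≤ numBidders.eval m
  n_lt : numBidders.eval m + 1 ≤ β
  one_le_size : 1 ≤ size.eval m
  size_lt : size.eval m + 1 ≤ β

theorem Ready.write {β : ℕ} {m : Mem} (h : Ready β m) {a : ℕ} (ha : a ≠ 0) {i : ℕ}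
    (hi : i + 1 ≤ β) : Ready β (m.write a 0 i) where
  bdd := h.bdd.write (by have := bitLen_natCast_le i; omega)
  one_le := by rw [numBidders_write ha]; exact h.one_le
  n_lt := by rw [numBidders_write ha]; exact h.n_lt
  one_le_size := by rw [size_write ha]; exact h.one_le_size
  size_lt := by rw [size_write ha]; exact h.size_lt

theorem emits_atom (A : AtomCode) : Emits (fun β m => Ready β m ∧ m 7 0 = 0) A.prog A.out := by
  have hb : ∀ β m, Ready β m ∧ m 7 0 = 0 → Bdd β m := fun _ _ h => h.1.bdd
  refine .seq hb (.emit hb _) (.seq hb (.emit hb _) ?_)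
  refine Emits.for (P := fun β m => Ready β m) (.seq (fun _ _ h => h.bdd)
      (.emit (fun _ _ h => h.bdd) _) (.emit (fun _ _ h => h.bdd) _)) hb
    (fun _ _ h => h.2) (fun m x => numBidders_write (by norm_num) _ _) (fun _ _ h => ?_)
    (fun _ _ h i hi => h.1.write (by norm_num) hi)
  exact ⟨by have := h.1.one_le; omega, h.1.n_lt⟩

theorem emits_zero : Emits (fun β m => Ready β m ∧ m 7 0 = 0) zeroProg zeroOut := by
  have hb : ∀ β m, Ready β m ∧ m 7 0 = 0 → Bdd β m := fun _ _ h => h.1.bdd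
  exact .seq hb (.emit hb _) (.seq hb (emits_atom _) (emits_atom _))

theorem write_apply_of_ne {m : Mem} {a b : ℕ} (h : b ≠ a) (x : ℤ) : m.write a 0 x b 0 = m b 0 :=
  Mem.write_of_ne m 0 0 x h

theorem emits_one : Emits (fun β m => Ready β m ∧ m 7 0 = 0 ∧ m 6 0 = 0) oneProg oneOut := by
  have hb : ∀ β m, Ready β m ∧ m 7 0 = 0 ∧ m 6 0 = 0 → Bdd β m := fun _ _ h => h.1.bdd
  refine .seq hb (.emit hb _) (Emits.for (emits_atom _) hb (fun _ _ h => h.2.2)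
    (fun m x => size_write (by norm_num) _ _) (fun _ _ h => ?_) (fun _ _ h i hi => ⟨h.1.write
      (by norm_num) hi, ?_⟩))
  · exact ⟨by have := h.1.one_le_size; omega, h.1.size_lt⟩
  · rw [write_apply_of_ne (by norm_num)]; exact h.2.1

theorem emits_many : Emits (fun β m => Ready β m ∧ m 7 0 = 0 ∧ m 6 0 = 0) manyProg manyOut := by
  have hb : ∀ β m, Ready β m ∧ m 7 0 = 0 ∧ m 6 0 = 0 → Bdd β m := fun _ _ h => h.1.bdd
  have hb' : ∀ β m, Ready β m ∧ m 7 0 = 0 → Bdd β m := fun _ _ h => h.1.bdd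
  refine .seq hb (.emit hb _) (.seq hb (Emits.for (.seq hb' (emits_atom _) (emits_atom _)) hb
    (fun _ _ h => h.2.2) (fun m x => ?_) (fun _ _ h => ?_) (fun _ _ h i hi => ⟨h.1.write
      (by norm_num) hi, ?_⟩)) ((Emits.seq hb' (emits_atom _) (emits_atom _)).mono
        fun _ _ h => ⟨h.1, h.2.1⟩))
  · simp only [eval_sub, size_write (show 6 ≠ 0 by norm_num), eval_one]
  · simp only [eval_sub, eval_one]
    have h1 := h.1.one_le_size
    have h2 := h.1.size_lt
    omega
  · rw [write_apply_of_ne (by norm_num)]; exact h.2.1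

theorem emits_output : Emits (fun β m => Ready β m ∧ m 7 0 = 0 ∧ m 6 0 = 0 ∧ m 5 0 = 0)
    outputProg outputOut := by
  have hb : ∀ β m, Ready β m ∧ m 7 0 = 0 ∧ m 6 0 = 0 ∧ m 5 0 = 0 → Bdd β m := fun _ _ h => h.1.bdd
  refine .seq hb (emits_zero.mono fun _ _ h => ⟨h.1, h.2.1⟩) (.seq hb (emits_one.mono
    fun _ _ h => ⟨h.1, h.2.1, h.2.2.1⟩) (Emits.for emits_many hb (fun _ _ h => h.2.2.2)
      (fun m x => ?_) (fun _ _ h => ?_) (fun _ _ h i hi => ⟨h.1.write (by norm_num) hi, ?_, ?_⟩)))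
  · simp only [eval_sub, numBidders_write (show 5 ≠ 0 by norm_num), eval_one]
  · simp only [eval_sub, eval_one]
    have h1 := h.1.one_le
    have h2 := h.1.n_lt
    omega
  · rw [write_apply_of_ne (by norm_num)]; exact h.2.1
  · rw [write_apply_of_ne (by norm_num)]; exact h.2.2.1

/-! #### Values of the expressions -/

/-- The memory holds the parameters of the chain. -/
structure Holds (m : Mem) (n : ℕ) (a0 a1 S : ℤ) (N h : ℕ) : Prop where
  numBidders : Code.numBidders.eval m = n
  l0 : Code.l0.eval m = a0
  l1 : Code.l1.eval m = a1
  surplus : Code.surplus.eval m = S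
  size : Code.size.eval m = N
  level : Code.level.eval m = h

variable {m : Mem} {n : ℕ} {a0 a1 S : ℤ} {N h : ℕ}

theorem scaled_write {m : Mem} {a : ℕ} (ha : 5 ≤ a) (i z : ℤ) (k : Expr)
    (hk : k.eval (m.write a i z) = k.eval m) :
    (scaled k).eval (m.write a i z) = (scaled k).eval m := by
  simp only [scaled, Expr.eval, eval_var, hk]
  rw [Mem.write_of_ne, Mem.write_of_ne, Mem.write_of_ne] <;> omega

theorem Holds.write (H : Holds m n a0 a1 S N h) {a : ℕ} (ha : 5 ≤ a) (ha' : a ≠ 8) (x : ℤ) :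
    Holds (m.write a 0 x) n a0 a1 S N h where
  numBidders := by rw [numBidders_write (by omega), H.numBidders]
  l0 := by rw [Code.l0, scaled_write ha _ _ _ rfl]; exact H.l0
  l1 := by rw [Code.l1, scaled_write ha _ _ _ rfl]; exact H.l1
  surplus := by
    rw [Code.surplus, eval_var, Mem.write_of_ne _ _ _ _ (by omega)]; exact H.surplus
  size := by rw [size_write (by omega), H.size]
  level := by rw [Code.level, eval_var, Mem.write_of_ne _ _ _ _ (by omega)]; exact H.level

theorem Holds.den (H : Holds m n a0 a1 S N h) : ((Code.den.eval m : ℤ) : ℝ) = chainDen a1 S N h := by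
  simp only [Code.den, Code.cube, eval_add, eval_mul, eval_two, H.l1, H.surplus, H.size, H.level]
  push_cast
  unfold chainDen
  ring

theorem Holds.free (H : Holds m n a0 a1 S N h) : ((Code.free.eval m : ℤ) : ℝ) = freeUnits N h := by
  simp only [Code.free, eval_sub, eval_mul, eval_two, eval_one, H.size, H.level]
  push_cast
  rfl

theorem Holds.mixN (H : Holds m n a0 a1 S N h) : ((Code.mixN.eval m : ℤ) : ℝ) = mixNum a0 a1 S N h := by
  simp only [Code.mixN, Code.slack, Code.cube, eval_add, eval_mul, eval_sub, eval_two, eval_one,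
    eval_four, H.l0, H.l1, H.surplus, H.size]
  push_cast
  rw [H.den, H.free]
  unfold mixNum slackNum
  ring

theorem Holds.mixD (H : Holds m n a0 a1 S N h) : ((Code.mixD.eval m : ℤ) : ℝ) = mixDen a0 a1 S N h := by
  simp only [Code.mixD, eval_mul, eval_two, H.l0, H.surplus, H.size]
  push_cast
  rw [H.den, H.free]
  rfl

theorem Holds.mix (H : Holds m n a0 a1 S N h)
    (P : ChainParams (a0 : ℝ) a1 S N h) : ((Code.mix.eval m : ℤ) : ℝ) = mixProb a0 a1 S N h * mixDen a0 a1 S N h := by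
  rw [mixProb, div_mul_cancel₀ _ P.mixDen_pos.ne', ← H.mixN, ← H.mixD, ← Int.cast_min]
  congr 1
  simp only [Code.mix, eval_add, eval_mul, eval_sub, eval_lt, eval_one]
  split_ifs with hlt
  · rw [min_eq_left hlt.le]; ring
  · rw [min_eq_right (not_lt.1 hlt)]; ring

theorem Holds.mixD_pos (H : Holds m n a0 a1 S N h)
    (P : ChainParams (a0 : ℝ) a1 S N h) : 0 < Code.mixD.eval m := by
  have := P.mixDen_pos
  rw [← H.mixD] at this
  exact_mod_cast this

theorem Holds.den_pos (H : Holds m n a0 a1 S N h)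
    (P : ChainParams (a0 : ℝ) a1 S N h) : 0 < Code.den.eval m := by
  have := P.den_pos
  rw [← H.den] at this
  exact_mod_cast this

theorem Holds.zeroD_pos (H : Holds m n a0 a1 S N h)
    (P : ChainParams (a0 : ℝ) a1 S N h) : 0 < Code.zeroD.eval m := by
  have h2 := P.l0_pos
  have h3 := P.S_pos
  have h4 := P.m_pos
  have h5 := P.free_pos
  have : ((Code.zeroD.eval m : ℤ) : ℝ) = 4 * N * a0 + S * freeUnits N h := by
    simp only [Code.zeroD, eval_add, eval_mul, eval_four, H.l0, H.surplus, H.size]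
    push_cast
    rw [H.free]
  have h6 : 0 < ((Code.zeroD.eval m : ℤ) : ℝ) := by rw [this]; positivity
  exact_mod_cast h6

theorem Holds.zeroBid (H : Holds m n a0 a1 S N h) :
    ((Code.zeroN.eval m : ℤ) : ℝ) / (Code.zeroD.eval m : ℤ) = CalibSignal.zeroBid a0 S N h := by
  simp only [Code.zeroN, Code.zeroD, eval_add, eval_mul, eval_four, H.l0, H.surplus, H.size]
  push_cast
  rw [H.free]
  rfl

theorem Holds.bid (H : Holds m n a0 a1 S N h)
    (P : ChainParams (a0 : ℝ) a1 S N h) {e : Expr} {j : ℕ} (hj : e.eval m = j) (hjN : j ≤ N) :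
    (((Code.bid e).eval m : ℤ) : ℝ) / (Code.den.eval m : ℤ) = chainBid a1 S N h j := by
  have hd := P.den_pos
  rw [H.den, div_eq_iff hd.ne']
  simp only [Code.bid, Code.cube, eval_add, eval_mul, eval_sub, eval_lt, eval_zero, eval_one, hj,
    H.l1, H.surplus, H.size, H.level]
  push_cast
  rw [H.den]
  rcases Nat.eq_zero_or_pos j with rfl | hj0
  · simp [ChainParams.bid_zero]
  · rcases hjN.eq_or_lt with rfl | hlt
    · rw [P.bid_last]
      simp [hj0]
    · rw [P.bid_mid hj0 hlt]
      have h1 : (0 : ℤ) < j := by exact_mod_cast hj0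
      have h2 : (j : ℤ) < N := by exact_mod_cast hlt
      simp only [h1, h2, if_true]
      have e : ∀ x : ℝ, (1 - x / chainDen a1 S N h) * chainDen a1 S N h =
          chainDen a1 S N h - x := fun x => by field_simp
      rw [e]
      unfold chainDen
      ring

theorem eval_place (m : Mem) (z : ℤ) : place.eval (m.write 7 0 z) = z := Mem.write_same _ _ _ _

theorem eval_pairBid {i : ℕ} (hp : place.eval m = i) (x : Expr) :
    (((pairBid x).eval m : ℤ) : ℝ) = if i < 2 then (x.eval m : ℝ) else 0 := by
  simp only [pairBid, eval_mul, eval_lt, hp, eval_two]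
  split_ifs with h1 h2 h2 <;> first | omega | simp

theorem eval_chainBid' {i : ℕ} (hp : place.eval m = i) (x y : Expr) :
    (((chainBid' x y).eval m : ℤ) : ℝ) =
      if i < 1 then (x.eval m : ℝ) else if i < 2 then (y.eval m : ℝ) else 0 := by
  simp only [chainBid', eval_add, eval_sub, eval_mul, eval_lt, hp, eval_two, eval_one]
  split_ifs <;> first | omega | simp

theorem eval_surplusBid {i k : ℕ} (hp : place.eval m = i) (hk : (var 5).eval m + 2 = k)
    (xn xd : Expr) : (((surplusBid xn xd).eval m : ℤ) : ℝ) =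
      if i < 2 then (xd.eval m : ℝ) else if i < k then (xn.eval m : ℝ) else 0 := by
  simp only [surplusBid, eval_add, eval_sub, eval_mul, eval_lt, hp, hk, eval_two, eval_one]
  split_ifs <;> first | omega | simp

theorem Holds.place (H : Holds m n a0 a1 S N h) (x : ℤ) :
    Holds (m.write 7 0 x) n a0 a1 S N h := H.write (by norm_num) (by norm_num) x

theorem spec_surplusBid {wn wd xn xd : Expr} {k : ℕ} {w x : ℝ}
    (hk : ∀ i : ℕ, (var 5).eval (m.write 7 0 i) + 2 = k) (h1 : 0 < wd.eval m)
    (h2 : (wn.eval m : ℝ) / wd.eval m = w) (h3 : 0 ≤ w)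
    (h4 : ∀ i : ℕ, 0 < xd.eval (m.write 7 0 i))
    (h5 : ∀ i : ℕ, (xn.eval (m.write 7 0 i) : ℝ) / xd.eval (m.write 7 0 i) = x) (h6 : 0 ≤ x) :
    AtomCode.Spec ⟨wn, wd, surplusBid xn xd, xd⟩ m w (surplusBids n k x) where
  wd_pos := h1
  weight := h2
  weight_nonneg := h3
  bd_pos i := h4 i
  bid i := by
    have hd : ((xd.eval (m.write 7 0 (i : ℕ)) : ℤ) : ℝ) ≠ 0 := by exact_mod_cast (h4 i).ne'
    dsimp only
    rw [eval_surplusBid (eval_place m i) (hk i), surplusBids]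
    split_ifs
    · exact div_self hd
    · exact h5 i
    · exact zero_div _
  bid_nonneg i := by unfold surplusBids; split_ifs <;> simp [h6]

theorem spec_zero (H : Holds m n a0 a1 S N h) (P : ChainParams (a0 : ℝ) a1 S N h) :
    zeroAtom.Spec m (mixProb a0 a1 S N h) (pairBids n (zeroBid a0 S N h)) where
  wd_pos := H.mixD_pos P
  weight := by
    simp only [zeroAtom]
    rw [H.mix P, H.mixD, mul_div_cancel_right₀ _ P.mixDen_pos.ne']
  weight_nonneg := P.mixProb_mem.1
  bd_pos i := (H.place _).zeroD_pos P
  bid i := by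
    simp only [zeroAtom]
    rw [eval_pairBid (eval_place m i), pairBids]
    split_ifs
    · exact (H.place _).zeroBid
    · exact zero_div _
  bid_nonneg i := by
    have := P.zeroBid_mem.1
    unfold pairBids; split_ifs <;> simp [this.le]

theorem spec_idle (H : Holds m n a0 a1 S N h) (P : ChainParams (a0 : ℝ) a1 S N h) :
    idleAtom.Spec m (1 - mixProb a0 a1 S N h) (pairBids n 0) where
  wd_pos := H.mixD_pos P
  weight := by
    have := P.mixDen_pos
    simp only [idleAtom, eval_sub]
    push_cast
    rw [H.mix P, H.mixD]
    field_simp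
  weight_nonneg := sub_nonneg.2 P.mixProb_mem.2
  bd_pos i := one_pos
  bid i := by
    simp only [idleAtom]
    rw [eval_pairBid (eval_place m i), pairBids, eval_zero]
    simp
  bid_nonneg i := by simp [pairBids]

theorem spec_chain (H : Holds m n a0 a1 S N h) (P : ChainParams (a0 : ℝ) a1 S N h) {j : ℕ}
    (hj : m 6 0 = j) (hjN : j < N) :
    chainAtom.Spec m (1 / (N : ℝ))
      (chainBids n (chainBid a1 S N h (j + 1)) (chainBid a1 S N h j)) where
  wd_pos := by simp only [chainAtom, H.size]; exact_mod_cast Nat.zero_lt_of_lt hjN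
  weight := by simp only [chainAtom, H.size, eval_one]; simp
  weight_nonneg := by positivity
  bd_pos i := (H.place _).den_pos P
  bid i := by
    have h6 : (var 6).eval (m.write 7 0 (i : ℕ)) = j := by
      rw [eval_var, Mem.write_of_ne _ _ _ _ (by norm_num), hj]
    simp only [chainAtom]
    rw [eval_chainBid' (eval_place m i), chainBids]
    split_ifs
    · refine (H.place _).bid P ?_ hjN
      rw [eval_add, h6, eval_one]; push_cast; rfl
    · exact (H.place _).bid P h6 hjN.le
    · exact zero_div _
  bid_nonneg i := by
    have h1 : ∀ j ≤ N, 0 ≤ chainBid a1 S N h j := by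
      intro j hj
      rcases Nat.eq_zero_or_pos j with rfl | hj0
      · rw [ChainParams.bid_zero]
      · rcases hj.eq_or_lt with rfl | hlt
        · rw [P.bid_last]; norm_num
        · exact (P.bid_pos hj0 hlt).le
    unfold chainBids
    split_ifs
    · exact h1 _ hjN
    · exact h1 _ hjN.le
    · exact le_rfl

theorem Holds.weightD {e : Expr} (H : Holds m n a0 a1 S N h) {j : ℕ} (hj : e.eval m = j) :
    (((Code.weightD e).eval m : ℤ) : ℝ) = (N : ℝ) ^ 2 * S * ((N : ℝ) ^ 3 - j) := by
  simp only [Code.weightD, Code.cube, eval_mul, eval_sub, H.size, H.surplus, hj]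
  push_cast
  ring

theorem Holds.weightN {e : Expr} (H : Holds m n a0 a1 S N h) {j : ℕ} (hj : e.eval m = j) :
    (((Code.weightN e).eval m : ℤ) : ℝ) = h * S * (N : ℝ) ^ 3 + 2 * N * a1 * j := by
  simp only [Code.weightN, Code.cube, eval_mul, eval_add, H.size, H.surplus, H.level, H.l1,
    eval_two, hj]
  push_cast
  ring

theorem Holds.weightD_pos {e : Expr} (H : Holds m n a0 a1 S N h)
    (P : ChainParams (a0 : ℝ) a1 S N h) {j : ℕ} (hj : e.eval m = j) (hjN : j < N) :
    0 < (Code.weightD e).eval m := by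
  have h3 := P.S_pos
  have h4 := P.m_pos
  have h5 := P.sub_pos hjN
  have : (0 : ℝ) < ((Code.weightD e).eval m : ℤ) := by rw [H.weightD hj]; positivity
  exact_mod_cast this

theorem spec_link (H : Holds m n a0 a1 S N h) (P : ChainParams (a0 : ℝ) a1 S N h) {j k : ℕ}
    (hj : m 6 0 = j) (hjN : j + 1 < N) (hk : m 5 0 = k) :
    linkAtom.Spec m (chainWeight a1 S N h (j + 1))
      (surplusBids n (k + 2) (chainBid a1 S N h (j + 1))) := by
  have h6 : (var 6 + 1 : Expr).eval m = (j + 1 : ℕ) := by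
    rw [eval_add, eval_var, hj, eval_one]; push_cast; rfl
  have h6' : ∀ i : ℕ, (var 6 + 1 : Expr).eval (m.write 7 0 i) = (j + 1 : ℕ) := fun i => by
    rw [eval_add, eval_var, Mem.write_of_ne _ _ _ _ (by norm_num), hj, eval_one]; push_cast; rfl
  refine spec_surplusBid (fun i => ?_) (H.weightD_pos P h6 hjN) ?_ (P.weight_nonneg hjN)
    (fun i => (H.place _).den_pos P) (fun i => (H.place _).bid P (h6' i) hjN.le)
    (P.bid_pos (by omega) hjN).le
  · rw [eval_var, Mem.write_of_ne _ _ _ _ (by norm_num), hk]; push_cast; rfl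
  · rw [H.weightN h6, H.weightD h6]; rfl

theorem spec_rest (H : Holds m n a0 a1 S N h) (P : ChainParams (a0 : ℝ) a1 S N h) {j k : ℕ}
    (hj : m 6 0 = j) (hjN : j + 1 < N) (hk : m 5 0 = k) :
    restAtom.Spec m (restWeight a1 S N h (j + 1)) (surplusBids n (k + 2) 1) := by
  have h6 : (var 6 + 1 : Expr).eval m = (j + 1 : ℕ) := by
    rw [eval_add, eval_var, hj, eval_one]; push_cast; rfl
  refine spec_surplusBid (fun i => ?_) ?_ ?_ (P.rest_nonneg hjN)
    (fun i => one_pos) (fun i => by simp [eval_one]) zero_le_one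
  · rw [eval_var, Mem.write_of_ne _ _ _ _ (by norm_num), hk]; push_cast; rfl
  · rw [eval_mul, eval_two]
    have := H.weightD_pos P h6 hjN
    omega
  · have h3 := P.S_pos
    have h4 := P.m_pos
    have h5 := P.sub_pos hjN
    simp only [eval_mul, eval_add, eval_sub, eval_two, eval_one (m := m), H.level, H.surplus]
    rw [show Expr.eval m (var 6) + 1 = (j + 1 : ℕ) from h6]
    push_cast
    rw [H.weightN h6, H.weightD h6]
    simp only [Code.cube, eval_mul, H.size, restWeight, chainWeight]
    push_cast at h5 ⊢
    field_simp

theorem spec_free (H : Holds m n a0 a1 S N h) (P : ChainParams (a0 : ℝ) a1 S N h) {k : ℕ}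
    (hk : m 5 0 = k) :
    freeAtom.Spec m (mixProb a0 a1 S N h * freeUnits N h / (2 * N))
      (surplusBids n (k + 2) (zeroBid a0 S N h)) := by
  have h2 := P.mixDen_pos
  have h3 := P.free_pos
  have h4 := P.m_pos
  have h5 := P.mixProb_mem.1
  refine spec_surplusBid (fun i => ?_) ?_ ?_ (by positivity)
    (fun i => (H.place _).zeroD_pos P) (fun i => (H.place _).zeroBid) P.zeroBid_mem.1.le
  · rw [eval_var, Mem.write_of_ne _ _ _ _ (by norm_num), hk]; push_cast; rfl
  · rw [eval_mul, eval_mul, eval_two, H.size]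
    have h6 := H.mixD_pos P
    have h7 : (0 : ℤ) < N := by exact_mod_cast h4
    positivity
  · simp only [eval_mul, eval_two, H.size]
    push_cast
    rw [H.mix P, H.free, H.mixD]
    field_simp

theorem spec_last (H : Holds m n a0 a1 S N h) (P : ChainParams (a0 : ℝ) a1 S N h) {k : ℕ}
    (hk : m 5 0 = k) :
    lastAtom.Spec m ((1 - mixProb a0 a1 S N h) * freeUnits N h / (2 * N) +
      (2 * h + 1) / (2 * (N : ℝ) ^ 2)) (surplusBids n (k + 2) 1) := by
  have h2 := P.mixDen_pos
  have h3 := P.free_pos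
  have h4 := P.m_pos
  have h5 : 0 ≤ 1 - mixProb a0 a1 S N h := sub_nonneg.2 P.mixProb_mem.2
  refine spec_surplusBid (fun i => ?_) ?_ ?_ (by positivity)
    (fun i => one_pos) (fun i => by simp [eval_one]) zero_le_one
  · rw [eval_var, Mem.write_of_ne _ _ _ _ (by norm_num), hk]; push_cast; rfl
  · simp only [eval_mul, eval_two, H.size]
    have h6 := H.mixD_pos P
    have h7 : (0 : ℤ) < N := by exact_mod_cast h4
    positivity
  · simp only [eval_mul, eval_add, eval_sub, eval_two, eval_one (m := m), H.size, H.level]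
    push_cast
    rw [H.mix P, H.free, H.mixD]
    field_simp

theorem Holds.size_sub (H : Holds m n a0 a1 S N h) (hN : 1 ≤ N) :
    (Expr.eval m (Code.size - 1)).toNat = N - 1 := by
  rw [eval_sub, eval_one, H.size]; omega

theorem Holds.level_write (H : Holds m n a0 a1 S N h) (k : ℕ) :
    Holds (m.write 5 0 k) n a0 a1 S N h := H.write (by norm_num) (by norm_num) _

theorem Holds.link_write (H : Holds m n a0 a1 S N h) (j : ℕ) :
    Holds (m.write 6 0 j) n a0 a1 S N h := H.write (by norm_num) (by norm_num) _

theorem write_link_five (k j : ℤ) : (m.write 5 0 k).write 6 0 j 5 0 = k := by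
  rw [Mem.write_of_ne _ _ _ _ (by norm_num), Mem.write_same]

/-- The chain conditions are homogeneous in the masses, so parameters scaled by the common
denominator `c` give a chain for `λ` itself. -/
theorem isChain_desc {lam : Outcome n → ℝ} (H : Holds m n a0 a1 S N h)
    (P : ChainParams (a0 : ℝ) a1 S N h) {c : ℝ} (hc : 0 < c) (h0 : (a0 : ℝ) = levelProb lam 0 * c)
    (h1 : (a1 : ℝ) = levelProb lam 1 * c)
    (hS : (S : ℝ) = (∑ k ∈ Finset.Icc 2 n, ((k : ℝ) - 2) * levelProb lam k) * c) :
    IsChain lam (desc n m) N (chainBid a1 S N h) (chainWeight a1 S N h) (restWeight a1 S N h)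
      (mixProb a0 a1 S N h) (zeroBid a0 S N h) (mixProb a0 a1 S N h * freeUnits N h / (2 * N))
      ((1 - mixProb a0 a1 S N h) * freeUnits N h / (2 * N) + (2 * h + 1) / (2 * (N : ℝ) ^ 2)) where
  pos := by have := P.lt; omega
  real_zero := by
    simp only [Desc.real, desc, List.map_cons, List.map_nil, (spec_zero H P).real,
      (spec_idle H P).real]
  real_one := by
    simp only [Desc.real, desc, List.map_map, H.size, Int.toNat_natCast]
    refine List.map_congr_left fun j hj => ?_
    exact (spec_chain (H.link_write j) P (Mem.write_same _ _ _ _) (List.mem_range.1 hj)).real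
  real_of_two_le k hk _ := by
    obtain ⟨k, rfl⟩ := Nat.exists_eq_add_of_le' hk
    have hN : 1 ≤ N := by have := P.lt; omega
    simp only [Desc.real, desc, List.map_append, List.map_flatMap, List.map_cons, List.map_nil,
      H.size_sub hN, (spec_free (H.level_write k) P (Mem.write_same _ _ _ _)).real,
      (spec_last (H.level_write k) P (Mem.write_same _ _ _ _)).real]
    congr 1
    rw [List.flatMap_def, List.flatMap_def]
    congr 1
    refine List.map_congr_left fun j hj => ?_
    have hjN : j + 1 < N := by have := List.mem_range.1 hj; omega
    rw [(spec_link ((H.level_write k).link_write j) P (Mem.write_same _ _ _ _) hjN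
      (write_link_five _ _)).real, (spec_rest ((H.level_write k).link_write j) P
      (Mem.write_same _ _ _ _) hjN (write_link_five _ _)).real]
  t_zero := ChainParams.bid_zero
  t_last := P.bid_last
  t_lt j hj := P.bid_lt hj
  s_mem := ⟨P.zeroBid_mem.1.le, P.zeroBid_mem.2.le⟩
  balance j hj hjN := by
    have := P.balance hj hjN
    rw [← mul_left_inj' hc.ne']
    rw [h1, hS] at this ⊢
    linear_combination this
  balance_zero := by
    have := P.balance_zero (mixProb a0 a1 S N h)
    rw [← mul_left_inj' hc.ne']
    generalize zeroBid (a0 : ℝ) S N h = z at *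
    generalize mixProb (a0 : ℝ) a1 S N h = y at *
    rw [h0, hS] at this
    linear_combination this
  total := P.total _

theorem outputOut_eq (H : Holds m n a0 a1 S N h) (P : ChainParams (a0 : ℝ) a1 S N h)
    (hn : 1 ≤ n) : outputOut m = (desc n m).encode := by
  have hN : 1 ≤ N := by have := P.lt; omega
  obtain ⟨p, rfl⟩ : ∃ p, n = p + 1 := ⟨n - 1, by omega⟩
  have e0 : ((desc (p + 1) m 0).length : ℤ) :: (desc (p + 1) m 0).flatMap Atom.encode =
      zeroOut m := by
    simp only [desc, zeroOut, List.flatMap_cons, List.flatMap_nil,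
      (spec_zero H P).encode H.numBidders, (spec_idle H P).encode H.numBidders]
    simp [eval_two]
  have e1 : ((desc (p + 1) m 1).length : ℤ) :: (desc (p + 1) m 1).flatMap Atom.encode =
      oneOut m := by
    simp only [desc, oneOut, List.length_map, List.length_range, H.size, Int.toNat_natCast,
      List.flatMap_map]
    refine congrArg (List.cons _) ?_
    refine Eq.trans ?_ (List.nil_append _).symm
    rw [List.flatMap_def, List.flatMap_def]
    congr 1
    refine List.map_congr_left fun j hj => ?_
    exact (spec_chain (H.link_write j) P (Mem.write_same _ _ _ _) (List.mem_range.1 hj)).encode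
      (H.link_write j).numBidders
  have e2 : ∀ k : ℕ, ((desc (p + 1) m (k + 2)).length : ℤ) ::
      (desc (p + 1) m (k + 2)).flatMap Atom.encode = manyOut (m.write 5 0 k) := by
    intro k
    have H' := H.level_write k
    simp only [desc, manyOut, List.flatMap_append, List.flatMap_assoc, List.flatMap_cons,
      List.flatMap_nil, List.append_nil, H.size_sub hN, H'.size_sub hN,
      (spec_free H' P (Mem.write_same _ _ _ _)).encode H'.numBidders,
      (spec_last H' P (Mem.write_same _ _ _ _)).encode H'.numBidders]
    -- Two atoms for each of `N - 1` links, then the free and the last atom.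
    have hl : ((desc (p + 1) m (k + 2)).length : ℤ) = 2 * N := by
      simp only [desc, H.size_sub hN, List.length_append, List.length_flatMap]
      simp
      omega
    simp only [desc, H.size_sub hN] at hl
    rw [hl, eval_mul, eval_two, H'.size]
    refine congrArg (List.cons _) ?_
    refine Eq.trans ?_ (List.nil_append _).symm
    congr 1
    rw [List.flatMap_def, List.flatMap_def]
    congr 1
    refine List.map_congr_left fun j hj => ?_
    have hjN : j + 1 < N := by have := List.mem_range.1 hj; omega
    rw [(spec_link (H'.link_write j) P (Mem.write_same _ _ _ _) hjN
      (write_link_five _ _)).encode (H'.link_write j).numBidders,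
      (spec_rest (H'.link_write j) P (Mem.write_same _ _ _ _) hjN
      (write_link_five _ _)).encode (H'.link_write j).numBidders]
  have e3 : (Expr.eval m (Code.numBidders - 1)).toNat = p := by
    rw [eval_sub, eval_one, H.numBidders]; omega
  rw [Desc.encode, outputOut, e3, List.range_succ_eq_map, List.flatMap_cons, e0, List.flatMap_map,
    List.range_succ_eq_map, List.flatMap_cons, e1, List.flatMap_map]
  simp only [e2]

/-! ### The setup phase -/

def denProg : Prog :=
  .seq (.store 3 0 1) (.for 5 (numBidders + 1) (.store 3 0 (var 3 * load 2 (var 5))))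

def surplusProg : Prog :=
  .for 5 (numBidders - 1) (.store 4 0 (var 4 + var 5 * scaled (var 5 + 2)))

/-- Nonzero as long as the next level is below the optimal split. -/
def levelTest : Expr :=
  lt (2 * (l0 * l0) * ((2 * size * l1 + (level + 1) * surplus) *
      (2 * size * l1 + (level + 1) * surplus)))
    (l1 * l1 * ((2 * size * l0 + (size * surplus - (level + 1) * surplus)) *
      (2 * size * l0 + (size * surplus - (level + 1) * surplus))))

def levelProg : Prog := .loop levelTest (.store 8 0 (var 8 + 1))

def mainProg : Prog := .seq denProg (.seq surplusProg (.seq levelProg outputProg))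

/-- The product of the first `i` denominators. -/
def denProd (q : ℕ → ℚ) (i : ℕ) : ℤ := ∏ k ∈ Finset.range i, ((q k).den : ℤ)

/-- The integer division is exact: each denominator divides the product. -/
def scaledVal (n : ℕ) (q : ℕ → ℚ) (k : ℕ) : ℤ := (q k).num * denProd q (n + 1) / (q k).den

def surplusSum (n : ℕ) (q : ℕ → ℚ) (i : ℕ) : ℤ :=
  ∑ k ∈ Finset.range i, (k : ℤ) * scaledVal n q (k + 2)

def denMem (n M : ℕ) (q : ℕ → ℚ) : Mem := (inputState n M q).mem.write 3 0 (denProd q (n + 1))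

def surplusMem (n M : ℕ) (q : ℕ → ℚ) : Mem := (denMem n M q).write 4 0 (surplusSum n q (n - 1))

def levelMem (n M : ℕ) (q : ℕ → ℚ) (h : ℕ) : Mem := (surplusMem n M q).write 8 0 h

theorem input_num {n M : ℕ} {q : ℕ → ℚ} {k : ℕ} (hk : k ≤ n) :
    (inputState n M q).mem 1 k = (q k).num := by
  simp [inputState, hk]

theorem input_den {n M : ℕ} {q : ℕ → ℚ} {k : ℕ} (hk : k ≤ n) :
    (inputState n M q).mem 2 k = (q k).den := by
  simp [inputState, hk]

theorem input_of_three_le (n M : ℕ) (q : ℕ → ℚ) {a : ℕ} (ha : 3 ≤ a) (i : ℤ) :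
    (inputState n M q).mem a i = 0 := by
  obtain ⟨a, rfl⟩ := Nat.exists_eq_add_of_le' ha
  rfl

theorem eval_load (m : Mem) (a : ℕ) (e : Expr) : (load a e).eval m = m a (e.eval m) := rfl

theorem exec_den : ∃ w d, ∀ (n M : ℕ) (q : ℕ → ℚ) (β : ℕ), n + 2 ≤ β →
    Bdd β (inputState n M q).mem → (∀ i ≤ n + 1, bitLen (denProd q i) + 1 ≤ β) →
    Exec w d β denProg (inputState n M q) ⟨denMem n M q, []⟩ := by
  obtain ⟨w₁, h₁⟩ := exec_store 3 0 1
  obtain ⟨w₂, h₂⟩ := exec_store 3 0 (var 3 * load 2 (var 5))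
  obtain ⟨w₃, d₃, h₃⟩ := exec_for 5 (numBidders + 1) (.store 3 0 (var 3 * load 2 (var 5))) w₂ 2
  refine ⟨w₁ + w₃, max 2 d₃, fun n M q β hn hb hD => ?_⟩
  have hb' : ∀ i ≤ n + 1, Bdd β ((inputState n M q).mem.write 3 0 (denProd q i)) :=
    fun i hi => hb.write (hD i hi)
  have e1 := h₁ β (inputState n M q) hb
  have e2 := h₃ β (fun i => (inputState n M q).mem.write 3 0 (denProd q i)) (fun _ => []) (n + 1)
    (by omega) hb' (fun i _ => by
      rw [Mem.write_of_ne _ _ _ _ (by norm_num), input_of_three_le _ _ _ (by norm_num)])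
    (fun i _ => by
      rw [eval_add, eval_one, numBidders_write (by norm_num), numBidders_write (by norm_num)]
      push_cast; rfl)
    (fun i hi => by
      have e := h₂ β ⟨((inputState n M q).mem.write 3 0 (denProd q i)).write 5 0 i, []⟩
        ((hb' i hi.le).write (by have := bitLen_natCast_le i; omega))
      convert e using 2
      simp only [eval_mul, eval_load, eval_zero, eval_var, Mem.write_same,
        Mem.write_of_ne _ _ _ _ (show 3 ≠ 5 by norm_num),
        Mem.write_of_ne _ _ _ _ (show 2 ≠ 5 by norm_num),
        Mem.write_of_ne _ _ _ _ (show 2 ≠ 3 by norm_num), input_den (show i ≤ n by omega)]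
      rw [Mem.write_comm _ (show 5 ≠ 3 by norm_num), Mem.write_write, denProd,
        Finset.prod_range_succ]
      rfl)
  exact e1.seq e2 (by omega)

theorem scaled_eval {m : Mem} {k : Expr} {j : ℤ} (hk : k.eval m = j) :
    (scaled k).eval m = m 1 j * m 3 0 / m 2 j := by
  simp only [scaled, Expr.eval, BinOp.eval, eval_var, hk]

theorem denMem_scaled {n M : ℕ} {q : ℕ → ℚ} {k : ℕ} (hk : k ≤ n) :
    denMem n M q 1 k * denMem n M q 3 0 / denMem n M q 2 k = scaledVal n q k := by
  rw [denMem, Mem.write_same, Mem.write_of_ne _ _ _ _ (by norm_num),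
    Mem.write_of_ne _ _ _ _ (by norm_num), input_num hk, input_den hk, scaledVal]

theorem exec_surplus : ∃ w d, ∀ (n M : ℕ) (q : ℕ → ℚ) (β : ℕ), 1 ≤ n → n + 2 ≤ β →
    Bdd β (denMem n M q) → (∀ i ≤ n - 1, bitLen (surplusSum n q i) + 1 ≤ β) →
    Exec w d β surplusProg ⟨denMem n M q, []⟩ ⟨surplusMem n M q, []⟩ := by
  obtain ⟨w₂, h₂⟩ := exec_store 4 0 (var 4 + var 5 * scaled (var 5 + 2))
  obtain ⟨w₃, d₃, h₃⟩ := exec_for 5 (numBidders - 1)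
    (.store 4 0 (var 4 + var 5 * scaled (var 5 + 2))) w₂ 2
  refine ⟨w₃, d₃, fun n M q β hn1 hn hb hS => ?_⟩
  have hb' : ∀ i ≤ n - 1, Bdd β ((denMem n M q).write 4 0 (surplusSum n q i)) :=
    fun i hi => hb.write (hS i hi)
  have e2 := h₃ β (fun i => (denMem n M q).write 4 0 (surplusSum n q i)) (fun _ => []) (n - 1)
    (by omega) hb' (fun i _ => by
      rw [Mem.write_of_ne _ _ _ _ (by norm_num), denMem, Mem.write_of_ne _ _ _ _ (by norm_num),
        input_of_three_le _ _ _ (by norm_num)])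
    (fun i _ => by
      rw [eval_sub, eval_one, numBidders_write (by norm_num), numBidders_write (by norm_num),
        denMem, numBidders_write (by norm_num), Nat.cast_sub hn1]
      rfl)
    (fun i hi => by
      have e := h₂ β ⟨((denMem n M q).write 4 0 (surplusSum n q i)).write 5 0 i, []⟩
        ((hb' i hi.le).write (by have := bitLen_natCast_le i; omega))
      convert e using 2
      have e5 : (var 5 + 2 : Expr).eval
          (((denMem n M q).write 4 0 (surplusSum n q i)).write 5 0 i) = ((i + 2 : ℕ) : ℤ) := by
        rw [eval_add, eval_var, Mem.write_same, eval_two]; push_cast; rfl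
      simp only [eval_add _ (var 4), eval_mul, eval_zero, scaled_eval e5, eval_var, Mem.write_same,
        Mem.write_of_ne _ _ _ _ (show 4 ≠ 5 by norm_num),
        Mem.write_of_ne _ _ _ _ (show 3 ≠ 5 by norm_num),
        Mem.write_of_ne _ _ _ _ (show 3 ≠ 4 by norm_num),
        Mem.write_of_ne _ _ _ _ (show 2 ≠ 5 by norm_num),
        Mem.write_of_ne _ _ _ _ (show 2 ≠ 4 by norm_num),
        Mem.write_of_ne _ _ _ _ (show 1 ≠ 5 by norm_num),
        Mem.write_of_ne _ _ _ _ (show 1 ≠ 4 by norm_num), denMem_scaled (show i + 2 ≤ n by omega)]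
      rw [Mem.write_comm _ (show 5 ≠ 4 by norm_num), Mem.write_write, surplusSum,
        Finset.sum_range_succ]
      rfl)
  have e0 : (denMem n M q).write 4 0 (surplusSum n q 0) = denMem n M q := by
    have : denMem n M q 4 0 = surplusSum n q 0 := by
      rw [denMem, Mem.write_of_ne _ _ _ _ (by norm_num), input_of_three_le _ _ _ (by norm_num)]
      simp [surplusSum]
    rw [← this, Mem.write_self]
  rw [e0] at e2
  exact e2

theorem exec_level : ∃ w d, ∀ (n M : ℕ) (q : ℕ → ℚ) (β h : ℕ), h + 1 ≤ β →
    Bdd β (surplusMem n M q) →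
    (∀ i < h, levelTest.eval (levelMem n M q i) ≠ 0) → levelTest.eval (levelMem n M q h) = 0 →
    Exec w d β levelProg ⟨surplusMem n M q, []⟩ ⟨levelMem n M q h, []⟩ := by
  obtain ⟨w₂, h₂⟩ := exec_store 8 0 (var 8 + 1)
  obtain ⟨w₃, d₃, h₃⟩ := exec_loop levelTest (.store 8 0 (var 8 + 1)) w₂ 2
  refine ⟨w₃, d₃, fun n M q β h hh hb ht he => ?_⟩
  have hb' : ∀ i ≤ h, Bdd β (levelMem n M q i) := fun i hi =>
    hb.write (by have := bitLen_natCast_le i; omega)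
  have e2 := h₃ β (fun i => ⟨levelMem n M q i, []⟩) h hh hb' (fun i hi => ⟨ht i hi, by
    have e := h₂ β ⟨levelMem n M q i, []⟩ (hb' i hi.le)
    convert e using 2
    simp only [eval_add, eval_var, eval_one, eval_zero, levelMem, Mem.write_same, Mem.write_write]
    push_cast; rfl⟩) he
  have e0 : levelMem n M q 0 = surplusMem n M q := by
    have : surplusMem n M q 8 0 = ((0 : ℕ) : ℤ) := by
      rw [surplusMem, Mem.write_of_ne _ _ _ _ (by norm_num), denMem,
        Mem.write_of_ne _ _ _ _ (by norm_num), input_of_three_le _ _ _ (by norm_num)]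
      rfl
    rw [levelMem, ← this, Mem.write_self]
  rw [e0] at e2
  exact e2

/-- The value of the expression `size`. -/
def sizeVal (n M : ℕ) : ℕ := 2 * n ^ 3 * M ^ 7

theorem levelMem_apply_of_ne {n M : ℕ} {q : ℕ → ℚ} {h a : ℕ} (h3 : a ≠ 3) (h4 : a ≠ 4)
    (h8 : a ≠ 8) (i : ℤ) : levelMem n M q h a i = (inputState n M q).mem a i := by
  rw [levelMem, Mem.write_of_ne _ _ _ _ h8, surplusMem, Mem.write_of_ne _ _ _ _ h4, denMem,
    Mem.write_of_ne _ _ _ _ h3]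

theorem holds_levelMem {n M : ℕ} (hn : 1 ≤ n) (q : ℕ → ℚ) (h : ℕ) :
    Holds (levelMem n M q h) n (scaledVal n q 0) (scaledVal n q 1) (surplusSum n q (n - 1))
      (sizeVal n M) h where
  numBidders := levelMem_apply_of_ne (by norm_num) (by norm_num) (by norm_num) 0
  l0 := by
    rw [← denMem_scaled (M := M) (Nat.zero_le n)]
    rfl
  l1 := by
    rw [← denMem_scaled (M := M) hn]
    rfl
  surplus := by
    rw [Code.surplus, eval_var, levelMem, Mem.write_of_ne _ _ _ _ (by norm_num), surplusMem,
      Mem.write_same]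
  size := by
    have h1 : numBidders.eval (levelMem n M q h) = n :=
      levelMem_apply_of_ne (by norm_num) (by norm_num) (by norm_num) 0
    have h2 : accuracy.eval (levelMem n M q h) = M :=
      levelMem_apply_of_ne (by norm_num) (by norm_num) (by norm_num) 1
    simp only [Code.size, eval_mul, eval_two, h1, h2, sizeVal]
    push_cast
    ring
  level := by rw [Code.level, eval_var, levelMem, Mem.write_same]

theorem exec_main : ∃ w d, ∀ (n M : ℕ) (q : ℕ → ℚ) (β h : ℕ), 1 ≤ n → n + 2 ≤ β →
    1 ≤ sizeVal n M → sizeVal n M + 1 ≤ β → h < sizeVal n M → Bdd β (inputState n M q).mem →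
    (∀ i ≤ n + 1, bitLen (denProd q i) + 1 ≤ β) →
    (∀ i ≤ n - 1, bitLen (surplusSum n q i) + 1 ≤ β) →
    (∀ i < h, levelTest.eval (levelMem n M q i) ≠ 0) → levelTest.eval (levelMem n M q h) = 0 →
    Exec w d β mainProg (inputState n M q) ⟨levelMem n M q h, outputOut (levelMem n M q h)⟩ := by
  obtain ⟨w₁, d₁, h₁⟩ := exec_den
  obtain ⟨w₂, d₂, h₂⟩ := exec_surplus
  obtain ⟨w₃, d₃, h₃⟩ := exec_level
  obtain ⟨w₄, d₄, h₄⟩ := emits_output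
  refine ⟨w₁ + (w₂ + (w₃ + w₄)), max d₁ (max d₂ (max d₃ d₄)),
    fun n M q β h hn hβ hs hsβ hh hb hD hS ht he => ?_⟩
  have hb1 : Bdd β (denMem n M q) := hb.write (hD _ le_rfl)
  have hb2 : Bdd β (surplusMem n M q) := hb1.write (hS _ le_rfl)
  have hb3 : Bdd β (levelMem n M q h) := hb2.write (by have := bitLen_natCast_le h; omega)
  have H := holds_levelMem hn (M := M) q h
  have hz : ∀ a, 5 ≤ a → a ≠ 8 → levelMem n M q h a 0 = 0 := fun a ha h8 => by
    rw [levelMem_apply_of_ne (by omega) (by omega) h8, input_of_three_le _ _ _ (by omega)]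
  have hr : Ready β (levelMem n M q h) :=
    ⟨hb3, by rw [H.numBidders]; omega, by rw [H.numBidders]; omega,
      by rw [H.size]; omega, by rw [H.size]; omega⟩
  have e4 := h₄ β (levelMem n M q h) [] ⟨hr, hz 7 (by norm_num) (by norm_num),
    hz 6 (by norm_num) (by norm_num), hz 5 (by norm_num) (by norm_num)⟩
  rw [List.nil_append] at e4
  exact (h₁ n M q β hβ hb hD).seq ((h₂ n M q β hn hβ hb1 hS).seq
    ((h₃ n M q β h (by omega) hb2 ht he).seq e4 (by omega)) (by omega)) (by omega)

theorem levelTest_eval {m : Mem} {n : ℕ} {a0 a1 S : ℤ} {N h : ℕ} (H : Holds m n a0 a1 S N h) :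
    levelTest.eval m = if 2 * (a0 * a0) * ((2 * N * a1 + (h + 1) * S) * (2 * N * a1 + (h + 1) * S)) <
      a1 * a1 * ((2 * N * a0 + (N * S - (h + 1) * S)) * (2 * N * a0 + (N * S - (h + 1) * S)))
      then 1 else 0 := by
  simp only [levelTest, eval_lt, eval_mul, eval_add, eval_sub, eval_two, eval_one, H.l0, H.l1,
    H.surplus, H.size, H.level]

/-! ### Bit lengths of the memory -/

theorem bitLen_denProd_le (q : ℕ → ℚ) (i : ℕ) :
    bitLen (denProd q i) ≤ 1 + ∑ k ∈ Finset.range i, bitComplexity (q k) := by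
  induction i with
  | zero => simp [denProd, bitLen]
  | succ i ih =>
    rw [denProd, Finset.prod_range_succ, Finset.sum_range_succ]
    refine (bitLen_mul_le _ _).trans ?_
    have : bitLen ((q i).den : ℤ) ≤ bitComplexity (q i) := le_max_right _ _
    rw [denProd] at ih
    omega

theorem denProd_pos (q : ℕ → ℚ) (i : ℕ) : 0 < denProd q i :=
  Finset.prod_pos fun k _ => by exact_mod_cast (q k).den_pos

theorem scaledVal_eq {n : ℕ} (q : ℕ → ℚ) {k : ℕ} (hk : k ≤ n) :
    (scaledVal n q k : ℝ) = (q k : ℝ) * denProd q (n + 1) := by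
  have hd : ((q k).den : ℤ) ∣ denProd q (n + 1) :=
    Finset.dvd_prod_of_mem _ (Finset.mem_range.2 (by omega))
  obtain ⟨e, he⟩ := hd
  have h0 : ((q k).den : ℤ) ≠ 0 := by exact_mod_cast (q k).den_ne_zero
  have h0' : ((q k).den : ℝ) ≠ 0 := by exact_mod_cast (q k).den_ne_zero
  rw [scaledVal, he, mul_left_comm, Int.mul_ediv_cancel_left _ h0, Rat.cast_def]
  push_cast
  field_simp

theorem bdd_input {n M : ℕ} {q : ℕ → ℚ} {β : ℕ} (hn : n + 1 ≤ β) (hM : M + 1 ≤ β)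
    (hq : ∀ k ≤ n, bitComplexity (q k) + 1 ≤ β) : Bdd β (inputState n M q).mem := by
  intro a i
  have h0 : bitLen 0 = 0 := by simp [bitLen]
  have h1 := bitLen_natCast_le n
  have h2 := bitLen_natCast_le M
  rcases a with _ | _ | _ | a
  · simp only [inputState]
    split_ifs <;> omega
  · simp only [inputState]
    split_ifs with h
    · have h3 := hq i.toNat (by omega)
      have h4 : bitLen (q i.toNat).num ≤ bitComplexity (q i.toNat) := le_max_left _ _
      omega
    · omega
  · simp only [inputState]
    split_ifs with h
    · have h3 := hq i.toNat (by omega)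
      have h4 : bitLen ((q i.toNat).den : ℤ) ≤ bitComplexity (q i.toNat) := le_max_right _ _
      omega
    · omega
  · rw [input_of_three_le _ _ _ (by omega)]; omega

/-- Each scaled mass is at most the product of denominators, so the sum is bounded in value by `n *
n` times that product. Bounding lengths addition by addition would be far worse. -/
theorem bitLen_surplusSum_le {n : ℕ} {q : ℕ → ℚ} (h0 : ∀ k ≤ n, 0 ≤ q k) (h1 : ∀ k ≤ n, q k ≤ 1)
    {i : ℕ} (hi : i ≤ n - 1) :
    bitLen (surplusSum n q i) ≤ 2 * n + bitLen (denProd q (n + 1)) := by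
  have hD := denProd_pos q (n + 1)
  have hL : ∀ k ≤ n, 0 ≤ scaledVal n q k ∧ scaledVal n q k ≤ denProd q (n + 1) := by
    intro k hk
    have e := scaledVal_eq q hk
    have hD' : (0 : ℝ) < denProd q (n + 1) := by exact_mod_cast hD
    have e0 : (0 : ℝ) ≤ q k := by exact_mod_cast h0 k hk
    have e1 : (q k : ℝ) ≤ 1 := by exact_mod_cast h1 k hk
    constructor
    · have : (0 : ℝ) ≤ scaledVal n q k := by rw [e]; positivity
      exact_mod_cast this
    · have : (scaledVal n q k : ℝ) ≤ denProd q (n + 1) := by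
        rw [e]; exact mul_le_of_le_one_left hD'.le e1
      exact_mod_cast this
  have hs0 : 0 ≤ surplusSum n q i := Finset.sum_nonneg fun k hk =>
    mul_nonneg (by positivity) (hL _ (by have := Finset.mem_range.1 hk; omega)).1
  have hs1 : surplusSum n q i ≤ n * n * denProd q (n + 1) := by
    calc surplusSum n q i ≤ ∑ _k ∈ Finset.range i, (n : ℤ) * denProd q (n + 1) := by
          refine Finset.sum_le_sum fun k hk => ?_
          have hk := Finset.mem_range.1 hk
          have hk2 := hL (k + 2) (by omega)
          exact mul_le_mul (by exact_mod_cast (by omega : k ≤ n)) hk2.2 hk2.1 (by positivity)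
      _ = i * (n * denProd q (n + 1)) := by simp
      _ ≤ n * (n * denProd q (n + 1)) := by
          have : (i : ℤ) ≤ n := by exact_mod_cast (by omega : i ≤ n)
          gcongr
      _ = _ := by ring
  have h2 := bitLen_natCast_le n
  calc bitLen (surplusSum n q i) ≤ bitLen (n * n * denProd q (n + 1)) :=
        bitLen_mono (by omega)
    _ ≤ bitLen ((n : ℤ) * n) + bitLen (denProd q (n + 1)) := bitLen_mul_le _ _
    _ ≤ _ := by have := bitLen_mul_le (n : ℤ) n; omega

end Code

/-! ### The linear system and the value of a split. -/

theorem IsOptSplit.scale {l0 l1 A B c : ℝ} (h : IsOptSplit l0 l1 A B) (hc : 0 < c) :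
    IsOptSplit (l0 * c) (l1 * c) (A * c) (B * c) where
  nonneg := mul_nonneg h.nonneg hc.le
  pos := mul_pos h.pos hc
  le := by nlinarith [mul_le_mul_of_nonneg_right h.le (mul_pos hc hc).le]
  eq := fun hA => by linear_combination c * c * h.eq (pos_of_mul_pos_left hA hc.le)

/-- The number of clicks beyond the second one, in expectation. -/
noncomputable def surplusMass (n : ℕ) (L : ℕ → ℝ) : ℝ := ∑ k ∈ Finset.Icc 2 n, ((k : ℝ) - 2) * L k

/-- The part of the optimal revenue contributed by outcome profiles with at most one click. -/
noncomputable def splitValue (l0 l1 A B : ℝ) : ℝ :=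
  l0 * (B / (2 * l0 + B)) + l1 * ((l1 + A) / (2 * l1 + A))

theorem splitValue_scale {c : ℝ} (hc : 0 < c) (l0 l1 A B : ℝ) :
    splitValue (l0 * c) (l1 * c) (A * c) (B * c) = splitValue l0 l1 A B * c := by
  have e1 : 2 * (l0 * c) + B * c = (2 * l0 + B) * c := by ring
  have e2 : 2 * (l1 * c) + A * c = (2 * l1 + A) * c := by ring
  have e3 : l1 * c + A * c = (l1 + A) * c := by ring
  rw [splitValue, splitValue, e1, e2, e3, mul_div_mul_right _ _ hc.ne',
    mul_div_mul_right _ _ hc.ne']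
  ring

theorem mul_le_surplusMass {n : ℕ} (hn : 2 ≤ n) {L : ℕ → ℝ} (hL : ∀ k, 0 ≤ L k) :
    ((n : ℝ) - 2) * L n ≤ surplusMass n L := by
  refine Finset.single_le_sum (f := fun k : ℕ => ((k : ℝ) - 2) * L k) (fun k hk => ?_)
    (Finset.mem_Icc.2 ⟨hn, le_rfl⟩)
  have : (2 : ℝ) ≤ k := by exact_mod_cast (Finset.mem_Icc.1 hk).1
  exact mul_nonneg (by linarith) (hL k)

theorem surplusMass_le {n : ℕ} (hn : 2 ≤ n) {L : ℕ → ℝ} (hL : ∀ k, 0 ≤ L k)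
    (h1 : ∑ k ∈ Finset.range (n + 1), L k = 1) : surplusMass n L ≤ n - 2 := by
  have hn' : (2 : ℝ) ≤ n := by exact_mod_cast hn
  calc surplusMass n L ≤ ∑ k ∈ Finset.Icc 2 n, ((n : ℝ) - 2) * L k := by
        refine Finset.sum_le_sum fun k hk => ?_
        have : (k : ℝ) ≤ n := by exact_mod_cast (Finset.mem_Icc.1 hk).2
        exact mul_le_mul_of_nonneg_right (by linarith) (hL k)
    _ = ((n : ℝ) - 2) * ∑ k ∈ Finset.Icc 2 n, L k := by rw [Finset.mul_sum]
    _ ≤ ((n : ℝ) - 2) * 1 := by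
        refine mul_le_mul_of_nonneg_left ?_ (by linarith)
        rw [← h1, sum_range_eq_zero_one_Icc hn]
        linarith [hL 0, hL 1]
    _ = _ := mul_one _

/-- Split every `(k - 2) / k` in the same proportion `A : S - A`. Since `A < S` and `n ≥ 3`, this
leaves `b n > 0`. -/
theorem exists_linSys {n : ℕ} (hn : 3 ≤ n) {L : ℕ → ℝ} (h0 : 0 < L 0) (h1 : 0 < L 1)
    (hS : 0 < surplusMass n L) : ∃ a b, LinSys n L a b := by
  have h := IsOptSplit.of_max h0 h1 hS
  set A := max ((L 1 * surplusMass n L + 2 * L 1 * L 0 * (1 - √2)) / (L 1 + √2 * L 0)) 0 with hA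
  have hn' : (3 : ℝ) ≤ n := by exact_mod_cast hn
  have hr0 : 0 ≤ A / surplusMass n L := div_nonneg h.nonneg hS.le
  have hr1 : 0 < 1 - A / surplusMass n L := by
    rw [sub_pos, div_lt_one hS]; linarith [h.pos]
  have hk : ∀ k ∈ Finset.Icc 2 n, 0 ≤ ((k : ℝ) - 2) / k := fun k hk => by
    have : (2 : ℝ) ≤ k := by exact_mod_cast (Finset.mem_Icc.1 hk).1
    exact div_nonneg (by linarith) (by linarith)
  have hsum : ∀ r : ℝ, ∑ k ∈ Finset.Icc 2 n, L k * (k * (r * (((k : ℝ) - 2) / k))) =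
      r * surplusMass n L := fun r => by
    rw [surplusMass, Finset.mul_sum]
    refine Finset.sum_congr rfl fun k hk => ?_
    have : (2 : ℝ) ≤ k := by exact_mod_cast (Finset.mem_Icc.1 hk).1
    have : (k : ℝ) ≠ 0 := by linarith
    field_simp
  refine ⟨fun k => A / surplusMass n L * (((k : ℝ) - 2) / k),
    fun k => (1 - A / surplusMass n L) * (((k : ℝ) - 2) / k), ?_, fun k hk' => ?_, fun k hk' => ?_,
    fun k _ => by ring, ?_, ?_⟩
  · exact mul_pos hr1 (div_pos (by linarith) (by linarith))
  · exact mul_nonneg hr0 (hk k hk')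
  · exact mul_nonneg hr1.le (hk k hk')
  · rw [hsum, div_mul_cancel₀ _ hS.ne', hA, surplusMass]
  · rw [hsum, hsum, ← add_mul, add_sub_cancel, one_mul, surplusMass]

/-- The total weight which `a` puts on the clicks. -/
noncomputable def clickSum (n : ℕ) (L a : ℕ → ℝ) : ℝ := ∑ k ∈ Finset.Icc 2 n, L k * (k * a k)

namespace LinSys

variable {n : ℕ} {L a b c : ℕ → ℝ}

theorem clickSum_b (h : LinSys n L a b) : clickSum n L b = surplusMass n L - clickSum n L a :=
  eq_sub_of_add_eq' h.sum_ab

/-- The system fixes the totals of `a` and `b`, so all its solutions share one optimal split. This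
is why a single output serves them all. -/
theorem isOptSplit (h : LinSys n L a b) (h0 : 0 < L 0) (h1 : 0 < L 1) (hS : 0 < surplusMass n L) :
    IsOptSplit (L 0) (L 1) (clickSum n L a) (surplusMass n L - clickSum n L a) := by
  have := IsOptSplit.of_max h0 h1 hS
  rw [show clickSum n L a = _ from h.sum_a]
  exact this

theorem splitValue_eq (h : LinSys n L a b) :
    splitValue (L 0) (L 1) (clickSum n L a) (surplusMass n L - clickSum n L a) =
      L 0 * tZero n L b + L 1 * tOne n L a := by
  rw [← h.clickSum_b]; rfl

/-- Scale all of `b` by one factor `r < 1`. The required total solves `C / (2 λ_0 + C) = p`, that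
is, `C = 2 λ_0 p / (1 - p)`. -/
theorem exists_reduction (h : LinSys n L a b) (h0 : 0 < L 0) (h1 : 0 < L 1)
    (hS : 0 < surplusMass n L) (hlt : L 1 * (1 - tOne n L a) / L 0 < tZero n L b) :
    ∃ c, IsReduction n L a b c := by
  have hO := h.isOptSplit h0 h1 hS
  rw [← h.clickSum_b] at hO
  obtain ⟨hA, hB, -, -⟩ := hO
  have ht : tOne n L a = (L 1 + clickSum n L a) / (2 * L 1 + clickSum n L a) := rfl
  have hp : L 1 / L 0 * (1 - tOne n L a) = L 1 * (1 - tOne n L a) / L 0 := by ring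
  rw [← hp, show tZero n L b = clickSum n L b / (2 * L 0 + clickSum n L b) from rfl] at hlt
  set p := L 1 / L 0 * (1 - tOne n L a)
  have hp0 : 0 ≤ p := by
    refine mul_nonneg (by positivity) ?_
    rw [ht, sub_nonneg, div_le_one (by positivity)]
    linarith
  set B := clickSum n L b
  rw [lt_div_iff₀ (by positivity)] at hlt
  have hp1 : p < 1 := by
    by_contra! hp1
    nlinarith
  set r := 2 * L 0 * p / (1 - p) / B with hr
  have hr0 : 0 ≤ r := by
    have : 0 ≤ 1 - p := by linarith
    positivity
  have hrB : r * B = 2 * L 0 * p / (1 - p) := div_mul_cancel₀ _ hB.ne'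
  have hr1 : r < 1 := by
    have : 2 * L 0 * p / (1 - p) < B := by
      rw [div_lt_iff₀ (by linarith)]; linarith
    rw [hr, div_lt_one hB]; exact this
  have hsum : clickSum n L (fun k => r * b k) = r * B := by
    rw [clickSum, show B = ∑ k ∈ Finset.Icc 2 n, L k * (k * b k) from rfl, Finset.mul_sum]
    exact Finset.sum_congr rfl fun k _ => by ring
  refine ⟨fun k => r * b k, fun k hk => mul_nonneg hr0 (h.nonneg_b k hk),
    fun k hk => mul_le_of_le_one_left (h.nonneg_b k hk) hr1.le,
    mul_lt_of_lt_one_left h.pos hr1, ?_⟩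
  change clickSum n L (fun k => r * b k) / (2 * L 0 + clickSum n L (fun k => r * b k)) = p
  have h1p : 1 - p ≠ 0 := by linarith
  rw [hsum, hrB]
  field_simp
  ring

/-- In the second case the dual bound exceeds the welfare by a quantifiable amount. -/
theorem gap (h : LinSys n L a b) (hn : 2 ≤ n) (hL : ∀ k, 0 ≤ L k) (h0 : 0 < L 0) (h1 : 0 < L 1)
    (hS : 0 < surplusMass n L) (hc : IsReduction n L a b c) :
    L 1 + (L 1 / (2 * L 1 + clickSum n L a)) ^ 2 * (n * L n * (b n - c n)) ≤
      splitValue (L 0) (L 1) (clickSum n L a) (surplusMass n L - clickSum n L a) := by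
  have hO := h.isOptSplit h0 h1 hS
  rw [h.splitValue_eq]
  rw [← h.clickSum_b] at hO
  have hn2 : n ∈ Finset.Icc 2 n := Finset.mem_Icc.2 ⟨hn, le_rfl⟩
  -- Of the nonnegative differences only the term `k = n` is kept.
  have hsub : n * L n * (b n - c n) ≤ clickSum n L b - clickSum n L c := by
    rw [clickSum, clickSum, ← Finset.sum_sub_distrib]
    have := Finset.single_le_sum (s := Finset.Icc 2 n)
      (f := fun k : ℕ => L k * (k * b k) - L k * (k * c k)) (fun k hk => by
        rw [sub_nonneg]
        exact mul_le_mul_of_nonneg_left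
          (mul_le_mul_of_nonneg_left (hc.le k hk) (by positivity)) (hL k)) hn2
    linarith
  have hC : 0 ≤ clickSum n L c := Finset.sum_nonneg fun k hk =>
    mul_nonneg (hL k) (mul_nonneg (by positivity) (hc.nonneg k hk))
  have hbc : 0 ≤ n * L n * (b n - c n) :=
    mul_nonneg (mul_nonneg (by positivity) (hL n)) (sub_nonneg.2 hc.lt.le)
  have hg := hO.gap h0 h1 hC (by linarith)
  have he : L 0 * tZero n L c = L 1 * (1 - tOne n L a) := by
    rw [hc.eq]; field_simp
  have hb : L 0 * (clickSum n L b / (2 * L 0 + clickSum n L b)) = L 0 * tZero n L b := rfl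
  have hc' : L 0 * (clickSum n L c / (2 * L 0 + clickSum n L c)) = L 0 * tZero n L c := rfl
  rw [hb, hc', he] at hg
  have := mul_le_mul_of_nonneg_left hsub (sq_nonneg (L 1 / (2 * L 1 + clickSum n L a)))
  linarith

end LinSys

theorem revenue_le_splitValue {n : ℕ} (hn : 2 ≤ n) {lam : Outcome n → ℝ}
    (hlam : IsSymmetricPrior lam) (h0 : 0 < levelProb lam 0) (h1 : 0 < levelProb lam 1) {A : ℝ}
    (hA : IsOptSplit (levelProb lam 0) (levelProb lam 1) A (surplusMass n (levelProb lam) - A))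
    {p : Signaling n} (hp : p ∈ calibratedIR lam) :
    revenue lam p ≤ splitValue (levelProb lam 0) (levelProb lam 1) A
      (surplusMass n (levelProb lam) - A) + ∑ k ∈ Finset.Icc 2 n, levelProb lam k := by
  obtain ⟨μ, s, γ, h2, h3, h4, h5, h6⟩ := hA.exists_dual h0 h1
  refine (revenue_le_dual hn hlam hp.1 hp.2.1 h2 h3 h4 h5).trans (le_of_eq ?_)
  rw [splitValue, ← h6, sum_range_eq_zero_one_Icc hn, if_pos rfl, if_neg one_ne_zero, if_pos rfl]
  have : ∑ k ∈ Finset.Icc 2 n, levelProb lam k *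
      (if k = 0 then (1 - s) ^ 2 else if k = 1 then γ else 1 + ((k : ℝ) - 2) * μ) =
      ∑ k ∈ Finset.Icc 2 n, levelProb lam k + surplusMass n (levelProb lam) * μ := by
    rw [surplusMass, Finset.sum_mul, ← Finset.sum_add_distrib]
    refine Finset.sum_congr rfl fun k hk => ?_
    have := (Finset.mem_Icc.1 hk).1
    rw [if_neg (by omega), if_neg (by omega)]
    ring
  rw [this]
  ring

/-! ### The grid search and the guarantee of the algorithm. -/

namespace Code

/-- The test that the next level stays below the optimal split, as a comparison of integers. -/
def BelowSplit (a0 a1 S : ℤ) (N h : ℕ) : Prop :=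
  2 * (a0 * a0) * ((2 * N * a1 + (h + 1) * S) * (2 * N * a1 + (h + 1) * S)) <
    a1 * a1 * ((2 * N * a0 + (N * S - (h + 1) * S)) * (2 * N * a0 + (N * S - (h + 1) * S)))

/-- At `h = N - 1` the grid point is `S`, where nothing would be left for the zero outcome; there
the left side is at least twice the right, so the search stops. -/
theorem exists_level {a0 a1 S : ℤ} (h1 : 0 ≤ a1) (hS : 0 ≤ S) {N : ℕ} (hN : 1 ≤ N) :
    ∃ h < N, (∀ i < h, BelowSplit a0 a1 S N i) ∧ ¬ BelowSplit a0 a1 S N h := by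
  classical
  have hlast : ¬ BelowSplit a0 a1 S N (N - 1) := by
    rw [BelowSplit, not_lt, Nat.cast_sub hN]
    have hNS : (0 : ℤ) ≤ N * S := by positivity
    have hNa : (0 : ℤ) ≤ 2 * N * a1 := by positivity
    have e : (2 * N * a1) * (2 * N * a1) ≤ (2 * N * a1 + N * S) * (2 * N * a1 + N * S) := by
      apply mul_le_mul <;> linarith
    have e' := mul_le_mul_of_nonneg_left e (mul_nonneg zero_le_two (mul_self_nonneg a0))
    have : 0 ≤ a1 * a1 * ((2 * N * a0) * (2 * N * a0)) := by
      have := mul_self_nonneg (a1 * (2 * N * a0)); linarith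
    push_cast
    nlinarith
  have hex : ∃ h, ¬ BelowSplit a0 a1 S N h := ⟨_, hlast⟩
  refine ⟨Nat.find hex, ?_, fun i hi => not_not.1 (Nat.find_min hex hi), Nat.find_spec hex⟩
  have := Nat.find_min' hex hlast
  omega

theorem belowSplit_iff {a0 a1 S : ℤ} {N h : ℕ} (hN : 1 ≤ N) : BelowSplit a0 a1 S N h ↔
    2 * (a0 : ℝ) ^ 2 * (2 * a1 + (h + 1) * S / N) ^ 2 <
      (a1 : ℝ) ^ 2 * (2 * a0 + (S - (h + 1) * S / N)) ^ 2 := by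
  have hN' : (0 : ℝ) < N := by exact_mod_cast hN
  rw [BelowSplit, ← @Int.cast_lt ℝ]
  push_cast
  have e1 : 2 * (a0 : ℝ) ^ 2 * (2 * a1 + (h + 1) * S / N) ^ 2 * (N : ℝ) ^ 2 =
      2 * (a0 * a0) * ((2 * N * a1 + (h + 1) * S) * (2 * N * a1 + (h + 1) * S)) := by
    field_simp
  have e2 : (a1 : ℝ) ^ 2 * (2 * a0 + (S - (h + 1) * S / N)) ^ 2 * (N : ℝ) ^ 2 =
      a1 * a1 * ((2 * N * a0 + (N * S - (h + 1) * S)) * (2 * N * a0 + (N * S - (h + 1) * S))) := by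
    field_simp
  rw [← e1, ← e2, mul_lt_mul_iff_left₀ (by positivity)]

/-- The first failure of the test traps `A` between consecutive grid points. -/
theorem level_bounds {a0 a1 S : ℤ} {N h : ℕ} (h0 : 0 < a0) (h1 : 0 < a1) (hS : 0 ≤ S)
    (hh : h < N) (hlt : ∀ i < h, BelowSplit a0 a1 S N i) (hge : ¬ BelowSplit a0 a1 S N h) {A : ℝ}
    (hA : IsOptSplit a0 a1 A (S - A)) : h * S / N ≤ A ∧ A ≤ (h + 1) * S / N := by
  have hN : 1 ≤ N := by omega
  have hN' : (0 : ℝ) < N := by exact_mod_cast hN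
  have h0' : (0 : ℝ) < a0 := by exact_mod_cast h0
  have h1' : (0 : ℝ) < a1 := by exact_mod_cast h1
  have hS' : (0 : ℝ) ≤ S := by exact_mod_cast hS
  constructor
  · rcases Nat.eq_zero_or_pos h with rfl | hpos
    · simpa using hA.nonneg
    · obtain ⟨i, rfl⟩ := Nat.exists_eq_add_of_le' hpos
      have := (belowSplit_iff hN).1 (hlt i (Nat.lt_succ_self i))
      have hle : ((i : ℝ) + 1) * S / N ≤ S := by
        rw [div_le_iff₀ hN', mul_comm (S : ℝ)]
        have : ((i : ℝ) + 1) ≤ N := by exact_mod_cast hh.le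
        gcongr
      have := hA.lt_of_not_test h0' h1' hle this
      push_cast
      exact this.le
  · rw [belowSplit_iff hN, not_lt] at hge
    exact hA.le_of_test h0' h1' (by positivity) hge

theorem surplusSum_eq {n : ℕ} (hn : 2 ≤ n) {q : ℕ → ℚ} {L : ℕ → ℝ}
    (hq : ∀ k ≤ n, (q k : ℝ) = L k) :
    (surplusSum n q (n - 1) : ℝ) = surplusMass n L * denProd q (n + 1) := by
  rw [surplusMass, surplusSum, Finset.sum_mul, ← Finset.Ico_succ_right_eq_Icc, Nat.succ_eq_succ,
    Nat.succ_eq_add_one, Finset.sum_Ico_eq_sum_range, show n + 1 - 2 = n - 1 by omega]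
  push_cast
  refine Finset.sum_congr rfl fun k hk => ?_
  have := Finset.mem_range.1 hk
  rw [add_comm k 2, scaledVal_eq q (by omega), hq _ (by omega)]
  ring

/-- A bound on the bit lengths of all the values in the memory. -/
def bitBound (X : ℕ) : ℕ := 2 * X ^ 10 + 3 * X + 5

theorem exec_input : ∃ w d, ∀ (n M : ℕ) (q : ℕ → ℚ) (h : ℕ), 2 ≤ n → 1 ≤ M →
    (∀ k ≤ n, 0 ≤ q k ∧ q k ≤ 1) → h < sizeVal n M →
    (∀ i < h, BelowSplit (scaledVal n q 0) (scaledVal n q 1) (surplusSum n q (n - 1))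
      (sizeVal n M) i) →
    ¬ BelowSplit (scaledVal n q 0) (scaledVal n q 1) (surplusSum n q (n - 1)) (sizeVal n M) h →
    Exec w d (bitBound (n + ∑ k ∈ Finset.range (n + 1), bitComplexity (q k) + M)) mainProg
      (inputState n M q) ⟨levelMem n M q h, outputOut (levelMem n M q h)⟩ := by
  obtain ⟨w, d, hE⟩ := exec_main
  refine ⟨w, d, fun n M q h hn hM hq hh hlt hge => ?_⟩
  set X := n + ∑ k ∈ Finset.range (n + 1), bitComplexity (q k) + M with hX
  have hs1 : 1 ≤ sizeVal n M := by omega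
  have hs : sizeVal n M ≤ 2 * X ^ 10 := by
    calc sizeVal n M = 2 * (n ^ 3 * M ^ 7) := by rw [sizeVal]; ring
      _ ≤ 2 * (X ^ 3 * X ^ 7) := by gcongr <;> omega
      _ = _ := by ring
  have hc : ∀ k ≤ n, bitComplexity (q k) ≤ ∑ k ∈ Finset.range (n + 1), bitComplexity (q k) :=
    fun k hk => Finset.single_le_sum (f := fun k => bitComplexity (q k)) (fun _ _ => Nat.zero_le _)
      (Finset.mem_range.2 (by omega))
  have hd : ∀ i ≤ n + 1, bitLen (denProd q i) ≤
      1 + ∑ k ∈ Finset.range (n + 1), bitComplexity (q k) := fun i hi =>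
    (bitLen_denProd_le q i).trans (Nat.add_le_add_left (Finset.sum_le_sum_of_subset
      (Finset.range_mono hi)) 1)
  have H : ∀ i, _ := fun i => levelTest_eval (holds_levelMem (by omega : 1 ≤ n) (M := M) q i)
  refine hE n M q (bitBound X) h (by omega) (by rw [bitBound]; omega) hs1
    (by rw [bitBound]; omega) hh
    (bdd_input (by rw [bitBound]; omega) (by rw [bitBound]; omega) fun k hk => by
      have := hc k hk
      rw [bitBound]; omega)
    (fun i hi => by have := hd i hi; rw [bitBound]; omega) (fun i hi => ?_) (fun i hi => ?_) ?_
  · have h1 := bitLen_surplusSum_le (fun k hk => (hq k hk).1) (fun k hk => (hq k hk).2) hi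
    have h2 := hd (n + 1) le_rfl
    rw [bitBound]; omega
  · exact ((H i).trans (if_pos (hlt i hi))).trans_ne one_ne_zero
  · exact (H h).trans (if_neg hge)

theorem bitBound_pow_le {X d : ℕ} {Y : ℝ} (hX1 : 1 ≤ X) (hX : (X : ℝ) ≤ 2 * Y) :
    ((bitBound X ^ d : ℕ) : ℝ) ≤ ((10 * 2 ^ 10) ^ d : ℕ) * Y ^ (10 * d) := by
  have h1 : bitBound X ≤ 10 * X ^ 10 := by
    have := Nat.le_self_pow (show (10 : ℕ) ≠ 0 by norm_num) X
    rw [bitBound]; omega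
  have h2 : (bitBound X : ℝ) ≤ 10 * X ^ 10 := by exact_mod_cast h1
  push_cast
  rw [pow_mul, ← mul_pow]
  refine pow_le_pow_left₀ (Nat.cast_nonneg _) (h2.trans ?_) d
  calc (10 : ℝ) * X ^ 10 ≤ 10 * (2 * Y) ^ 10 := by gcongr
    _ = _ := by ring

end Code

/-- The minimum has two sources: `λ_1` arises when IR limits the zero outcome, the second entry when
its positive bids are sent with certainty. -/
theorem Code.exists_desc : ∃ w d, ∀ (n : ℕ), 3 ≤ n → ∀ (lam : Outcome n → ℝ),
    IsSymmetricPrior lam → 0 < levelProb lam 0 → 0 < levelProb lam 1 →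
    ∀ (q : ℕ → ℚ), (∀ k ≤ n, (q k : ℝ) = levelProb lam k) →
    ∀ (M : ℕ), 1 ≤ M → levelProb lam 1 ≤ 4 * M * levelProb lam n →
    ∃ (D : Desc n) (m : Mem),
      Exec w d (bitBound (n + ∑ k ∈ Finset.range (n + 1), bitComplexity (q k) + M)) mainProg
        (inputState n M q) ⟨m, D.encode⟩ ∧
      D.signaling ∈ calibratedIR lam ∧
      ∀ A, IsOptSplit (levelProb lam 0) (levelProb lam 1) A (surplusMass n (levelProb lam) - A) →
        min (levelProb lam 1) (splitValue (levelProb lam 0) (levelProb lam 1) A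
            (surplusMass n (levelProb lam) - A) - 1 / (2 * (n : ℝ) ^ 2 * (M : ℝ) ^ 7)) +
          ∑ k ∈ Finset.Icc 2 n, levelProb lam k ≤ revenue lam D.signaling := by
  obtain ⟨w, d, hE⟩ := exec_input
  refine ⟨w, d, fun n hn lam hlam h0 h1 q hq M hM hle => ?_⟩
  have hL : ∀ k, 0 ≤ levelProb lam k := levelProb_nonneg hlam
  have hsum := sum_levelProb hlam
  have hn3 : (3 : ℝ) ≤ n := by exact_mod_cast hn
  have hM1 : (1 : ℝ) ≤ M := by exact_mod_cast hM
  have hLle : ∀ k ≤ n, levelProb lam k ≤ 1 := fun k hk => by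
    rw [← hsum]
    exact Finset.single_le_sum (fun k _ => hL k) (Finset.mem_range.2 (by omega))
  have hmass := mul_le_surplusMass (by omega : 2 ≤ n) hL
  have hmass' := surplusMass_le (by omega : 2 ≤ n) hL hsum
  set l0 := levelProb lam 0
  set l1 := levelProb lam 1
  have hln : 0 < levelProb lam n := by
    by_contra! h
    have : 4 * (M : ℝ) * levelProb lam n ≤ 0 := mul_nonpos_of_nonneg_of_nonpos (by positivity) h
    linarith
  set s := surplusMass n (levelProb lam) with hs
  have hlns : levelProb lam n ≤ s := by nlinarith
  have hs0 : 0 < s := hln.trans_le hlns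
  set c : ℝ := Int.cast (denProd q (n + 1))
  have hc : 0 < c := Int.cast_pos.2 (denProd_pos q (n + 1))
  have e0 : (scaledVal n q 0 : ℝ) = l0 * c := by
    rw [scaledVal_eq q (Nat.zero_le n), hq 0 (Nat.zero_le n)]
  have e1 : (scaledVal n q 1 : ℝ) = l1 * c := by
    rw [scaledVal_eq q (by omega), hq 1 (by omega)]
  have eS : (surplusSum n q (n - 1) : ℝ) = s * c := surplusSum_eq (by omega) hq
  set a0 := scaledVal n q 0
  set a1 := scaledVal n q 1
  set S := surplusSum n q (n - 1)
  have ha0 : 0 < a0 := by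
    have : (0 : ℝ) < a0 := by rw [e0]; positivity
    exact_mod_cast this
  have ha1 : 0 < a1 := by
    have : (0 : ℝ) < a1 := by rw [e1]; positivity
    exact_mod_cast this
  have hS0 : 0 < S := by
    have : (0 : ℝ) < S := by rw [eS]; positivity
    exact_mod_cast this
  have hN1 : 1 ≤ sizeVal n M := Nat.succ_le_of_lt (by unfold sizeVal; positivity)
  obtain ⟨h, hh, hlt, hge⟩ := exists_level ha1.le hS0.le hN1 (a0 := a0)
  have hNe : (sizeVal n M : ℝ) = 2 * (n : ℝ) ^ 3 * (M : ℝ) ^ 7 := by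
    rw [sizeVal]; push_cast; rfl
  have hNge : 16 * (M : ℝ) + 2 ≤ sizeVal n M := by
    rw [hNe]
    have h3 : (3 : ℝ) ^ 3 ≤ (n : ℝ) ^ 3 := by gcongr
    have h4 : (M : ℝ) ≤ (M : ℝ) ^ 7 := le_self_pow₀ hM1 (by norm_num)
    have h5 : 2 * (3 : ℝ) ^ 3 * M ≤ 2 * (n : ℝ) ^ 3 * (M : ℝ) ^ 7 := by gcongr
    linarith
  have hN0 : (0 : ℝ) < sizeVal n M := by linarith
  -- Here `λ_1 ≤ 4 M λ_n ≤ 4 M s`, where `λ_n ≤ s` comes from `n ≥ 3`.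
  have hlarge : 4 * (a1 : ℝ) + 2 * S ≤ sizeVal n M * S := by
    have h2 : 4 * l1 + 2 * s ≤ (16 * (M : ℝ) + 2) * s := by
      have : 4 * (M : ℝ) * levelProb lam n ≤ 4 * M * s := by gcongr
      linarith
    have h3 : (16 * (M : ℝ) + 2) * s ≤ sizeVal n M * s := by gcongr
    rw [e1, eS]
    nlinarith [mul_le_mul_of_nonneg_right (h2.trans h3) hc.le]
  have P : ChainParams (a0 : ℝ) a1 S (sizeVal n M) h :=
    ⟨by exact_mod_cast ha0, by exact_mod_cast ha1, by exact_mod_cast hS0, hh, hlarge⟩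
  have H := holds_levelMem (by omega : 1 ≤ n) (M := M) q h
  have I := isChain_desc H P hc e0 e1 eS
  have hmix := P.mixProb_mul
  set T := 1 / (sizeVal n M : ℝ) * ∑ j ∈ Finset.range (sizeVal n M),
    chainBid a1 S (sizeVal n M) h j
  set z := zeroBid a0 S (sizeVal n M) h
  set θ := mixProb a0 a1 S (sizeVal n M) h
  have hmix' : l0 * (θ * z) = min (l1 * (1 - T)) (l0 * z) := by
    have e : l0 * (θ * z) * c = min (l1 * (1 - T)) (l0 * z) * c := by
      rw [e0, e1, mul_right_comm l1, mul_right_comm l0 c z] at hmix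
      rw [min_mul_of_nonneg _ _ hc.le]
      linear_combination hmix
    exact mul_right_cancel₀ hc.ne' e
  refine ⟨desc n (levelMem n M q h), levelMem n M q h, ?_,
    I.mem_calibratedIR (by omega) hlam (hmix'.trans_le (min_le_left _ _)), fun A hA => ?_⟩
  · rw [← outputOut_eq H P (by omega)]
    refine hE n M q h (by omega) hM (fun k hk => ?_) hh hlt hge
    have h2 := hL k
    have h3 := hLle k hk
    rw [← hq k hk] at h2 h3
    exact ⟨by exact_mod_cast h2, by exact_mod_cast h3⟩
  · have hA' := hA.scale hc
    rw [sub_mul, ← e0, ← e1, ← eS] at hA'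
    obtain ⟨hlow, hup⟩ := level_bounds ha0 ha1 hS0.le hh hlt hge hA'
    have hv := P.value_ge hA' hlow hup
    have hsc := splitValue_scale hc l0 l1 A (s - A)
    rw [sub_mul, ← e0, ← e1, ← eS] at hsc
    change splitValue a0 a1 (A * c) (S - A * c) - _ ≤ a1 * T + a0 * z at hv
    rw [hsc, e0, e1, eS] at hv
    have hv' : splitValue l0 l1 A (s - A) - (l1 + s / 2) / sizeVal n M ≤ l1 * T + l0 * z := by
      refine le_of_mul_le_mul_right (le_trans (le_of_eq ?_) (hv.trans (le_of_eq ?_))) hc <;> ring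
    -- The numerator is at most `n`, by `λ_1 ≤ 1` and `s ≤ n - 2`; the size `2 n^3 M^7` was chosen
    -- for this quotient.
    have hloss : (l1 + s / 2) / sizeVal n M ≤ 1 / (2 * (n : ℝ) ^ 2 * (M : ℝ) ^ 7) := by
      have : 1 / (2 * (n : ℝ) ^ 2 * (M : ℝ) ^ 7) = n / sizeVal n M := by
        rw [hNe]; field_simp
      rw [this]
      have := hLle 1 (by omega)
      gcongr
      linarith
    rw [I.revenue_eq (by omega) hlam, hmix']
    refine add_le_add_left ?_ _
    -- If IR binds, the payments are `λ_1 (1 - T)` and `λ_1 T`, which add up to `λ_1`.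
    rcases min_cases (l1 * (1 - T)) (l0 * z) with ⟨e, -⟩ | ⟨e, -⟩ <;> rw [e]
    · exact (min_le_left _ _).trans (le_of_eq (by ring))
    · exact (min_le_right _ _).trans (by linarith)

theorem welfare_eq {n : ℕ} (hn : 1 ≤ n) (lam : Outcome n → ℝ) :
    welfare lam = levelProb lam 1 + ∑ k ∈ Finset.Icc 2 n, levelProb lam k := by
  rw [welfare, ← Finset.add_sum_Ioc_eq_sum_Icc hn]
  rfl

/-- This explains the exponent 7: with `λ_1 ≥ ε^2` the gap is at least `(ε^2 / n)^2 * ε^3 / 2 = ε^7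
/ (2 n^2)`, and `1 / M ≤ ε`. -/
theorem pow_mul_le_gap {n M : ℕ} {ε l1 A : ℝ} (hn : 1 ≤ n) (hM : 1 ≤ M) (hε : 0 < ε)
    (hMε : 1 ≤ M * ε) (hl1 : ε ^ 2 ≤ l1) (hA0 : 0 ≤ A) (hA : 2 * l1 + A ≤ n) :
    1 / (2 * (n : ℝ) ^ 2 * (M : ℝ) ^ 7) ≤ (l1 / (2 * l1 + A)) ^ 2 * (ε * l1 / 2) := by
  have hn0 : (0 : ℝ) < n := by exact_mod_cast hn
  have hM0 : (0 : ℝ) < M := by exact_mod_cast hM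
  have hl : 0 < l1 := (by positivity : (0 : ℝ) < ε ^ 2).trans_le hl1
  calc 1 / (2 * (n : ℝ) ^ 2 * (M : ℝ) ^ 7)
      ≤ (M * ε) ^ 7 / (2 * (n : ℝ) ^ 2 * (M : ℝ) ^ 7) := by
        gcongr; exact one_le_pow₀ hMε
    _ = (ε ^ 2 / n) ^ 2 * (ε * ε ^ 2 / 2) := by field_simp
    _ ≤ (l1 / (2 * l1 + A)) ^ 2 * (ε * l1 / 2) := by gcongr

end CalibSignal

/-! ### The main theorem. -/

theorem theorem2 :
    ∃ (prog : Prog) (C d : ℕ),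
      ∀ (n : ℕ), 3 ≤ n → ∀ (lam : Outcome n → ℝ), IsSymmetricPrior lam → 0 < levelProb lam 0 →
      ∀ (q : ℕ → ℚ), (∀ k ≤ n, (q k : ℝ) = levelProb lam k) →
      ∀ (ε : ℝ), 0 < ε → ε ≤ Real.sqrt (levelProb lam 1) →
        ε ≤ 4 * levelProb lam n / levelProb lam 1 →
      -- the linear system that defines the minimum second-highest bids is solvable
      (∃ a b : ℕ → ℝ, LinSys n (levelProb lam) a b) ∧
      -- the program halts within the time bound and outputs an IR calibrated signaling
      ∃ (D : Desc n) (t : ℕ) (m : Mem),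
        Runs prog (inputState n ⌈1 / ε⌉₊ q) t ⟨m, D.encode⟩ ∧
        (t : ℝ) ≤ C * ((n : ℝ) + (∑ k ∈ Finset.range (n + 1), (bitComplexity (q k) : ℝ)) + 1 / ε) ^ d ∧
        D.signaling ∈ calibratedIR lam ∧
        ∀ a b : ℕ → ℝ, LinSys n (levelProb lam) a b →
          -- first case: the revenue is within `ε` of the IR optimum
          (tZero n (levelProb lam) b ≤
              levelProb lam 1 * (1 - tOne n (levelProb lam) a) / levelProb lam 0 →
            ∀ p ∈ calibratedIR lam, revenue lam p - ε ≤ revenue lam D.signaling) ∧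
          -- second case: for small `ε` the output is optimal and extracts the full surplus
          (levelProb lam 1 * (1 - tOne n (levelProb lam) a) / levelProb lam 0 <
              tZero n (levelProb lam) b →
            (∃ c : ℕ → ℝ, IsReduction n (levelProb lam) a b c) ∧
            ∀ c : ℕ → ℝ, IsReduction n (levelProb lam) a b c →
              ε ≤ 2 * n * levelProb lam n / levelProb lam 1 * (b n - c n) →
              revenue lam D.signaling = welfare lam ∧
              ∀ p ∈ calibratedIR lam, revenue lam p ≤ revenue lam D.signaling) := by
  obtain ⟨w, d, hD⟩ := Code.exists_desc
  refine ⟨Code.mainProg, w * (10 * 2 ^ 10) ^ d, 10 * d,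
    fun n hn lam hlam h0 q hq ε hε hε1 hεn => ?_⟩
  have hL : ∀ k, 0 ≤ levelProb lam k := levelProb_nonneg hlam
  have hsum := sum_levelProb hlam
  have hn3 : (3 : ℝ) ≤ n := by exact_mod_cast hn
  have hn2 : 2 ≤ n := by omega
  have h1 : 0 < levelProb lam 1 := Real.sqrt_pos.1 (hε.trans_le hε1)
  have hsq : ε ^ 2 ≤ levelProb lam 1 := (Real.le_sqrt hε.le h1.le).1 hε1
  have hl1 : levelProb lam 1 ≤ 1 := by
    rw [← hsum]
    exact Finset.single_le_sum (fun k _ => hL k) (Finset.mem_range.2 (by omega))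
  have hε_le : ε ≤ 1 := by nlinarith
  have hM : 1 ≤ ⌈1 / ε⌉₊ := Nat.one_le_ceil_iff.2 (by positivity)
  have hMle : 1 / ε ≤ (⌈1 / ε⌉₊ : ℝ) := Nat.le_ceil _
  have hMlt : (⌈1 / ε⌉₊ : ℝ) < 1 / ε + 1 := Nat.ceil_lt_add_one (by positivity)
  set M := ⌈1 / ε⌉₊
  have hMε : 1 ≤ M * ε := (div_le_iff₀ hε).1 hMle
  have hM1 : (1 : ℝ) ≤ M := by exact_mod_cast hM
  rw [le_div_iff₀ h1] at hεn
  have hle : levelProb lam 1 ≤ 4 * M * levelProb lam n := by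
    have e1 := mul_le_mul_of_nonneg_left hεn (by positivity : (0 : ℝ) ≤ M)
    have e2 := mul_le_mul_of_nonneg_right hMε h1.le
    linarith
  have hln : 0 < levelProb lam n := by have := mul_pos hε h1; linarith
  have hS : 0 < surplusMass n (levelProb lam) :=
    (mul_pos (by linarith : (0 : ℝ) < (n : ℝ) - 2) hln).trans_le (mul_le_surplusMass hn2 hL)
  refine ⟨exists_linSys hn h0 h1 hS, ?_⟩
  obtain ⟨D, m, ⟨t, hrun, ht⟩, hIR, hrev⟩ := hD n hn lam hlam h0 h1 q hq M hM hle
  refine ⟨D, t, m, hrun, ?_, hIR, fun a b hab => ?_⟩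
  -- The factor 2 covers the rounding: `M < 1/ε + 1 ≤ 2/ε`.
  · have hX : ((n + ∑ k ∈ Finset.range (n + 1), bitComplexity (q k) + M : ℕ) : ℝ) ≤
        2 * ((n : ℝ) + (∑ k ∈ Finset.range (n + 1), (bitComplexity (q k) : ℝ)) + 1 / ε) := by
      have h2 : 1 ≤ 1 / ε := by rw [le_div_iff₀ hε]; linarith
      have h3 : (0 : ℝ) ≤ ∑ k ∈ Finset.range (n + 1), (bitComplexity (q k) : ℝ) := by positivity
      push_cast
      linarith
    have h4 := Code.bitBound_pow_le (d := d) (by omega) hX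
    calc (t : ℝ) ≤ w * ((Code.bitBound _ ^ d : ℕ) : ℝ) := by exact_mod_cast ht
      _ ≤ w * (((10 * 2 ^ 10) ^ d : ℕ) * _) := by gcongr
      _ = _ := by push_cast; ring
  have hO := hab.isOptSplit h0 h1 hS
  have hrev := hrev _ hO
  have hub : ∀ p ∈ calibratedIR lam, _ := fun p hp => revenue_le_splitValue hn2 hlam h0 h1 hO hp
  have hn0 : (0 : ℝ) < n := by linarith
  refine ⟨fun hcase p hp => ?_, fun hcase => ⟨hab.exists_reduction h0 h1 hS hcase,
    fun c hc hεc => ?_⟩⟩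
  · have hsmall : 1 / (2 * (n : ℝ) ^ 2 * (M : ℝ) ^ 7) ≤ ε := by
      have e1 : (M : ℝ) ≤ 2 * (n : ℝ) ^ 2 * (M : ℝ) ^ 7 := by
        have e2 : (M : ℝ) ≤ (M : ℝ) ^ 7 := le_self_pow₀ hM1 (by norm_num)
        have e3 : 1 ≤ 2 * (n : ℝ) ^ 2 := by nlinarith
        nlinarith
      rw [div_le_iff₀ (by positivity)]
      nlinarith
    -- The first case says that the split value is at most `λ_1`, so the minimum in `hrev` is its
    -- second entry, within `ε` of the dual bound.
    have hF : splitValue (levelProb lam 0) (levelProb lam 1) (clickSum n (levelProb lam) a)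
        (surplusMass n (levelProb lam) - clickSum n (levelProb lam) a) ≤ levelProb lam 1 := by
      rw [hab.splitValue_eq]
      rw [le_div_iff₀ h0] at hcase
      linarith
    have := hub p hp
    have : splitValue (levelProb lam 0) (levelProb lam 1) (clickSum n (levelProb lam) a)
        (surplusMass n (levelProb lam) - clickSum n (levelProb lam) a) -
          1 / (2 * (n : ℝ) ^ 2 * (M : ℝ) ^ 7) ≤ levelProb lam 1 :=
      (sub_le_self _ (by positivity)).trans hF
    rw [min_eq_right this] at hrev
    linarith
  · have hgap := hab.gap hn2 hL h0 h1 hS hc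
    have hAS : clickSum n (levelProb lam) a ≤ n - 2 :=
      (by linarith [hO.pos] : clickSum n (levelProb lam) a ≤ surplusMass n (levelProb lam)).trans
        (surplusMass_le hn2 hL hsum)
    have hpow := pow_mul_le_gap (by omega) hM hε hMε hsq hO.nonneg (n := n)
      (A := clickSum n (levelProb lam) a) (by linarith)
    have hred : ε * levelProb lam 1 / 2 ≤ n * levelProb lam n * (b n - c n) := by
      rw [div_mul_eq_mul_div, le_div_iff₀ h1] at hεc
      linarith
    have hred' := mul_le_mul_of_nonneg_left hred
      (sq_nonneg (levelProb lam 1 / (2 * levelProb lam 1 + clickSum n (levelProb lam) a)))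
    -- The discretization loss is at most the gap above `λ_1`, so the minimum in `hrev` is `λ_1` and
    -- the full welfare is extracted.
    rw [min_eq_left (by linarith), ← welfare_eq (by omega)] at hrev
    have hopt : ∀ p ∈ calibratedIR lam, revenue lam p ≤ welfare lam :=
      fun p hp => revenue_le_welfare hn2 hlam hp
    exact ⟨(hopt _ hIR).antisymm hrev, fun p hp => (hopt p hp).trans hrev⟩
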